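/- Let $\mathfrak g$ be a finite-dimensional complex Lie algebra. For $x\in\mathfrak g^*$ let $\mathcal A_x(\xi,\eta)=\langle x,[\xi,\eta]\rangle$, a skew-symmetric bilinear form on $\mathfrak g$. By the Jordan–Kronecker theorem, for any $x,a\in\mathfrak g^*$ there is a basis of $\mathfrak g$ in which the matrices of $\mathcal A_x$ and $\mathcal A_a$ are simultaneously block-diagonal, the pairs of diagonal blocks being $$\left(\begin{pmatrix}0&C\\-C^{T}&0\end{pmatrix},\begin{pmatrix}0&D\\-D^{T}&0\end{pmatrix}\right)$$ with one of the following pairs $(C,D)$, where $J_n(\mu)$ is the upper triangular $n\times n$ Jordan block with eigenvalue $\mu$ and $I_n$ is the identity matrix: $(J_n(\mu),I_n)$ with $n\ge1$ (Jordan block of size $2n$ with eigenvalue $\mu\in\mathbb C$); $(I_n,J_n(0))$ with $n\ge1$ (Jordan block of size $2n$ with eigenvalue $\infty$); or the $(k-1)\times k$ matrices $C=(I_{k-1}\mid 0)$, $D=(0\mid I_{k-1})$ with $k\ge1$ (Kronecker block of size $2k-1$). The algebraic type of the pencil $\mathcal A_x+\lambda\mathcal A_a$ is the multiset which contains, for each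 distinct eigenvalue $\mu\in\mathbb C\cup\{\infty\}$ of its Jordan blocks, the tuple, in descending order, of the sizes of all Jordan blocks with eigenvalue $\mu$ (a Jordan tuple; the value of $\mu$ is forgotten), together with the sizes of all Kronecker blocks. The Jordan–Kronecker invariants $\operatorname{JK}(\mathfrak g)$ are the common algebraic type of the pencils $\mathcal A_x+\lambda\mathcal A_a$ for all $(x,a)$ in some non-empty Zariski open subset of $\mathfrak g^*\times\mathfrak g^*$. **Theorem.** Let $\mathfrak g_1,\mathfrak g_2$ be finite-dimensional complex Lie algebras. Then $\operatorname{JK}(\mathfrak g_1)$, $\operatorname{JK}(\mathfrak g_2)$ and $\operatorname{JK}(\mathfrak g_1\oplus\mathfrak g_2)$ are well defined (the generic algebraic type exists and is unique) and $$\operatorname{JK}(\mathfrak g_1\oplus\mathfrak g_2)=\operatorname{JK}(\mathfrak g_1)\cup\operatorname{JK}(\mathfrak g_2)$$ as a union of multisets (multiplicities add). Moreover, Jordan tuples coming from different summands have different eigenvalues: there is a non-empty Zariski open set $U$ of pairs $(x,a)$, $x=(x_1,x_2)$, $a=(a_1,a_2)$, in $(\mathfrak g_1\oplus\mathfrak g_2)^*\times(\mathfrak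 g_1\oplus\mathfrak g_2)^*$ such that for every $(x,a)\in U$ the pencils $\mathcal A_{x_i}+\lambda\mathcal A_{a_i}$ on $\mathfrak g_i$ have algebraic type $\operatorname{JK}(\mathfrak g_i)$ $(i=1,2)$, the blocks of any Jordan–Kronecker decomposition of the first pencil together with those of any decomposition of the second are the blocks of a Jordan–Kronecker decomposition of $\mathcal A_x+\lambda\mathcal A_a$, whose algebraic type is $\operatorname{JK}(\mathfrak g_1\oplus\mathfrak g_2)$, and no eigenvalue of a Jordan block of the first pencil is an eigenvalue of a Jordan block of the second. -/

import Mathlib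

/-! ### Blocks of the Jordan-Kronecker normal form -/

/-- The blocks of the Jordan-Kronecker theorem:
`jordan μ n` is the `2n × 2n` Jordan block with the finite eigenvalue `μ`,
`jordanInf n` is the `2n × 2n` Jordan block with eigenvalue `∞`,
`kronecker m` is the `(2m+1) × (2m+1)` Kronecker block (Kronecker index `k = m + 1`). -/
inductive JKBlock (K : Type*) where
  | jordan (μ : K) (n : ℕ+) : JKBlock K
  | jordanInf (n : ℕ+) : JKBlock K
  | kronecker (m : ℕ) : JKBlock K

namespace JKBlock

variable {K : Type*}

/-- Number of rows of the upper right quarter of the block. -/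
def rows : JKBlock K → ℕ
  | jordan _ n => n
  | jordanInf n => n
  | kronecker m => m

/-- Number of columns of the upper right quarter of the block. -/
def cols : JKBlock K → ℕ
  | jordan _ n => n
  | jordanInf n => n
  | kronecker m => m + 1

/-- The size of the (square) block: `2n` for Jordan blocks, `2m + 1` for Kronecker blocks. -/
def size (b : JKBlock K) : ℕ := b.rows + b.cols

/-- The index type of the standard basis of a block. -/
abbrev Index (b : JKBlock K) : Type := Fin b.rows ⊕ Fin b.cols

/-- The eigenvalue of a Jordan block, an element of `K ∪ {∞}`; Kronecker blocks have none. -/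
def eigenvalue? : JKBlock K → Option (OnePoint K)
  | jordan μ _ => some (μ : OnePoint K)
  | jordanInf _ => some OnePoint.infty
  | kronecker _ => none

/-- The entry `(i, j)` of the upper right quarter of the first matrix of the block. -/
def entryA [Field K] : JKBlock K → ℕ → ℕ → K
  | jordan μ _, i, j => if j = i then μ else if j = i + 1 then 1 else 0
  | jordanInf _, i, j => if j = i then 1 else 0
  | kronecker _, i, j => if j = i then 1 else 0

/-- The entry `(i, j)` of the upper right quarter of the second matrix of the block. -/
def entryB [Field K] : JKBlock K → ℕ → ℕ → K
  | jordan _ _, i, j => if j = i then 1 else 0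
  | jordanInf _, i, j => if j = i + 1 then 1 else 0
  | kronecker _, i, j => if j = i + 1 then 1 else 0

/-- The skew-symmetric matrix with vanishing diagonal quarters and the given upper right
quarter. -/
def skewMatrix [Field K] (b : JKBlock K) (c : ℕ → ℕ → K) : Matrix b.Index b.Index K :=
  Matrix.fromBlocks 0 (Matrix.of fun i j => c i j) (Matrix.of fun j i => -c i j) 0

/-- The matrix of the first form of the pencil in the standard basis of the block. -/
def matrixA [Field K] (b : JKBlock K) : Matrix b.Index b.Index K := b.skewMatrix b.entryA

/-- The matrix of the second form of the pencil in the standard basis of the block. -/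
def matrixB [Field K] (b : JKBlock K) : Matrix b.Index b.Index K := b.skewMatrix b.entryB

end JKBlock

/-! ### Jordan-Kronecker decompositions of a pair of forms -/

/-- The pencil `A + λB` on `V` has a Jordan-Kronecker decomposition whose multiset of blocks
is `s`: in a suitable basis both forms are block-diagonal with these standard blocks. -/
def HasJKBlocks {K V : Type*} [Field K] [AddCommGroup V] [Module K V]
    (A B : LinearMap.BilinForm K V) (s : Multiset (JKBlock K)) : Prop :=
  ∃ (N : ℕ) (b : Fin N → JKBlock K) (e : Module.Basis (Σ i, (b i).Index) K V),
    s = Multiset.map b Finset.univ.val ∧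
    LinearMap.BilinForm.toMatrix e A = Matrix.blockDiagonal' (fun i => (b i).matrixA) ∧
    LinearMap.BilinForm.toMatrix e B = Matrix.blockDiagonal' (fun i => (b i).matrixB)

/-- An element of an algebraic type: a tuple of sizes of all Jordan blocks with a common
eigenvalue, or the size of one Kronecker block. -/
inductive JKInvariant where
  | jordanTuple (sizes : List ℕ) : JKInvariant
  | kroneckerSize (size : ℕ) : JKInvariant

open Classical in
/-- The (finite) set of eigenvalues of the Jordan blocks in `s`. -/
noncomputable def jkEigenvalues {K : Type*} (s : Multiset (JKBlock K)) : Finset (OnePoint K) :=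
  (s.filterMap JKBlock.eigenvalue?).toFinset

open Classical in
/-- The sizes of the Jordan blocks in `s` with eigenvalue `μ`, in descending order. -/
noncomputable def jordanSizes {K : Type*} (s : Multiset (JKBlock K)) (μ : OnePoint K) :
    List ℕ :=
  ((s.filter fun b => b.eigenvalue? = some μ).map JKBlock.size).sort (· ≥ ·)

open Classical in
/-- The sizes of the Kronecker blocks in `s`. -/
noncomputable def kroneckerSizes {K : Type*} (s : Multiset (JKBlock K)) : Multiset ℕ :=
  (s.filter fun b => b.eigenvalue? = none).map JKBlock.size

/-- The algebraic type: one Jordan tuple for every eigenvalue (whose value is forgotten), and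
the sizes of the Kronecker blocks. -/
noncomputable def algebraicType {K : Type*} (s : Multiset (JKBlock K)) : Multiset JKInvariant :=
  (jkEigenvalues s).val.map (fun μ => JKInvariant.jordanTuple (jordanSizes s μ)) +
    (kroneckerSizes s).map JKInvariant.kroneckerSize

/-- The pencil `A + λB` has algebraic type `T`. -/
def HasAlgebraicType {K V : Type*} [Field K] [AddCommGroup V] [Module K V]
    (A B : LinearMap.BilinForm K V) (T : Multiset JKInvariant) : Prop :=
  ∃ s : Multiset (JKBlock K), HasJKBlocks A B s ∧ algebraicType s = T

/-! ### Jordan-Kronecker invariants of Lie algebras -/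

/-- Zariski open subsets of a vector space `E`: complements of common zero sets of families of
polynomial functions, written without coordinates as polynomials in linear functionals. -/
def IsZariskiOpen (K : Type*) {E : Type*} [Field K] [AddCommGroup E] [Module K E]
    (U : Set E) : Prop :=
  ∃ S : Set (MvPolynomial (Module.Dual K E) K),
    U = {v | ∃ p ∈ S, MvPolynomial.eval (fun φ : Module.Dual K E => φ v) p ≠ 0}

/-- The skew-symmetric form `𝒜ₓ(ξ, η) = ⟨x, [ξ, η]⟩` on a Lie algebra, for `x` in its dual. -/
def lieForm {K L : Type*} [Field K] [LieRing L] [LieAlgebra K L] (x : Module.Dual K L) :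
    LinearMap.BilinForm K L :=
  LinearMap.mk₂ K (fun ξ η : L => x ⁅ξ, η⁆) (by simp) (by simp) (by simp) (by simp)

/-- `T` is the algebraic type of the pencils `𝒜ₓ + λ𝒜ₐ` for all `(x, a)` in some non-empty
Zariski open subset of `L* × L*`. -/
def IsGenericJKType (L : Type*) [LieRing L] [LieAlgebra ℂ L] (T : Multiset JKInvariant) : Prop :=
  ∃ U : Set (Module.Dual ℂ L × Module.Dual ℂ L), IsZariskiOpen ℂ U ∧ U.Nonempty ∧
    ∀ p ∈ U, HasAlgebraicType (lieForm p.1) (lieForm p.2) T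

open Classical in
/-- The Jordan-Kronecker invariants `JK(L)` of a Lie algebra `L`: the algebraic type of a generic
pencil `𝒜ₓ + λ𝒜ₐ` (by convention empty if there were none). -/
noncomputable def jkInvariants (L : Type*) [LieRing L] [LieAlgebra ℂ L] : Multiset JKInvariant :=
  if h : ∃ T, IsGenericJKType L T then h.choose else 0

/-! The blocks of two pencils together decompose their orthogonal sum (`HasJKBlocks.add`). What
needs proof is that a generic type exists and is unique, and that generically the two summands share
no eigenvalue, since only then do the Jordan tuples stay apart.

Existence (`exists_isGenericJKType`). The coordinates of (x, a) are treated as indeterminates, and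
the Jordan–Kronecker theorem (`exists_hasJKBlocks`) is applied to the resulting pencil over an
algebraic closure Ω of the field of rational functions. Its decomposition involves finitely many
elements of Ω: eigenvalues, inverses of their differences, and the entries of a transition matrix
and of its inverse. Integrality and lying over evaluate all of them at every point of a non-empty
basic open set (`exists_specialization`), and the evaluated decomposition has the same type
(`HasJKBlocks.specialize`).

Uniqueness (`HasJKBlocks.algebraicType_eq`). For forms f, g of the pencil, consider the finite
sequences with f u_i = g u_(i+1). With the extra condition g u_0 = 0 these are polynomial kernel
vectors of bounded degree, and their dimensions give the Kronecker sizes; without it, and with f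
degenerate at μ, they give the Jordan sizes at μ. So a pencil has one type, and two non-empty
Zariski open sets meet.

The Jordan–Kronecker theorem itself is proved by induction on the dimension. A polynomial kernel
vector of minimal degree and a dual chain split off a Kronecker block. Without polynomial kernel,
either one of the two forms is non-degenerate and Jordan chains of G⁻¹H split off a Jordan block, or
the Fitting decomposition of such an operator cuts the space in two.

Additivity. From a generic point, replacing a₁ by a₁ + t x₁ removes the eigenvalue ∞ of the first
pencil, and then replacing x₁ by x₁ + u a₁ translates its eigenvalues by u, while the second pencil
stays fixed. All but finitely many t and u remain in the open set and avoid collisions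
(`exists_disjoint_jkEigenvalues`). One such point proves the formula for the invariants. The formula
then forces disjoint eigenvalues on the whole open set, because the number of Jordan tuples is the
number of distinct eigenvalues. -/

/-! ### Assembling and splitting off blocks -/

open Matrix in
theorem hasJKBlocks_of_basis {K V ι : Type*} [Field K] [AddCommGroup V] [Module K V] [Fintype ι]
    [DecidableEq ι] {A B : LinearMap.BilinForm K V} (b : ι → JKBlock K)
    (e : Module.Basis (Σ i, (b i).Index) K V)
    (hA : ∀ p q, A (e p) (e q) = blockDiagonal' (fun i => (b i).matrixA) p q)
    (hB : ∀ p q, B (e p) (e q) = blockDiagonal' (fun i => (b i).matrixB) p q) :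
    HasJKBlocks A B (Finset.univ.val.map b) := by
  -- `HasJKBlocks` numbers the blocks by `Fin N`; the enumeration σ makes any finite index type
  -- admissible.
  let σ : Fin (Fintype.card ι) ≃ ι := (Fintype.equivFin ι).symm
  let τ : (Σ i, (b (σ i)).Index) ≃ Σ i, (b i).Index :=
    Equiv.sigmaCongrLeft (β := fun i => (b i).Index) σ
  have key : ∀ (M : ∀ i, Matrix (b i).Index (b i).Index K) p q,
      blockDiagonal' M (τ p) (τ q) = blockDiagonal' (fun i => M (σ i)) p q := by
    rintro M ⟨i, p⟩ ⟨j, q⟩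
    by_cases h : i = j
    · subst h
      simp [τ, blockDiagonal'_apply_eq]
    · rw [blockDiagonal'_apply_ne _ _ _ h]
      exact blockDiagonal'_apply_ne _ _ _ (fun h' => h (σ.injective h'))
  refine ⟨Fintype.card ι, b ∘ σ, e.reindex τ.symm, ?_, ?_, ?_⟩
  · have h1 : (Finset.univ : Finset ι) = Finset.univ.map σ.toEmbedding := by simp
    rw [h1, Finset.map_val, Multiset.map_map]
    rfl
  · ext p q
    rw [LinearMap.BilinForm.toMatrix_apply, Module.Basis.reindex_apply,
      Module.Basis.reindex_apply, Equiv.symm_symm, hA, key]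
    rfl
  · ext p q
    rw [LinearMap.BilinForm.toMatrix_apply, Module.Basis.reindex_apply,
      Module.Basis.reindex_apply, Equiv.symm_symm, hB, key]
    rfl

theorem hasJKBlocks_zero {K V : Type*} [Field K] [AddCommGroup V] [Module K V] [Subsingleton V]
    (A B : LinearMap.BilinForm K V) : HasJKBlocks A B 0 := by
  let b : Empty → JKBlock K := fun i => i.elim
  have : IsEmpty (Σ i, (b i).Index) := ⟨fun p => p.1.elim⟩
  exact hasJKBlocks_of_basis b (Module.Basis.empty V) (fun p => isEmptyElim p)
    (fun p => isEmptyElim p)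

theorem hasJKBlocks_singleton {K V : Type*} [Field K] [AddCommGroup V] [Module K V]
    {A B : LinearMap.BilinForm K V} (b : JKBlock K) (e : Module.Basis b.Index K V)
    (hA : ∀ p q, A (e p) (e q) = b.matrixA p q) (hB : ∀ p q, B (e p) (e q) = b.matrixB p q) :
    HasJKBlocks A B {b} := by
  have := hasJKBlocks_of_basis (A := A) (B := B) (fun _ : Unit => b)
    (e.reindex (Equiv.uniqueSigma (fun _ : Unit => b.Index)).symm)
    (by
      rintro ⟨⟨⟩, p⟩ ⟨⟨⟩, q⟩
      rw [Matrix.blockDiagonal'_apply_eq, Module.Basis.reindex_apply, Module.Basis.reindex_apply]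
      exact hA p q)
    (by
      rintro ⟨⟨⟩, p⟩ ⟨⟨⟩, q⟩
      rw [Matrix.blockDiagonal'_apply_eq, Module.Basis.reindex_apply, Module.Basis.reindex_apply]
      exact hB p q)
  simpa using this

/-- The blocks of an orthogonal direct sum of two pencils are the blocks of the summands. -/
theorem HasJKBlocks.add {K V V₁ V₂ : Type*} [Field K] [AddCommGroup V] [Module K V]
    [AddCommGroup V₁] [Module K V₁] [AddCommGroup V₂] [Module K V₂]
    {A B : LinearMap.BilinForm K V} {A₁ B₁ : LinearMap.BilinForm K V₁}
    {A₂ B₂ : LinearMap.BilinForm K V₂} (f : (V₁ × V₂) ≃ₗ[K] V)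
    (hA : ∀ x y, A (f x) (f y) = A₁ x.1 y.1 + A₂ x.2 y.2)
    (hB : ∀ x y, B (f x) (f y) = B₁ x.1 y.1 + B₂ x.2 y.2)
    {s₁ s₂ : Multiset (JKBlock K)} (h₁ : HasJKBlocks A₁ B₁ s₁) (h₂ : HasJKBlocks A₂ B₂ s₂) :
    HasJKBlocks A B (s₁ + s₂) := by
  obtain ⟨N₁, b₁, e₁, rfl, hA₁, hB₁⟩ := h₁
  obtain ⟨N₂, b₂, e₂, rfl, hA₂, hB₂⟩ := h₂
  have hs : Finset.univ.val.map b₁ + Finset.univ.val.map b₂ =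
      Finset.univ.val.map (Sum.elim b₁ b₂) := by
    rw [← Finset.univ_disjSum_univ, Finset.val_disjSum, Multiset.disjSum, Multiset.map_add,
      Multiset.map_map, Multiset.map_map]
    rfl
  rw [hs]
  let τ : (Σ i, (Sum.elim b₁ b₂ i).Index) ≃ (Σ i, (b₁ i).Index) ⊕ (Σ i, (b₂ i).Index) :=
    Equiv.sumSigmaDistrib (fun i => (Sum.elim b₁ b₂ i).Index)
  let e : Module.Basis (Σ i, (Sum.elim b₁ b₂ i).Index) K V := ((e₁.prod e₂).map f).reindex τ.symm
  have key : ∀ (C : LinearMap.BilinForm K V) (C₁ : LinearMap.BilinForm K V₁)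
      (C₂ : LinearMap.BilinForm K V₂) (M : ∀ b : JKBlock K, Matrix b.Index b.Index K),
      (∀ x y, C (f x) (f y) = C₁ x.1 y.1 + C₂ x.2 y.2) →
      LinearMap.BilinForm.toMatrix e₁ C₁ = Matrix.blockDiagonal' (fun i => M (b₁ i)) →
      LinearMap.BilinForm.toMatrix e₂ C₂ = Matrix.blockDiagonal' (fun i => M (b₂ i)) →
      ∀ p q, C (e p) (e q) = Matrix.blockDiagonal' (fun i => M (Sum.elim b₁ b₂ i)) p q := by
    intro C C₁ C₂ M hC hC₁ hC₂ p q
    have h1 : ∀ p q, C₁ (e₁ p) (e₁ q) = Matrix.blockDiagonal' (fun i => M (b₁ i)) p q := by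
      intro p q; rw [← hC₁, LinearMap.BilinForm.toMatrix_apply]
    have h2 : ∀ p q, C₂ (e₂ p) (e₂ q) = Matrix.blockDiagonal' (fun i => M (b₂ i)) p q := by
      intro p q; rw [← hC₂, LinearMap.BilinForm.toMatrix_apply]
    have el : ∀ i (p : (b₁ i).Index), e ⟨Sum.inl i, p⟩ = f (e₁ ⟨i, p⟩, 0) := by
      intro i p
      refine (Module.Basis.reindex_apply _ _ _).trans ?_
      rw [Equiv.symm_symm, Module.Basis.map_apply]
      exact congrArg f (Prod.ext (Module.Basis.prod_apply_inl_fst _ _ _)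
        (Module.Basis.prod_apply_inl_snd _ _ _))
    have er : ∀ i (p : (b₂ i).Index), e ⟨Sum.inr i, p⟩ = f (0, e₂ ⟨i, p⟩) := by
      intro i p
      refine (Module.Basis.reindex_apply _ _ _).trans ?_
      rw [Equiv.symm_symm, Module.Basis.map_apply]
      exact congrArg f (Prod.ext (Module.Basis.prod_apply_inr_fst _ _ _)
        (Module.Basis.prod_apply_inr_snd _ _ _))
    let D := Matrix.blockDiagonal' (fun i => M (Sum.elim b₁ b₂ i))
    have dl : ∀ i (p : (b₁ i).Index) j (q : (b₁ j).Index), C₁ (e₁ ⟨i, p⟩) (e₁ ⟨j, q⟩) =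
        D ⟨Sum.inl i, p⟩ ⟨Sum.inl j, q⟩ := by
      intro i p j q
      rw [h1]
      by_cases h : i = j
      · subst h
        exact (Matrix.blockDiagonal'_apply_eq _ _ _ _).trans
          (Matrix.blockDiagonal'_apply_eq (fun i => M (Sum.elim b₁ b₂ i)) (Sum.inl i) _ _).symm
      · exact (Matrix.blockDiagonal'_apply_ne _ _ _ h).trans
          (Matrix.blockDiagonal'_apply_ne (fun i => M (Sum.elim b₁ b₂ i)) _ _
            (by simpa using h)).symm
    have dr : ∀ i (p : (b₂ i).Index) j (q : (b₂ j).Index), C₂ (e₂ ⟨i, p⟩) (e₂ ⟨j, q⟩) =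
        D ⟨Sum.inr i, p⟩ ⟨Sum.inr j, q⟩ := by
      intro i p j q
      rw [h2]
      by_cases h : i = j
      · subst h
        exact (Matrix.blockDiagonal'_apply_eq _ _ _ _).trans
          (Matrix.blockDiagonal'_apply_eq (fun i => M (Sum.elim b₁ b₂ i)) (Sum.inr i) _ _).symm
      · exact (Matrix.blockDiagonal'_apply_ne _ _ _ h).trans
          (Matrix.blockDiagonal'_apply_ne (fun i => M (Sum.elim b₁ b₂ i)) _ _
            (by simpa using h)).symm
    obtain ⟨i | i, p⟩ := p <;> obtain ⟨j | j, q⟩ := q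
    · refine (congrArg₂ (fun x y => C x y) (el i p) (el j q)).trans ((hC _ _).trans ?_)
      refine Eq.trans ?_ (dl i p j q)
      simp
    · refine (congrArg₂ (fun x y => C x y) (el i p) (er j q)).trans ((hC _ _).trans ?_)
      refine Eq.trans ?_ (Matrix.blockDiagonal'_apply_ne _ _ _ (by simp)).symm
      simp
    · refine (congrArg₂ (fun x y => C x y) (er i p) (el j q)).trans ((hC _ _).trans ?_)
      refine Eq.trans ?_ (Matrix.blockDiagonal'_apply_ne _ _ _ (by simp)).symm
      simp
    · refine (congrArg₂ (fun x y => C x y) (er i p) (er j q)).trans ((hC _ _).trans ?_)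
      refine Eq.trans ?_ (dr i p j q)
      simp
  exact hasJKBlocks_of_basis _ e (key A A₁ A₂ _ hA hA₁ hA₂) (key B B₁ B₂ _ hB hB₁ hB₂)

/-- A family `e` spanning a standard block, together with a dual family of functionals whose
common kernel is orthogonal to `e`, splits off the block. -/
theorem HasJKBlocks.cons {K V : Type*} [Field K] [AddCommGroup V] [Module K V]
    {A B : LinearMap.BilinForm K V} (hAalt : A.IsAlt) (hBalt : B.IsAlt)
    (b : JKBlock K) (e : b.Index → V) (ψ : b.Index → Module.Dual K V)
    (hA : ∀ p q, A (e p) (e q) = b.matrixA p q) (hB : ∀ p q, B (e p) (e q) = b.matrixB p q)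
    (hψ : ∀ p q, ψ p (e q) = if p = q then 1 else 0)
    (hort : ∀ x, (∀ p, ψ p x = 0) → ∀ p, A (e p) x = 0 ∧ B (e p) x = 0)
    {W : Submodule K V} (hW : ∀ x, x ∈ W ↔ ∀ p, ψ p x = 0)
    {s : Multiset (JKBlock K)} (hs : HasJKBlocks (A.restrict W) (B.restrict W) s) :
    HasJKBlocks A B (b ::ₘ s) := by
  let g : (b.Index → K) →ₗ[K] V := Fintype.linearCombination K e
  have hg : ∀ c, g c = ∑ p, c p • e p := fun c => Fintype.linearCombination_apply K e c
  have hψg : ∀ p c, ψ p (g c) = c p := by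
    intro p c
    rw [hg]; simp [hψ, -Fintype.sum_sum_type]
  -- The functionals ψ read off coordinates along `e`, so V is the direct sum of the span of `e` and
  -- W; `hort` makes the sum orthogonal for both forms.
  let F : ((b.Index → K) × W) →ₗ[K] V := LinearMap.coprod g W.subtype
  have hF : Function.Bijective F := by
    constructor
    · rw [← LinearMap.ker_eq_bot, LinearMap.ker_eq_bot']
      rintro ⟨c, w⟩ h
      have h0 : g c + (w : V) = 0 := h
      have hc : c = 0 := by
        ext p
        have := congrArg (ψ p) h0
        rwa [map_add, hψg, (hW _).1 w.2 p, map_zero, add_zero] at this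
      subst hc
      simpa using h0
    · intro x
      refine ⟨(fun p => ψ p x, ⟨x - g (fun p => ψ p x), (hW _).2 fun p => ?_⟩), ?_⟩
      · rw [map_sub, hψg, sub_self]
      · simp [F]
  let f := LinearEquiv.ofBijective F hF
  have hf : ∀ x, f x = g x.1 + x.2 := fun x => rfl
  have key : ∀ (C : LinearMap.BilinForm K V) (M : Matrix b.Index b.Index K),
      (∀ p q, C (e p) (e q) = M p q) → C.IsAlt →
      (∀ x, (∀ p, ψ p x = 0) → ∀ p, C (e p) x = 0) →
      ∀ x y, C (f x) (f y) = Matrix.toBilin' M x.1 y.1 + C.restrict W x.2 y.2 := by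
    intro C M hM halt ho x y
    have h1 : ∀ c (w : W), C (g c) w = 0 := by
      intro c w
      rw [hg]; simp [ho w ((hW _).1 w.2)]
    have h2 : ∀ c (w : W), C w (g c) = 0 := by
      intro c w
      rw [← halt.neg_eq, h1, neg_zero]
    have h3 : ∀ c d, C (g c) (g d) = Matrix.toBilin' M c d := by
      intro c d
      rw [hg, hg, Matrix.toBilin'_apply]
      simp only [map_sum, LinearMap.sum_apply, map_smul, LinearMap.smul_apply, smul_eq_mul, hM]
      rw [Finset.sum_comm]
      refine Finset.sum_congr rfl fun q _ => ?_
      rw [Finset.mul_sum]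
      exact Finset.sum_congr rfl fun p _ => by ring
    rw [hf, hf, map_add, map_add, LinearMap.add_apply, LinearMap.add_apply, h1, h2, h3]
    simp
  rw [← Multiset.singleton_add]
  refine HasJKBlocks.add f
    (key A _ hA hAalt fun x hx p => (hort x hx p).1)
    (key B _ hB hBalt fun x hx p => (hort x hx p).2) ?_ hs
  exact hasJKBlocks_singleton b (Pi.basisFun K b.Index) (by simp) (by simp)

/-! ### Splitting off a Kronecker block -/

/-- Sequences `u` with `f (u i) = g (u (i + 1))` for all `i` which vanish from `n` on. -/
def chainSpace {K X Y : Type*} [Field K] [AddCommGroup X] [Module K X] [AddCommGroup Y]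
    [Module K Y] (f g : X →ₗ[K] Y) (n : ℕ) : Submodule K (ℕ → X) where
  carrier := {u | (∀ i, n ≤ i → u i = 0) ∧ ∀ i, f (u i) = g (u (i + 1))}
  add_mem' := fun hu hv => ⟨fun i hi => by simp [hu.1 i hi, hv.1 i hi],
    fun i => by simp [hu.2 i, hv.2 i]⟩
  zero_mem' := ⟨fun _ _ => rfl, fun _ => by simp⟩
  smul_mem' := fun c u hu => ⟨fun i hi => by simp [hu.1 i hi], fun i => by simp [hu.2 i]⟩

/-- The coefficient sequences of the polynomial vectors `u` of degree less than `n` with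
`g u = λ f u`. -/
def kernelSpace {K X Y : Type*} [Field K] [AddCommGroup X] [Module K X] [AddCommGroup Y]
    [Module K Y] (f g : X →ₗ[K] Y) (n : ℕ) : Submodule K (ℕ → X) where
  carrier := {u | u ∈ chainSpace f g n ∧ g (u 0) = 0}
  add_mem' := fun hu hv => ⟨add_mem hu.1 hv.1, by simp [hu.2, hv.2]⟩
  zero_mem' := ⟨zero_mem _, by simp⟩
  smul_mem' := fun c u hu => ⟨Submodule.smul_mem _ c hu.1, by simp [hu.2]⟩

/-- The Fredholm alternative: it turns solvability of a linear system into a statement about the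
functionals that annihilate its left side. -/
theorem LinearMap.mem_range_of_forall_dual {K X Y : Type*} [Field K] [AddCommGroup X]
    [Module K X] [AddCommGroup Y] [Module K Y] (Θ : X →ₗ[K] Y) (t : Y)
    (h : ∀ f : Module.Dual K Y, (∀ x, f (Θ x) = 0) → f t = 0) : t ∈ LinearMap.range Θ := by
  by_contra ht
  obtain ⟨f, hft, hf⟩ := Submodule.exists_dual_map_eq_bot_of_notMem ht inferInstance
  refine hft (h f fun x => ?_)
  have : f (Θ x) ∈ Submodule.map f (LinearMap.range Θ) := ⟨Θ x, ⟨x, rfl⟩, rfl⟩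
  rwa [hf, Submodule.mem_bot] at this

/-- A relation which forces the trace of `c` to vanish when the pencil has no polynomial
solution of degree less than `m`. -/
theorem trace_eq_zero_of_kernelSpace_eq_bot {K X Y : Type*} [Field K] [AddCommGroup X]
    [Module K X] [AddCommGroup Y] [Module K Y] (f g : X →ₗ[K] Y) (m : ℕ) (v : ℕ → X)
    (hv : v ∈ kernelSpace f g (m + 1)) (hv0 : v 0 ≠ 0) (hbot : kernelSpace f g m = ⊥)
    (z : ℕ → X) (c : Fin m → Fin m → K) (hz0 : z 0 = 0) (hz : ∀ i, m ≤ i → z i = 0)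
    (hrel : ∀ k : Fin m, f (z k) - g (z (k + 1)) + ∑ j, c k j • f (v j) = 0) :
    ∑ k, c k k = 0 := by
  -- Extending `v` by zero to negative indices allows arbitrary shifts; the recurrence survives at
  -- -1 because g (v 0) = 0.
  let vz : ℤ → X := fun i => if 0 ≤ i then v i.toNat else 0
  have vz_neg : ∀ i : ℤ, i < 0 → vz i = 0 := fun i hi => if_neg (by omega)
  have vz_nat : ∀ i : ℕ, vz i = v i := fun i => by simp [vz]
  have vz_big : ∀ i : ℤ, (m : ℤ) < i → vz i = 0 := by
    intro i hi
    lift i to ℕ using by omega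
    rw [vz_nat]; exact hv.1.1 i (by omega)
  have vz_rec : ∀ i : ℤ, f (vz i) = g (vz (i + 1)) := by
    intro i
    rcases lt_trichotomy i (-1) with h | h | h
    · rw [vz_neg _ (by omega), vz_neg _ (by omega)]; simp
    · subst h
      have : vz (-1 + 1) = v 0 := vz_nat 0
      rw [this, hv.2, vz_neg _ (by omega), map_zero]
    · lift i to ℕ using by omega
      rw [vz_nat, hv.1.2]
      exact congrArg g (vz_nat (i + 1)).symm
  -- An explicit second solution of the relation satisfied by `z`. The term with i < k jumps exactly
  -- at k = i, which produces the inhomogeneity; the term with j ≤ i subtracts shifts of `v`,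
  -- solutions of the homogeneous recurrence, so that y vanishes from m on. At k = 0 only j = i
  -- survives and y 0 = -(tr c) v 0. Hence z - y lies in `kernelSpace f g m`, which is zero.
  let y : ℕ → X := fun k => ∑ i : Fin m, ∑ j : Fin m,
    (c i j * ((if (i : ℕ) < k then 1 else 0) - (if j ≤ i then 1 else 0))) • vz (j - i + k)
  have hy0 : y 0 = -((∑ k, c k k) • v 0) := by
    simp only [y, Finset.sum_smul, ← Finset.sum_neg_distrib]
    refine Finset.sum_congr rfl fun i _ => ?_
    rw [Finset.sum_eq_single i]
    · simp [← vz_nat]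
    · intro j _ hj
      by_cases h : j ≤ i
      · have : (j : ℕ) < i := lt_of_le_of_ne h (fun h' => hj (Fin.ext h'))
        rw [vz_neg _ (by omega), smul_zero]
      · simp [h]
    · simp
  have hybig : ∀ k, m ≤ k → y k = 0 := by
    intro k hk
    refine Finset.sum_eq_zero fun i _ => Finset.sum_eq_zero fun j _ => ?_
    have hi := i.2
    by_cases h : j ≤ i
    · rw [if_pos h, if_pos (by omega)]; simp
    · have : (i : ℕ) < j := not_le.1 h
      rw [vz_big _ (by omega), smul_zero]
  have hyrel : ∀ k : Fin m, f (y k) - g (y (k + 1)) + ∑ j, c k j • f (v j) = 0 := by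
    intro k
    have : ∀ i j : Fin m, f ((c i j * ((if (i : ℕ) < k then 1 else 0) -
        (if j ≤ i then 1 else 0))) • vz (j - i + (k : ℕ))) -
        g ((c i j * ((if (i : ℕ) < k + 1 then 1 else 0) -
        (if j ≤ i then 1 else 0))) • vz (j - i + (k + 1 : ℕ))) =
        if i = k then -(c i j • f (v j)) else 0 := by
      intro i j
      have h1 : ((j : ℕ) : ℤ) - (i : ℕ) + ((k : ℕ) + 1 : ℕ) = (j : ℕ) - (i : ℕ) + (k : ℕ) + 1 := by
        push_cast; ring
      rw [map_smul, map_smul, h1, ← vz_rec, ← sub_smul]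
      by_cases h : i = k
      · subst h
        have h2 : ((j : ℕ) : ℤ) - (i : ℕ) + (i : ℕ) = (j : ℕ) := by ring
        rw [h2, vz_nat]
        simp only [lt_irrefl, if_false, Nat.lt_succ_self, if_true, ← neg_smul]
        congr 1; ring
      · have : ((i : ℕ) < k + 1) ↔ (i : ℕ) < k := by
          have : (i : ℕ) ≠ k := fun h' => h (Fin.ext h')
          omega
        simp [this, h]
    simp only [y, map_sum, ← Finset.sum_sub_distrib, this]
    rw [Finset.sum_comm]
    simp
  have hmem : z - y ∈ kernelSpace f g m := by
    refine ⟨⟨fun i hi => by simp [hz i hi, hybig i hi], fun k => ?_⟩, ?_⟩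
    · rcases lt_or_ge k m with hk | hk
      · have h1 := hrel ⟨k, hk⟩
        have h2 := hyrel ⟨k, hk⟩
        rw [← sub_eq_zero]
        simp only [Pi.sub_apply, map_sub]
        have h3 := (sub_eq_zero.2 (h1.trans h2.symm))
        simp only at h3
        rw [← h3]; abel
      · simp [hz k hk, hybig k hk, hz (k + 1) (by omega), hybig (k + 1) (by omega)]
    · simp [hz0, hy0, hv.2]
  rw [hbot, Submodule.mem_bot] at hmem
  have h0 := congrFun hmem 0
  simp only [Pi.sub_apply, hz0, hy0, sub_neg_eq_add, zero_add, Pi.zero_apply] at h0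
  exact (smul_eq_zero.1 h0).resolve_right hv0

/-- The dual chain of a polynomial solution of minimal degree. -/
theorem exists_dual_chain {K V : Type*} [Field K] [AddCommGroup V] [Module K V]
    [FiniteDimensional K V] (A B : LinearMap.BilinForm K V) (m : ℕ)
    (v : ℕ → V) (hv : v ∈ kernelSpace A.flip B.flip (m + 1)) (hv0 : v 0 ≠ 0)
    (hbot : kernelSpace A.flip B.flip m = ⊥) :
    ∃ w : ℕ → V, (∀ i, i + 1 < m → A (w (i + 1)) = B (w i)) ∧
      ∀ i, i < m → ∀ j, j < m → A (w i) (v j) = if i = j then 1 else 0 := by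
  -- The conditions on `w` form a linear system Θ w = t. A functional killing the range of Θ amounts
  -- to a pair (z, c) as in `trace_eq_zero_of_kernelSpace_eq_bot`, and its value at t is the trace
  -- of c.
  let Θ : (Fin m → V) →ₗ[K] (Fin m → (Module.Dual K V × (Fin m → K))) :=
    LinearMap.pi fun k => LinearMap.prod
      (if h : 0 < k.1 then A ∘ₗ LinearMap.proj k -
        B ∘ₗ LinearMap.proj (⟨k - 1, by omega⟩ : Fin m) else 0)
      (LinearMap.pi fun j : Fin m => A.flip (v j) ∘ₗ LinearMap.proj k)
  have hΘ2 : ∀ w k j, (Θ w k).2 j = A (w k) (v j) := fun w k j => rfl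
  have hΘ1 : ∀ w k, (Θ w k).1 =
      if h : 0 < k.1 then A (w k) - B (w ⟨k - 1, by omega⟩) else 0 := by
    intro w k
    simp only [Θ, LinearMap.pi_apply, LinearMap.prod_apply, Function.prod_apply]
    split_ifs <;> rfl
  let t : Fin m → (Module.Dual K V × (Fin m → K)) := fun k => (0, Pi.single k 1)
  have ht : t ∈ LinearMap.range Θ := by
    refine LinearMap.mem_range_of_forall_dual Θ t fun f hf => ?_
    let F : Fin m → Module.Dual K (Module.Dual K V) := fun k =>
      f ∘ₗ LinearMap.single K (fun _ : Fin m => Module.Dual K V × (Fin m → K)) k ∘ₗ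
        LinearMap.inl K _ _
    -- By reflexivity, functionals on the dual of V are vectors of V.
    let z : Fin m → V := fun k => (Module.evalEquiv K V).symm (F k)
    have hz : ∀ k φ, f (Pi.single k (φ, 0)) = φ (z k) := by
      intro k φ
      exact (Module.apply_evalEquiv_symm_apply K V φ (F k)).symm
    let c : Fin m → Fin m → K := fun k j => f (Pi.single k (0, Pi.single j 1))
    have hf' : ∀ y, f y = ∑ k, ((y k).1 (z k) + ∑ j, (y k).2 j * c k j) := by
      intro y
      conv_lhs => rw [← Finset.univ_sum_single y, map_sum]
      refine Finset.sum_congr rfl fun k _ => ?_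
      have h1 : y k = ((y k).1, 0) + ∑ j, (y k).2 j • ((0 : Module.Dual K V), Pi.single j (1 : K)) := by
        refine Prod.ext ?_ ?_
        · simp [Prod.fst_sum]
        · ext l; simp [Prod.snd_sum, Finset.sum_apply, Pi.single_apply]
      conv_lhs => rw [h1, Pi.single_add, map_add, hz]
      congr 1
      have h2 : (Pi.single k (∑ j, (y k).2 j • ((0 : Module.Dual K V), Pi.single j (1 : K))) :
          Fin m → (Module.Dual K V × (Fin m → K))) =
          ∑ j, (y k).2 j • Pi.single k ((0 : Module.Dual K V), Pi.single j (1 : K)) := by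
        have := map_sum (LinearMap.single K (fun _ : Fin m => Module.Dual K V × (Fin m → K)) k)
          (fun j => (y k).2 j • ((0 : Module.Dual K V), Pi.single j (1 : K))) Finset.univ
        simpa only [map_smul, LinearMap.coe_single] using this
      rw [h2, map_sum]
      simp [c]
    let zz : ℕ → V := fun i => if h : 0 < i ∧ i < m then z ⟨i, h.2⟩ else 0
    -- Summation by parts: the shift from B(w_(k-1), z_k) to B(w_k, z_(k+1)) has no boundary terms
    -- because `zz` vanishes at 0 and at m.
    have hsum : ∀ w : Fin m → V, ∑ k : Fin m, (Θ w k).1 (z k) =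
        ∑ k : Fin m, (A (w k) (zz k) - B (w k) (zz (k + 1))) := by
      intro w
      let W : ℕ → V := fun i => if h : i < m then w ⟨i, h⟩ else 0
      have hW : ∀ k : Fin m, W k = w k := fun k => by simp [W]
      have e1 : ∀ k : Fin m, (Θ w k).1 (z k) = A (W k) (zz k) -
          (if (k : ℕ) = 0 then 0 else B (W (k - 1)) (zz k)) := by
        intro k
        rw [hΘ1]
        have hk := k.2
        by_cases h : 0 < k.1
        · have : W (k - 1) = w ⟨k - 1, by omega⟩ := by
            simp only [W]; rw [dif_pos]
          rw [dif_pos h, if_neg (by omega), this, hW]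
          simp [zz, h]
        · simp [zz, h]
      simp only [e1, ← hW, Finset.sum_sub_distrib]
      congr 1
      rw [Fin.sum_univ_eq_sum_range (fun k => if k = 0 then 0 else B (W (k - 1)) (zz k)),
        Fin.sum_univ_eq_sum_range (fun k => B (W k) (zz (k + 1)))]
      rcases m with _ | m
      · simp
      · rw [Finset.sum_range_succ', Finset.sum_range_succ]
        simp [zz]
    have hrel : ∀ k : Fin m, A.flip (zz k) - B.flip (zz (k + 1)) +
        ∑ j, c k j • A.flip (v j) = 0 := by
      intro k
      ext x
      have h1 := hf (Pi.single k x)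
      rw [hf', Finset.sum_add_distrib, hsum, ← Finset.sum_add_distrib,
        Finset.sum_eq_single k] at h1
      · simpa [hΘ2, mul_comm] using h1
      · intro k' _ hk
        simp [hΘ2, Pi.single_eq_of_ne hk]
      · simp
    have := trace_eq_zero_of_kernelSpace_eq_bot A.flip B.flip m v hv hv0 hbot zz c (by simp [zz])
      (fun i hi => by simp only [zz]; rw [dif_neg]; omega) hrel
    rw [hf', ← this]
    refine Finset.sum_congr rfl fun k _ => ?_
    simp [t, Pi.single_apply]
  obtain ⟨w, hw⟩ := ht
  refine ⟨fun i => if h : i < m then w ⟨i, h⟩ else 0, fun i hi => ?_, fun i hi j hj => ?_⟩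
  · have h1 := congrArg Prod.fst (congrFun hw ⟨i + 1, hi⟩)
    rw [hΘ1] at h1
    simp only [dif_pos hi, dif_pos (show i < m by omega)]
    simpa [t, sub_eq_zero] using h1
  · have h1 := congrFun (congrArg Prod.snd (congrFun hw ⟨i, hi⟩)) ⟨j, hj⟩
    rw [hΘ2] at h1
    simp only [dif_pos hi]
    rw [h1]
    simp [t, Pi.single_apply, eq_comm]

/-- `HasJKBlocks.cons` in the shape used by the induction on the dimension. The complement is proper
because every block has a basis vector, on which some ψ takes the value 1. -/
theorem HasJKBlocks.exists_cons {K V : Type*} [Field K] [AddCommGroup V] [Module K V]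
    [FiniteDimensional K V] {A B : LinearMap.BilinForm K V} (hAalt : A.IsAlt) (hBalt : B.IsAlt)
    (b : JKBlock K) (e : b.Index → V) (ψ : b.Index → Module.Dual K V)
    (hA : ∀ p q, A (e p) (e q) = b.matrixA p q) (hB : ∀ p q, B (e p) (e q) = b.matrixB p q)
    (hψ : ∀ p q, ψ p (e q) = if p = q then 1 else 0)
    (hort : ∀ x, (∀ p, ψ p x = 0) → ∀ p, A (e p) x = 0 ∧ B (e p) x = 0) :
    ∃ W : Submodule K V, Module.finrank K W < Module.finrank K V ∧
      ∀ s, HasJKBlocks (A.restrict W) (B.restrict W) s → HasJKBlocks A B (b ::ₘ s) := by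
  have hW : ∀ x, x ∈ ⨅ p, LinearMap.ker (ψ p) ↔ ∀ p, ψ p x = 0 := fun x => by
    simp [Submodule.mem_iInf]
  refine ⟨⨅ p, LinearMap.ker (ψ p), Submodule.finrank_lt fun htop => ?_,
    fun s hs => HasJKBlocks.cons hAalt hBalt b e ψ hA hB hψ hort hW hs⟩
  obtain ⟨p⟩ : Nonempty b.Index := by
    cases b with
    | jordan μ n => exact ⟨Sum.inl ⟨0, n.2⟩⟩
    | jordanInf n => exact ⟨Sum.inl ⟨0, n.2⟩⟩
    | kronecker m => exact ⟨Sum.inr ⟨0, Nat.succ_pos m⟩⟩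
  have h1 : e p ∈ ⨅ p, LinearMap.ker (ψ p) := htop ▸ Submodule.mem_top
  have h2 := (hW _).1 h1 p
  rw [hψ, if_pos rfl] at h2
  exact one_ne_zero h2

/-- A pencil with a non-trivial polynomial kernel splits off a Kronecker block. -/
theorem exists_kronecker_split {K V : Type*} [Field K] [NeZero (2 : K)] [AddCommGroup V]
    [Module K V] [FiniteDimensional K V] {A B : LinearMap.BilinForm K V} (hAalt : A.IsAlt)
    (hBalt : B.IsAlt) (hex : ∃ n, kernelSpace A.flip B.flip n ≠ ⊥) :
    ∃ (b : JKBlock K) (W : Submodule K V), Module.finrank K W < Module.finrank K V ∧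
      ∀ s, HasJKBlocks (A.restrict W) (B.restrict W) s → HasJKBlocks A B (b ::ₘ s) := by
  classical
  let n := Nat.find hex
  have hn : kernelSpace A.flip B.flip n ≠ ⊥ := Nat.find_spec hex
  have hmin : ∀ k < n, kernelSpace A.flip B.flip k = ⊥ := fun k hk =>
    not_not.1 (Nat.find_min hex hk)
  obtain ⟨v, hv, hvne⟩ := Submodule.exists_mem_ne_zero_of_ne_bot hn
  obtain ⟨m, hm⟩ : ∃ m, n = m + 1 := by
    refine Nat.exists_eq_succ_of_ne_zero fun h0 => hvne ?_
    funext i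
    exact hv.1.1 i (by omega)
  rw [hm] at hv
  have hbot : kernelSpace A.flip B.flip m = ⊥ := hmin m (by omega)
  -- Otherwise dividing by the variable, that is shifting the coefficients, would lower the degree.
  have hv0 : v 0 ≠ 0 := by
    intro h0
    have hmem : (fun i => v (i + 1)) ∈ kernelSpace A.flip B.flip m := by
      refine ⟨⟨fun i hi => hv.1.1 _ (by omega), fun i => hv.1.2 (i + 1)⟩, ?_⟩
      have := hv.1.2 0
      rw [h0, map_zero] at this
      exact this.symm
    rw [hbot, Submodule.mem_bot] at hmem
    refine hvne (funext fun i => ?_)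
    rcases i with _ | i
    · exact h0
    · exact congrFun hmem i
  obtain ⟨w, hw, hwv⟩ := exists_dual_chain A B m v hv hv0 hbot
  have hrec : ∀ x i, A x (v i) = B x (v (i + 1)) := fun x i =>
    LinearMap.congr_fun (hv.1.2 i) x
  have hB0 : ∀ x, B x (v 0) = 0 := fun x => LinearMap.congr_fun hv.2 x
  have hAm : ∀ x, A x (v m) = 0 := fun x => by
    rw [hrec, hv.1.1 (m + 1) le_rfl, map_zero]
  have hAvv : ∀ j i, A (v i) (v j) = 0 := by
    intro j
    induction j with
    | zero =>
      intro i
      rw [← hAalt.neg_eq, hrec, ← hBalt.neg_eq, hB0]; simp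
    | succ j ih =>
      intro i
      rw [← hAalt.neg_eq, hrec, ← hBalt.neg_eq, ← hrec, ih]; simp
  have hBvv : ∀ j i, B (v i) (v j) = 0 := by
    intro j i
    rcases j with _ | j
    · exact hB0 _
    · rw [← hrec, hAvv]
  have hAwv : ∀ i < m, ∀ j ≤ m, A (w i) (v j) = if j = i then 1 else 0 := by
    intro i hi j hj
    rcases hj.lt_or_eq with h | h
    · rw [hwv i hi j h]; simp [eq_comm]
    · rw [h, hAm, if_neg (by omega)]
  have hBwv : ∀ i < m, ∀ j ≤ m, B (w i) (v j) = if j = i + 1 then 1 else 0 := by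
    intro i hi j hj
    rcases j with _ | j
    · rw [hB0, if_neg (by omega)]
    · rw [← hrec, hAwv i hi j (by omega)]; simp
  -- The Gram matrix of `w` under A is thus constant along antidiagonals, hence symmetric; being
  -- also skew, it vanishes as 2 ≠ 0. No correction of the dual chain is needed.
  have hstep : ∀ i j, i + 1 < m → j + 1 < m → A (w (i + 1)) (w j) = A (w i) (w (j + 1)) := by
    intro i j hi hj
    rw [hw i hi, ← hBalt.neg_eq, ← hw j hj, hAalt.neg_eq]
  have hsh : ∀ d i j, i + d < m → j + d < m → A (w (i + d)) (w j) = A (w i) (w (j + d)) := by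
    intro d
    induction d with
    | zero => intros; rfl
    | succ d ih =>
      intro i j hi hj
      rw [← add_assoc, hstep _ _ (by omega) (by omega), ih _ _ (by omega) (by omega)]
      congr 2; omega
  have hself : ∀ x : K, x = -x → x = 0 := by
    intro x hx
    have h2 : (2 : K) * x = 0 := by linear_combination hx
    exact (mul_eq_zero.1 h2).resolve_left (NeZero.ne _)
  have hAle : ∀ d i, i + d < m → A (w (i + d)) (w i) = 0 := by
    intro d i h
    refine hself _ ?_
    conv_lhs => rw [hsh d i i h h]
    rw [hAalt.neg_eq]
  have hAww : ∀ i < m, ∀ j < m, A (w i) (w j) = 0 := by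
    intro i hi j hj
    rcases le_total i j with h | h
    · obtain ⟨d, rfl⟩ := Nat.exists_eq_add_of_le h
      rw [← hAalt.neg_eq, hAle d i hj, neg_zero]
    · obtain ⟨d, rfl⟩ := Nat.exists_eq_add_of_le h
      exact hAle d j hi
  have hBww : ∀ i < m, ∀ j < m, B (w i) (w j) = 0 := by
    intro i hi j hj
    by_cases h : i + 1 < m
    · rw [← hw i h, hAww _ h _ hj]
    · by_cases h' : j + 1 < m
      · rw [← hBalt.neg_eq, ← hw j h', hAww _ h' _ hi, neg_zero]
      · have : i = j := by omega
        rw [this, hBalt]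
  obtain ⟨φ, hφ⟩ := Module.Projective.exists_dual_eq_one K hv0
  -- The functionals dual to v 0, …, v m are A(w 0), B(w 0), …, B(w (m - 1)). For m = 0 there is no
  -- `w`, and since v 0 lies in both kernels any functional with value 1 on it will do.
  let ψ₀ : ℕ → Module.Dual K V := fun j =>
    if m = 0 then φ else if j = 0 then A (w 0) else B (w (j - 1))
  have hψv : ∀ i ≤ m, ∀ j ≤ m, ψ₀ i (v j) = if i = j then 1 else 0 := by
    intro i hi j hj
    simp only [ψ₀]
    by_cases h1 : m = 0
    · have hi0 : i = 0 := by omega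
      have hj0 : j = 0 := by omega
      rw [if_pos h1, hi0, hj0, hφ, if_pos rfl]
    rw [if_neg h1]
    by_cases h2 : i = 0
    · rw [if_pos h2, hAwv 0 (by omega) j hj, h2]
      simp [eq_comm]
    · rw [if_neg h2, hBwv (i - 1) (by omega) j hj, Nat.sub_add_cancel (by omega)]
      simp [eq_comm]
  have hψw : ∀ i ≤ m, ∀ j < m, ψ₀ i (w j) = 0 := by
    intro i hi j hj
    simp only [ψ₀]
    split_ifs with h1 h2
    · omega
    · exact hAww _ (by omega) _ hj
    · exact hBww _ (by omega) _ hj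
  refine ⟨.kronecker m, HasJKBlocks.exists_cons hAalt hBalt (.kronecker m)
    (Sum.elim (fun i : Fin m => w i) (fun j : Fin (m + 1) => v j))
    (Sum.elim (fun i : Fin m => A.flip (v i)) (fun j : Fin (m + 1) => ψ₀ j)) ?_ ?_ ?_ ?_⟩
  · rintro (⟨i, hi⟩ | ⟨i, hi⟩) (⟨j, hj⟩ | ⟨j, hj⟩)
    · exact hAww i hi j hj
    · exact hAwv i hi j (Nat.le_of_lt_succ hj)
    · refine (hAalt.neg_eq (w j) (v i)).symm.trans ?_
      rw [hAwv j hj i (Nat.le_of_lt_succ hi)]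
      rfl
    · exact hAvv j i
  · rintro (⟨i, hi⟩ | ⟨i, hi⟩) (⟨j, hj⟩ | ⟨j, hj⟩)
    · exact hBww i hi j hj
    · exact hBwv i hi j (Nat.le_of_lt_succ hj)
    · refine (hBalt.neg_eq (w j) (v i)).symm.trans ?_
      rw [hBwv j hj i (Nat.le_of_lt_succ hi)]
      rfl
    · exact hBvv j i
  · rintro (⟨i, hi⟩ | ⟨i, hi⟩) (⟨j, hj⟩ | ⟨j, hj⟩)
    · refine (hAwv j hj i (le_of_lt hi)).trans ?_
      simp
    · refine (hAvv i j).trans ?_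
      simp
    · refine (hψw i (Nat.le_of_lt_succ hi) j hj).trans ?_
      simp
    · refine (hψv i (Nat.le_of_lt_succ hi) j (Nat.le_of_lt_succ hj)).trans ?_
      simp
  · intro x hx
    have hxv : ∀ i ≤ m, A (v i) x = 0 := by
      intro i hi
      rcases hi.lt_or_eq with h | h
      · rw [← hAalt.neg_eq, show A x (v i) = 0 from hx (Sum.inl ⟨i, h⟩), neg_zero]
      · rw [← hAalt.neg_eq, h, hAm, neg_zero]
    have hxv' : ∀ i ≤ m, B (v i) x = 0 := by
      intro i hi
      rcases i with _ | i
      · rw [← hBalt.neg_eq, hB0, neg_zero]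
      · rw [← hBalt.neg_eq, ← hrec, hAalt.neg_eq, hxv i (by omega)]
    have hψx : ∀ j ≤ m, ψ₀ j x = 0 := fun j hj => hx (Sum.inr ⟨j, Nat.lt_succ_of_le hj⟩)
    have hxw' : ∀ i < m, B (w i) x = 0 := by
      intro i hi
      have := hψx (i + 1) hi
      simpa [ψ₀, show m ≠ 0 by omega] using this
    have hxw : ∀ i < m, A (w i) x = 0 := by
      intro i hi
      rcases i with _ | i
      · have := hψx 0 (by omega)
        simpa [ψ₀, show m ≠ 0 by omega] using this
      · rw [hw i hi, hxw' i (by omega)]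
    rintro (⟨i, hi⟩ | ⟨i, hi⟩)
    · exact ⟨hxw i hi, hxw' i hi⟩
    · exact ⟨hxv i (Nat.le_of_lt_succ hi), hxv' i (Nat.le_of_lt_succ hi)⟩

/-! ### Regular pencils: Jordan blocks and Fitting decomposition -/

open Polynomial in
/-- A pencil without polynomial kernel contains a non-degenerate form. -/
theorem exists_injective_of_kernelSpace_eq_bot {K V : Type*} [Field K] [Infinite K]
    [AddCommGroup V] [Module K V] [FiniteDimensional K V] (A B : LinearMap.BilinForm K V)
    (hbot : ∀ n, kernelSpace A.flip B.flip n = ⊥) :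
    ∃ c : K, Function.Injective (B - c • A) := by
  by_contra! hcon
  let bs := Module.finBasis K V
  let MA := LinearMap.BilinForm.toMatrix bs A
  let MB := LinearMap.BilinForm.toMatrix bs B
  let M : Matrix _ _ K[X] := MB.map C - (X : K[X]) • MA.map C
  have hdet0 : ∀ c : K, (MB - c • MA).det = 0 := by
    intro c
    obtain ⟨x, hx, hx0⟩ : ∃ x, (B - c • A) x = 0 ∧ x ≠ 0 := by
      by_contra! h
      exact hcon c ((injective_iff_map_eq_zero _).2 h)
    rw [← Matrix.exists_vecMul_eq_zero_iff]
    refine ⟨bs.repr x, fun h => hx0 ?_, ?_⟩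
    · apply bs.repr.injective
      rw [map_zero]
      exact DFunLike.coe_injective h
    · ext j
      have h1 := LinearMap.congr_fun hx (bs j)
      conv_lhs at h1 => rw [← bs.sum_repr x]
      rw [map_sum, LinearMap.sum_apply] at h1
      simpa [-Module.Basis.sum_repr, Matrix.vecMul, dotProduct, MA, MB,
        LinearMap.BilinForm.toMatrix_apply] using h1
  have hdet : M.det = 0 := by
    refine Polynomial.eq_zero_of_infinite_isRoot _ ?_
    have : {x | IsRoot M.det x} = Set.univ := by
      refine Set.eq_univ_of_forall fun c => ?_
      change eval c M.det = 0
      rw [← coe_evalRingHom, RingHom.map_det, ← hdet0 c]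
      congr 1
      ext i j
      simp [M]
      exact mul_comm _ _
    rw [this]
    exact Set.infinite_univ
  -- A null vector with polynomial entries; its coefficient vectors `u` form a non-zero element of
  -- some `kernelSpace`.
  obtain ⟨w, hw0, hw⟩ := Matrix.exists_mulVec_eq_zero_iff.2 hdet
  let u : ℕ → V := fun k => ∑ j, (w j).coeff k • bs j
  have hB : ∀ i k, B (bs i) (u k) = ∑ j, (MB i j) * (w j).coeff k := fun i k => by
    simp [u, MB, LinearMap.BilinForm.toMatrix_apply, mul_comm]
  have hA : ∀ i k, A (bs i) (u k) = ∑ j, (MA i j) * (w j).coeff k := fun i k => by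
    simp [u, MA, LinearMap.BilinForm.toMatrix_apply, mul_comm]
  have hw' : ∀ i, ∑ j, C (MB i j) * w j - X * ∑ j, C (MA i j) * w j = 0 := by
    intro i
    refine Eq.trans ?_ (congrFun hw i)
    rw [Finset.mul_sum, ← Finset.sum_sub_distrib]
    refine Finset.sum_congr rfl fun j _ => ?_
    simp [M]
    ring
  have hmem : u ∈ kernelSpace A.flip B.flip
      (Finset.univ.sup (fun j => (w j).natDegree) + 1) := by
    refine ⟨⟨fun k hk => Finset.sum_eq_zero fun j _ => ?_, fun k => bs.ext fun i => ?_⟩,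
      bs.ext fun i => ?_⟩
    · have : (w j).natDegree ≤ Finset.univ.sup (fun j => (w j).natDegree) :=
        Finset.le_sup (f := fun j => (w j).natDegree) (Finset.mem_univ j)
      rw [coeff_eq_zero_of_natDegree_lt (by omega), zero_smul]
    · have := congrArg (fun p => p.coeff (k + 1)) (hw' i)
      simp only [coeff_sub, coeff_X_mul, finsetSum_coeff, coeff_C_mul, coeff_zero] at this
      change A (bs i) (u k) = B (bs i) (u (k + 1))
      rw [hA, hB]
      exact (sub_eq_zero.1 this).symm
    · have := congrArg (fun p => p.coeff 0) (hw' i)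
      simp only [coeff_sub, mul_coeff_zero, coeff_X_zero, zero_mul, sub_zero, finsetSum_coeff,
        coeff_C_zero, coeff_zero] at this
      change B (bs i) (u 0) = 0
      rw [hB]
      simpa using this
  rw [hbot, Submodule.mem_bot] at hmem
  refine hw0 (funext fun j => Polynomial.ext fun k => ?_)
  have h1 := congrFun hmem k
  exact Fintype.linearIndependent_iff.1 bs.linearIndependent (fun j => (w j).coeff k) h1 j

/-- The endomorphism `G⁻¹H`. -/
theorem exists_endomorphism_of_injective {K V : Type*} [Field K] [AddCommGroup V] [Module K V]
    [FiniteDimensional K V] {G H : LinearMap.BilinForm K V} (hGalt : G.IsAlt) (hHalt : H.IsAlt)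
    (hG : Function.Injective G) : ∃ N : Module.End K V,
      (∀ x y, G (N x) y = H x y) ∧ ∀ k x y, G ((N ^ k) x) y = G x ((N ^ k) y) := by
  let Ge := LinearMap.linearEquivOfInjective G hG (Subspace.dual_finrank_eq (K := K) (V := V)).symm
  have h1 : ∀ x y, G (Ge.symm (H x)) y = H x y := by
    intro x y
    have : G (Ge.symm (H x)) = H x := Ge.apply_symm_apply (H x)
    rw [this]
  refine ⟨Ge.symm.toLinearMap ∘ₗ H, h1, fun k => ?_⟩
  induction k with
  | zero => intro x y; rfl
  | succ k ih =>
    intro x y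
    rw [pow_succ, Module.End.mul_apply, ih]
    have : (Ge.symm.toLinearMap ∘ₗ H) * (Ge.symm.toLinearMap ∘ₗ H) ^ k =
      (Ge.symm.toLinearMap ∘ₗ H) ^ k * (Ge.symm.toLinearMap ∘ₗ H) := (pow_succ' _ _).symm.trans (pow_succ _ _)
    rw [← this, Module.End.mul_apply]
    refine (h1 _ _).trans ((hHalt.neg_eq _ _).symm.trans ?_)
    rw [← h1, hGalt.neg_eq]
    rfl

/-- Dual Jordan chains of a non-degenerate form `G` and a degenerate form `H`. -/
theorem exists_dual_jordan_chains {K V : Type*} [Field K] [NeZero (2 : K)] [AddCommGroup V]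
    [Module K V] [FiniteDimensional K V] {G H : LinearMap.BilinForm K V} (hGalt : G.IsAlt)
    (hHalt : H.IsAlt) (hG : Function.Injective G) (hH : ¬ Function.Injective H) :
    ∃ (n : ℕ) (e f : ℕ → V), 0 < n ∧ (∀ i j, G (e i) (e j) = 0) ∧ (∀ i j, G (f i) (f j) = 0) ∧
      (∀ i j, H (e i) (e j) = 0) ∧ (∀ i j, H (f i) (f j) = 0) ∧
      (∀ i < n, ∀ j < n, G (e i) (f j) = if j = i then 1 else 0) ∧
      (∀ i < n, ∀ j < n, H (e i) (f j) = if j = i + 1 then 1 else 0) ∧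
      ∀ x, (∀ i < n, G (e i) x = 0 ∧ G (f i) x = 0) → ∀ i < n, H (e i) x = 0 ∧ H (f i) x = 0 := by
  classical
  obtain ⟨N, hN, hNG⟩ := exists_endomorphism_of_injective hGalt hHalt hG
  obtain ⟨n, hn, hn1⟩ := (N.eventually_isCompl_ker_pow_range_pow.and
    (Filter.eventually_ge_atTop 1)).exists
  have hex : ∃ k, LinearMap.ker (N ^ n) ≤ LinearMap.ker (N ^ k) := ⟨n, le_rfl⟩
  -- The nilpotency index of N on its generalized kernel. Choosing the longest chain ensures that
  -- the dual chain, which lies in the same space, also stops after k steps.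
  let k := Nat.find hex
  have hk : LinearMap.ker (N ^ n) ≤ LinearMap.ker (N ^ k) := Nat.find_spec hex
  have hkn : k ≤ n := Nat.find_min' hex le_rfl
  obtain ⟨x₀, hx₀, hx₀ne⟩ : ∃ x, H x = 0 ∧ x ≠ 0 := by
    by_contra! h
    exact hH ((injective_iff_map_eq_zero _).2 h)
  have hNx₀ : N x₀ = 0 := by
    apply hG
    ext y
    rw [hN, hx₀, map_zero]
  have hk0 : 0 < k := by
    by_contra h
    have h0 : k = 0 := by omega
    rw [h0] at hk
    have : x₀ ∈ LinearMap.ker (N ^ n) := by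
      obtain ⟨n, rfl⟩ := Nat.exists_eq_succ_of_ne_zero (by omega : n ≠ 0)
      rw [LinearMap.mem_ker, Nat.succ_eq_add_one, pow_succ, Module.End.mul_apply, hNx₀, map_zero]
    exact hx₀ne (by simpa using hk this)
  obtain ⟨u, hun, hu⟩ : ∃ u, (N ^ n) u = 0 ∧ (N ^ (k - 1)) u ≠ 0 := by
    have := Nat.find_min hex (m := k - 1) (by omega)
    rw [SetLike.not_le_iff_exists] at this
    obtain ⟨u, h1, h2⟩ := this
    exact ⟨u, h1, h2⟩
  have hpow : ∀ w, (N ^ n) w = 0 → ∀ l, k ≤ l → (N ^ l) w = 0 := by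
    intro w hw l hl
    have hw' : (N ^ k) w = 0 := hk hw
    obtain ⟨d, rfl⟩ := Nat.exists_eq_add_of_le' hl
    rw [pow_add, Module.End.mul_apply, hw', map_zero]
  have hind : ∀ c : Fin k → K, ∑ l, c l • (N ^ (l : ℕ)) u = 0 → ∀ l, c l = 0 := by
    intro c hc
    have : ∀ l, ∀ h : l < k, c ⟨l, h⟩ = 0 := by
      intro l
      induction l using Nat.strong_induction_on with
      | _ l ih =>
        intro h
        have h1 := congrArg (N ^ (k - 1 - l)) hc
        rw [map_sum, map_zero, Finset.sum_eq_single ⟨l, h⟩] at h1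
        · rw [map_smul, ← Module.End.mul_apply, ← pow_add, Nat.sub_add_cancel (by omega)] at h1
          exact (smul_eq_zero.1 h1).resolve_right hu
        · intro j _ hj
          rcases lt_trichotomy (j : ℕ) l with h' | h' | h'
          · rw [ih j h' j.2, zero_smul, map_zero]
          · exact absurd (Fin.ext h') hj
          · rw [map_smul, ← Module.End.mul_apply, ← pow_add, hpow u hun _ (by omega), smul_zero]
        · simp
    exact fun l => this l l.2
  -- The vectors N^l u with l < k are independent and G is injective, so their pairings with one
  -- vector can be prescribed.
  obtain ⟨v₀, hv₀⟩ : ∃ v₀, ∀ l < k, G ((N ^ l) u) v₀ = if l = k - 1 then 1 else 0 := by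
    let Θ : V →ₗ[K] (Fin k → K) := LinearMap.pi fun l => G ((N ^ (l : ℕ)) u)
    have : (fun l : Fin k => if (l : ℕ) = k - 1 then (1 : K) else 0) ∈ LinearMap.range Θ := by
      refine LinearMap.mem_range_of_forall_dual Θ _ fun f hf => ?_
      have hfy : ∀ y : Fin k → K, f y = ∑ l, f (Pi.single l 1) * y l := by
        intro y
        conv_lhs => rw [pi_eq_sum_univ' y, map_sum]
        refine Finset.sum_congr rfl fun l _ => ?_
        rw [map_smul, smul_eq_mul, mul_comm]
      have h0 := hind (fun l => f (Pi.single l 1)) (by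
        apply hG
        ext x
        have := hf x
        rw [hfy] at this
        simpa [Θ] using this)
      rw [hfy]
      exact Finset.sum_eq_zero fun l _ => by rw [h0 l, zero_mul]
    obtain ⟨v₀, hv₀⟩ := this
    exact ⟨v₀, fun l hl => congrFun hv₀ ⟨l, hl⟩⟩
  -- Projecting v₀ to the generalized kernel does not alter the pairings, since the range of N^n is
  -- G-orthogonal to that kernel.
  obtain ⟨v, hvn, hv⟩ : ∃ v, (N ^ n) v = 0 ∧
      ∀ l < k, G ((N ^ l) u) v = if l = k - 1 then 1 else 0 := by
    have hmem : v₀ ∈ LinearMap.ker (N ^ n) ⊔ LinearMap.range (N ^ n) := by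
      rw [hn.sup_eq_top]; exact Submodule.mem_top
    obtain ⟨v, hv, _, ⟨b, rfl⟩, rfl⟩ := Submodule.mem_sup.1 hmem
    refine ⟨v, hv, fun l hl => ?_⟩
    rw [← hv₀ l hl, map_add, ← hNG, ← Module.End.mul_apply, ← pow_add,
      hpow u hun (n + l) (by omega), map_zero, LinearMap.zero_apply, add_zero]
  have huv : ∀ i j, G ((N ^ i) u) ((N ^ j) v) = if i + j = k - 1 then 1 else 0 := by
    intro i j
    rw [← hNG, ← Module.End.mul_apply, ← pow_add, add_comm j i]
    by_cases h : i + j < k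
    · exact hv _ h
    · rw [hpow u hun _ (by omega), map_zero, LinearMap.zero_apply, if_neg (by omega)]
  -- Self-adjointness of N makes this expression symmetric in i and j, while G makes it skew; 2 ≠ 0
  -- finishes.
  have hself : ∀ i j x, G ((N ^ i) x) ((N ^ j) x) = 0 := by
    intro i j x
    have h1 : G ((N ^ i) x) ((N ^ j) x) = -G ((N ^ i) x) ((N ^ j) x) := by
      conv_lhs => rw [hNG, ← Module.End.mul_apply, ← pow_add, add_comm, pow_add,
        Module.End.mul_apply, ← hNG, ← hGalt.neg_eq]
    have h2 : (2 : K) * G ((N ^ i) x) ((N ^ j) x) = 0 := by linear_combination h1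
    exact (mul_eq_zero.1 h2).resolve_left (NeZero.ne _)
  have hHN : ∀ i x y, H ((N ^ i) x) y = G ((N ^ (i + 1)) x) y := by
    intro i x y
    rw [← hN, pow_succ', Module.End.mul_apply]
  refine ⟨k, fun i => (N ^ i) u, fun j => (N ^ (k - 1 - j)) v, hk0, fun i j => hself _ _ _,
    fun i j => hself _ _ _, fun i j => ?_, fun i j => ?_, fun i hi j hj => ?_,
    fun i hi j hj => ?_, fun x hx i hi => ⟨?_, ?_⟩⟩
  · rw [hHN, hself]
  · rw [hHN, hself]
  · rw [huv]; congr 1; exact propext (by omega)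
  · rw [hHN, huv]; congr 1; exact propext (by omega)
  · rw [hHN]
    by_cases h : i + 1 < k
    · exact (hx (i + 1) h).1
    · rw [hpow u hun _ (by omega), map_zero, LinearMap.zero_apply]
  · rw [hHN]
    rcases i with _ | i
    · rw [hpow v hvn _ (by omega), map_zero, LinearMap.zero_apply]
    · have := (hx i (by omega)).2
      rwa [show k - 1 - (i + 1) + 1 = k - 1 - i by omega]

theorem LinearMap.BilinForm.IsAlt.restrict {K V : Type*} [Field K] [AddCommGroup V] [Module K V]
    {A : LinearMap.BilinForm K V} (hA : A.IsAlt) (W : Submodule K V) : (A.restrict W).IsAlt :=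
  fun x => hA (x : V)

/-- Take dual chains for G = B and H = A - μB. On them B is the standard pairing and A = H + μB
becomes J_n(μ); pairing with the opposite chain under B gives the dual functionals. -/
theorem exists_jordan_split {K V : Type*} [Field K] [NeZero (2 : K)] [AddCommGroup V]
    [Module K V] [FiniteDimensional K V] {A B : LinearMap.BilinForm K V} (hAalt : A.IsAlt)
    (hBalt : B.IsAlt) (μ : K) (hB : Function.Injective B)
    (hμ : ¬ Function.Injective (A - μ • B)) :
    ∃ (b : JKBlock K) (W : Submodule K V), Module.finrank K W < Module.finrank K V ∧
      ∀ s, HasJKBlocks (A.restrict W) (B.restrict W) s → HasJKBlocks A B (b ::ₘ s) := by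
  obtain ⟨n, e, f, hn, hGe, hGf, hHe, hHf, hG, hH, hort⟩ := exists_dual_jordan_chains hBalt
    (hAalt.sub (hBalt.smul μ)) hB hμ
  have hAH : ∀ x y, A x y = (A - μ • B) x y + μ * B x y := fun x y => by simp
  have hAef : ∀ i < n, ∀ j < n, A (e i) (f j) =
      if j = i then μ else if j = i + 1 then 1 else 0 := by
    intro i hi j hj
    rw [hAH, hG i hi j hj, hH i hi j hj]
    by_cases h : j = i
    · rw [if_neg (by omega), if_pos h, if_pos h]; ring
    · rw [if_neg h, if_neg h]; ring
  have hAee : ∀ i j, A (e i) (e j) = 0 := fun i j => by rw [hAH, hHe, hGe]; simp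
  have hAff : ∀ i j, A (f i) (f j) = 0 := fun i j => by rw [hAH, hHf, hGf]; simp
  refine ⟨.jordan μ ⟨n, hn⟩, HasJKBlocks.exists_cons hAalt hBalt (.jordan μ ⟨n, hn⟩)
    (Sum.elim (fun i : Fin n => e i) (fun j : Fin n => f j))
    (Sum.elim (fun i : Fin n => B.flip (f i)) (fun j : Fin n => B (e j))) ?_ ?_ ?_ ?_⟩
  · rintro (⟨i, hi⟩ | ⟨i, hi⟩) (⟨j, hj⟩ | ⟨j, hj⟩)
    · exact hAee i j
    · exact hAef i hi j hj
    · refine (hAalt.neg_eq (e j) (f i)).symm.trans ?_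
      rw [hAef j hj i hi]
      rfl
    · exact hAff i j
  · rintro (⟨i, hi⟩ | ⟨i, hi⟩) (⟨j, hj⟩ | ⟨j, hj⟩)
    · exact hGe _ _
    · exact hG i hi j hj
    · refine (hBalt.neg_eq (e j) (f i)).symm.trans ?_
      rw [hG j hj i hi]
      rfl
    · exact hGf _ _
  · rintro (⟨i, hi⟩ | ⟨i, hi⟩) (⟨j, hj⟩ | ⟨j, hj⟩)
    · refine (hG j hj i hi).trans ?_
      simp
    · refine (hGf j i).trans ?_
      simp
    · refine (hGe i j).trans ?_
      simp
    · refine (hG i hi j hj).trans ?_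
      simp [eq_comm]
  · intro x hx
    have h1 : ∀ i < n, B (e i) x = 0 ∧ B (f i) x = 0 := fun i hi =>
      ⟨hx (Sum.inr ⟨i, hi⟩), by
        rw [← hBalt.neg_eq, show B x (f i) = 0 from hx (Sum.inl ⟨i, hi⟩), neg_zero]⟩
    have h2 : ∀ i < n, A (e i) x = 0 ∧ A (f i) x = 0 := fun i hi => by
      rw [hAH, hAH, (hort x h1 i hi).1, (hort x h1 i hi).2, (h1 i hi).1, (h1 i hi).2]
      simp
    rintro (⟨i, hi⟩ | ⟨i, hi⟩)
    · exact ⟨(h2 i hi).1, (h1 i hi).1⟩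
    · exact ⟨(h2 i hi).2, (h1 i hi).2⟩

/-- The dual chains for G = A and H = B are already in normal form. -/
theorem exists_jordanInf_split {K V : Type*} [Field K] [NeZero (2 : K)] [AddCommGroup V]
    [Module K V] [FiniteDimensional K V] {A B : LinearMap.BilinForm K V} (hAalt : A.IsAlt)
    (hBalt : B.IsAlt) (hA : Function.Injective A) (hB : ¬ Function.Injective B) :
    ∃ (b : JKBlock K) (W : Submodule K V), Module.finrank K W < Module.finrank K V ∧
      ∀ s, HasJKBlocks (A.restrict W) (B.restrict W) s → HasJKBlocks A B (b ::ₘ s) := by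
  obtain ⟨n, e, f, hn, hGe, hGf, hHe, hHf, hG, hH, hort⟩ := exists_dual_jordan_chains hAalt
    hBalt hA hB
  refine ⟨.jordanInf ⟨n, hn⟩, HasJKBlocks.exists_cons hAalt hBalt (.jordanInf ⟨n, hn⟩)
    (Sum.elim (fun i : Fin n => e i) (fun j : Fin n => f j))
    (Sum.elim (fun i : Fin n => A.flip (f i)) (fun j : Fin n => A (e j))) ?_ ?_ ?_ ?_⟩
  · rintro (⟨i, hi⟩ | ⟨i, hi⟩) (⟨j, hj⟩ | ⟨j, hj⟩)
    · exact hGe _ _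
    · exact hG i hi j hj
    · refine (hAalt.neg_eq (e j) (f i)).symm.trans ?_
      rw [hG j hj i hi]
      rfl
    · exact hGf _ _
  · rintro (⟨i, hi⟩ | ⟨i, hi⟩) (⟨j, hj⟩ | ⟨j, hj⟩)
    · exact hHe _ _
    · exact hH i hi j hj
    · refine (hBalt.neg_eq (e j) (f i)).symm.trans ?_
      rw [hH j hj i hi]
      rfl
    · exact hHf _ _
  · rintro (⟨i, hi⟩ | ⟨i, hi⟩) (⟨j, hj⟩ | ⟨j, hj⟩)
    · refine (hG j hj i hi).trans ?_
      simp
    · refine (hGf j i).trans ?_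
      simp
    · refine (hGe i j).trans ?_
      simp
    · refine (hG i hi j hj).trans ?_
      simp [eq_comm]
  · intro x hx
    have h1 : ∀ i < n, A (e i) x = 0 ∧ A (f i) x = 0 := fun i hi =>
      ⟨hx (Sum.inr ⟨i, hi⟩), by
        rw [← hAalt.neg_eq, show A x (f i) = 0 from hx (Sum.inl ⟨i, hi⟩), neg_zero]⟩
    rintro (⟨i, hi⟩ | ⟨i, hi⟩)
    · exact ⟨(h1 i hi).1, (hort x h1 i hi).1⟩
    · exact ⟨(h1 i hi).2, (hort x h1 i hi).2⟩

/-- A regular pencil with two degenerate forms is an orthogonal direct sum. -/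
theorem exists_fitting_split {K V : Type*} [Field K] [AddCommGroup V] [Module K V]
    [FiniteDimensional K V] {A B : LinearMap.BilinForm K V} (hAalt : A.IsAlt) (hBalt : B.IsAlt)
    (c : K) (hc : Function.Injective (B - c • A)) (hA : ¬ Function.Injective A)
    (hB : ¬ Function.Injective B) :
    ∃ W₁ W₂ : Submodule K V, Module.finrank K W₁ < Module.finrank K V ∧
      Module.finrank K W₂ < Module.finrank K V ∧
      ∀ s₁ s₂, HasJKBlocks (A.restrict W₁) (B.restrict W₁) s₁ →
        HasJKBlocks (A.restrict W₂) (B.restrict W₂) s₂ → HasJKBlocks A B (s₁ + s₂) := by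
  -- For c = 0 the form B - cA would be the degenerate form B.
  have hc0 : c ≠ 0 := by
    rintro rfl
    refine hB fun x y h => hc ?_
    simpa using h
  have hex : ∀ C : LinearMap.BilinForm K V, ¬ Function.Injective C → ∃ x, C x = 0 ∧ x ≠ 0 := by
    intro C hC
    by_contra! h
    exact hC ((injective_iff_map_eq_zero _).2 h)
  obtain ⟨N, hN, hNG⟩ := exists_endomorphism_of_injective (hBalt.sub (hAalt.smul c)) hBalt hc
  obtain ⟨n, hn, hn1⟩ := (N.eventually_isCompl_ker_pow_range_pow.and
    (Filter.eventually_ge_atTop 1)).exists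
  have hort : ∀ k x y, (N ^ n) x = 0 → (B - c • A) ((N ^ k) x) ((N ^ n) y) = 0 := by
    intro k x y hx
    rw [← hNG, ← Module.End.mul_apply, ← pow_add, add_comm, pow_add, Module.End.mul_apply, hx]
    simp
  have hBo : ∀ x ∈ LinearMap.ker (N ^ n), ∀ y ∈ LinearMap.range (N ^ n), B x y = 0 := by
    rintro x hx _ ⟨y, rfl⟩
    rw [← hN]
    simpa using hort 1 x y hx
  have hAo : ∀ x ∈ LinearMap.ker (N ^ n), ∀ y ∈ LinearMap.range (N ^ n), A x y = 0 := by
    rintro x hx _ ⟨y, rfl⟩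
    have h1 := hort 0 x y hx
    have h2 := hBo x hx _ ⟨y, rfl⟩
    simp only [pow_zero, Module.End.one_apply, LinearMap.sub_apply, h2, LinearMap.smul_apply,
      zero_sub, neg_eq_zero, smul_eq_mul] at h1
    exact (mul_eq_zero.1 h1).resolve_left hc0
  obtain ⟨b, hb, hb0⟩ := hex B hB
  obtain ⟨a, ha, ha0⟩ := hex A hA
  -- N = (B - cA)⁻¹B is 0 on the kernel of B and 1 on the kernel of A. Both kernels are non-zero, so
  -- neither Fitting summand is all of V.
  have hNb : N b = 0 := hc (by ext y; rw [hN, hb, map_zero])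
  have hNa : ∀ k, (N ^ k) a = a := by
    have h1 : N a = a := hc (by ext y; rw [hN]; simp [ha])
    intro k
    induction k with
    | zero => rfl
    | succ k ih => rw [pow_succ, Module.End.mul_apply, h1, ih]
  refine ⟨LinearMap.ker (N ^ n), LinearMap.range (N ^ n), Submodule.finrank_lt fun h => ?_,
    Submodule.finrank_lt fun h => ?_, fun s₁ s₂ h₁ h₂ => ?_⟩
  · have : a ∈ LinearMap.ker (N ^ n) := h ▸ Submodule.mem_top
    rw [LinearMap.mem_ker, hNa] at this
    exact ha0 this
  · have hbot := hn.inf_eq_bot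
    rw [h, inf_top_eq] at hbot
    have : b ∈ LinearMap.ker (N ^ n) := by
      obtain ⟨n, rfl⟩ := Nat.exists_eq_add_of_le' hn1
      rw [LinearMap.mem_ker, pow_succ, Module.End.mul_apply, hNb, map_zero]
    rw [hbot, Submodule.mem_bot] at this
    exact hb0 this
  · have key : ∀ C : LinearMap.BilinForm K V, C.IsAlt →
        (∀ x ∈ LinearMap.ker (N ^ n), ∀ y ∈ LinearMap.range (N ^ n), C x y = 0) →
        ∀ x y, C (Submodule.prodEquivOfIsCompl _ _ hn x) (Submodule.prodEquivOfIsCompl _ _ hn y) =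
          C.restrict (LinearMap.ker (N ^ n)) x.1 y.1 +
            C.restrict (LinearMap.range (N ^ n)) x.2 y.2 := by
      intro C hC ho x y
      rw [Submodule.coe_prodEquivOfIsCompl', Submodule.coe_prodEquivOfIsCompl', map_add, map_add,
        LinearMap.add_apply, LinearMap.add_apply, ho _ x.1.2 _ y.2.2,
        ← hC.neg_eq _ (x.2 : V), ho _ y.1.2 _ x.2.2]
      simp
    exact HasJKBlocks.add (Submodule.prodEquivOfIsCompl _ _ hn) (key A hAalt hAo)
      (key B hBalt hBo) h₁ h₂

/-! ### The Jordan–Kronecker theorem -/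

/-- The Jordan-Kronecker theorem. -/
theorem exists_hasJKBlocks {K V : Type*} [Field K] [IsAlgClosed K] [NeZero (2 : K)]
    [AddCommGroup V] [Module K V] [FiniteDimensional K V] {A B : LinearMap.BilinForm K V}
    (hA : A.IsAlt) (hB : B.IsAlt) : ∃ s, HasJKBlocks A B s := by
  obtain ⟨d, hd⟩ : ∃ d, Module.finrank K V = d := ⟨_, rfl⟩
  induction d using Nat.strong_induction_on generalizing V with
  | _ d ih =>
  have : Infinite K := IsAlgClosed.instInfinite
  rcases subsingleton_or_nontrivial V with hV | hV
  · exact ⟨0, hasJKBlocks_zero A B⟩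
  have hsplit : (∃ (b : JKBlock K) (W : Submodule K V),
      Module.finrank K W < Module.finrank K V ∧
      ∀ s, HasJKBlocks (A.restrict W) (B.restrict W) s → HasJKBlocks A B (b ::ₘ s)) →
      ∃ s, HasJKBlocks A B s := by
    rintro ⟨b, W, hW, h⟩
    obtain ⟨s, hs⟩ := ih _ (hd ▸ hW) (hA.restrict W) (hB.restrict W) rfl
    exact ⟨_, h s hs⟩
  by_cases hker : ∃ n, kernelSpace A.flip B.flip n ≠ ⊥
  · exact hsplit (exists_kronecker_split hA hB hker)
  push Not at hker
  by_cases hBi : Function.Injective B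
  -- An eigenvalue of B⁻¹A exists over an algebraically closed field and is an eigenvalue of the
  -- pencil.
  · obtain ⟨N, hN, -⟩ := exists_endomorphism_of_injective hB hA hBi
    obtain ⟨μ, hμ⟩ := Module.End.exists_eigenvalue N
    obtain ⟨x, hx⟩ := hμ.exists_hasEigenvector
    refine hsplit (exists_jordan_split hA hB μ hBi fun hinj => hx.2 (hinj ?_))
    ext y
    rw [LinearMap.sub_apply, LinearMap.sub_apply, ← hN, hx.apply_eq_smul]
    simp
  by_cases hAi : Function.Injective A
  · exact hsplit (exists_jordanInf_split hA hB hAi hBi)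
  obtain ⟨c, hc⟩ := exists_injective_of_kernelSpace_eq_bot A B hker
  obtain ⟨W₁, W₂, h₁, h₂, h⟩ := exists_fitting_split hA hB c hc hAi hBi
  obtain ⟨s₁, hs₁⟩ := ih _ (hd ▸ h₁) (hA.restrict W₁) (hB.restrict W₁) rfl
  obtain ⟨s₂, hs₂⟩ := ih _ (hd ▸ h₂) (hA.restrict W₂) (hB.restrict W₂) rfl
  exact ⟨_, h _ _ hs₁ hs₂⟩

/-! ### Pencil spaces and their dimensions -/

/-- The space `chainSpace f g n`, cut down to `kernelSpace f g n` if `Q` holds. -/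
def pencilSpace (Q : Prop) {K X Y : Type*} [Field K] [AddCommGroup X] [Module K X]
    [AddCommGroup Y] [Module K Y] (f g : X →ₗ[K] Y) (n : ℕ) : Submodule K (ℕ → X) where
  carrier := {u | u ∈ chainSpace f g n ∧ (Q → g (u 0) = 0)}
  add_mem' := fun hu hv => ⟨add_mem hu.1 hv.1, fun h => by simp [hu.2 h, hv.2 h]⟩
  zero_mem' := ⟨zero_mem _, by simp⟩
  smul_mem' := fun c u hu => ⟨Submodule.smul_mem _ c hu.1, fun h => by simp [hu.2 h]⟩

section PencilSpace

variable {K X Y X' Y' : Type*} [Field K] [AddCommGroup X] [Module K X] [AddCommGroup Y]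
  [Module K Y] [AddCommGroup X'] [Module K X'] [AddCommGroup Y'] [Module K Y']

instance (Q : Prop) (f g : X →ₗ[K] Y) (n : ℕ) [FiniteDimensional K X] :
    FiniteDimensional K (pencilSpace Q f g n) := by
  let F : pencilSpace Q f g n →ₗ[K] (Fin n → X) :=
    LinearMap.pi (fun i => LinearMap.proj (i : ℕ)) ∘ₗ (pencilSpace Q f g n).subtype
  refine FiniteDimensional.of_injective F ((injective_iff_map_eq_zero _).2 fun u hu => ?_)
  ext i
  rcases lt_or_ge i n with h | h
  · exact congrFun hu ⟨i, h⟩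
  · exact u.2.1.1 i h

/-- The condition at 0 is written with `f 0` so that every condition reads f x = g y: the pencil
space depends on f and g only through this relation, which is what is transported along
isomorphisms. -/
theorem mem_pencilSpace_iff {Q : Prop} {f g : X →ₗ[K] Y} {n : ℕ} {u : ℕ → X} :
    u ∈ pencilSpace Q f g n ↔
      (∀ i, n ≤ i → u i = 0) ∧ (∀ i, f (u i) = g (u (i + 1))) ∧ (Q → f 0 = g (u 0)) := by
  rw [map_zero]
  constructor
  · rintro ⟨⟨h1, h2⟩, h3⟩
    exact ⟨h1, h2, fun h => (h3 h).symm⟩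
  · rintro ⟨h1, h2, h3⟩
    exact ⟨⟨h1, h2⟩, fun h => (h3 h).symm⟩

/-- Pencil spaces are compatible with products. -/
theorem finrank_pencilSpace_pi {ι : Type*} [Fintype ι] {Z T : ι → Type*}
    [∀ i, AddCommGroup (Z i)] [∀ i, Module K (Z i)] [∀ i, FiniteDimensional K (Z i)]
    [∀ i, AddCommGroup (T i)] [∀ i, Module K (T i)] (Q : Prop) (f g : X →ₗ[K] Y)
    (f' g' : ∀ i, Z i →ₗ[K] T i) (φ : X ≃ₗ[K] ∀ i, Z i)
    (h : ∀ x y, f x = g y ↔ ∀ i, f' i (φ x i) = g' i (φ y i)) (n : ℕ) :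
    Module.finrank K (pencilSpace Q f g n) =
      ∑ i, Module.finrank K (pencilSpace Q (f' i) (g' i) n) := by
  rw [← Module.finrank_pi_fintype]
  refine LinearEquiv.finrank_eq (LinearEquiv.ofBijective
    (LinearMap.pi fun i => LinearMap.codRestrict (pencilSpace Q (f' i) (g' i) n)
      (LinearMap.pi (fun k => LinearMap.proj i ∘ₗ φ.toLinearMap ∘ₗ LinearMap.proj k) ∘ₗ
        (pencilSpace Q f g n).subtype) fun u => mem_pencilSpace_iff.2
          ⟨fun k hk => ?_, fun k => ?_, fun hQ => ?_⟩) ⟨?_, fun w => ?_⟩)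
  · simp [(mem_pencilSpace_iff.1 u.2).1 k hk]
  · exact (h _ _).1 ((mem_pencilSpace_iff.1 u.2).2.1 k) i
  · have := (h _ _).1 ((mem_pencilSpace_iff.1 u.2).2.2 hQ) i
    rwa [map_zero, Pi.zero_apply] at this
  · refine (injective_iff_map_eq_zero _).2 fun u hu => ?_
    ext k
    apply φ.injective
    rw [ZeroMemClass.coe_zero, Pi.zero_apply, map_zero]
    ext i
    exact congrFun (congrArg Subtype.val (congrFun hu i)) k
  · refine ⟨⟨fun k => φ.symm fun i => (w i : ℕ → Z i) k, mem_pencilSpace_iff.2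
      ⟨fun k hk => ?_, fun k => (h _ _).2 fun i => ?_, fun hQ => (h _ _).2 fun i => ?_⟩⟩, ?_⟩
    · have : (fun i => (w i : ℕ → Z i) k) = 0 :=
        funext fun i => (mem_pencilSpace_iff.1 (w i).2).1 k hk
      rw [this, map_zero]
    · simpa using (mem_pencilSpace_iff.1 (w i).2).2.1 k
    · simpa using (mem_pencilSpace_iff.1 (w i).2).2.2 hQ
    · ext i k
      simp

theorem finrank_pencilSpace_prod {Z₁ Z₂ T₁ T₂ : Type*} [AddCommGroup Z₁] [Module K Z₁]
    [FiniteDimensional K Z₁] [AddCommGroup Z₂] [Module K Z₂] [FiniteDimensional K Z₂]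
    [AddCommGroup T₁] [Module K T₁] [AddCommGroup T₂] [Module K T₂] (Q : Prop) (f g : X →ₗ[K] Y)
    (f₁ g₁ : Z₁ →ₗ[K] T₁) (f₂ g₂ : Z₂ →ₗ[K] T₂) (φ : X ≃ₗ[K] Z₁ × Z₂)
    (h : ∀ x y, f x = g y ↔ f₁ (φ x).1 = g₁ (φ y).1 ∧ f₂ (φ x).2 = g₂ (φ y).2) (n : ℕ) :
    Module.finrank K (pencilSpace Q f g n) =
      Module.finrank K (pencilSpace Q f₁ g₁ n) + Module.finrank K (pencilSpace Q f₂ g₂ n) := by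
  rw [← Module.finrank_prod]
  refine LinearEquiv.finrank_eq (LinearEquiv.ofBijective
    (LinearMap.prod
      (LinearMap.codRestrict (pencilSpace Q f₁ g₁ n)
      (LinearMap.pi (fun k => LinearMap.fst K Z₁ Z₂ ∘ₗ φ.toLinearMap ∘ₗ LinearMap.proj k) ∘ₗ
        (pencilSpace Q f g n).subtype) fun u => mem_pencilSpace_iff.2
          ⟨fun k hk => ?_, fun k => ?_, fun hQ => ?_⟩)
      (LinearMap.codRestrict (pencilSpace Q f₂ g₂ n)
      (LinearMap.pi (fun k => LinearMap.snd K Z₁ Z₂ ∘ₗ φ.toLinearMap ∘ₗ LinearMap.proj k) ∘ₗ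
        (pencilSpace Q f g n).subtype) fun u => mem_pencilSpace_iff.2
          ⟨fun k hk => ?_, fun k => ?_, fun hQ => ?_⟩)) ⟨?_, fun w => ?_⟩)
  · simp [(mem_pencilSpace_iff.1 u.2).1 k hk]
  · exact ((h _ _).1 ((mem_pencilSpace_iff.1 u.2).2.1 k)).1
  · have := ((h _ _).1 ((mem_pencilSpace_iff.1 u.2).2.2 hQ)).1
    rwa [map_zero] at this
  · simp [(mem_pencilSpace_iff.1 u.2).1 k hk]
  · exact ((h _ _).1 ((mem_pencilSpace_iff.1 u.2).2.1 k)).2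
  · have := ((h _ _).1 ((mem_pencilSpace_iff.1 u.2).2.2 hQ)).2
    rwa [map_zero] at this
  · refine (injective_iff_map_eq_zero _).2 fun u hu => ?_
    ext k
    apply φ.injective
    rw [ZeroMemClass.coe_zero, Pi.zero_apply, map_zero]
    exact Prod.ext (congrFun (congrArg Subtype.val (congrArg Prod.fst hu)) k)
      (congrFun (congrArg Subtype.val (congrArg Prod.snd hu)) k)
  · have h1 := mem_pencilSpace_iff.1 w.1.2
    have h2 := mem_pencilSpace_iff.1 w.2.2
    refine ⟨⟨fun k => φ.symm ((w.1 : ℕ → Z₁) k, (w.2 : ℕ → Z₂) k), mem_pencilSpace_iff.2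
      ⟨fun k hk => ?_, fun k => (h _ _).2 ?_, fun hQ => (h _ _).2 ?_⟩⟩, ?_⟩
    · rw [h1.1 k hk, h2.1 k hk]; exact map_zero _
    · simpa using ⟨h1.2.1 k, h2.2.1 k⟩
    · simpa using And.intro (h1.2.2 hQ) (h2.2.2 hQ)
    · refine Prod.ext (Subtype.ext (funext fun k => ?_)) (Subtype.ext (funext fun k => ?_))
      · simp
      · simp

theorem finrank_pencilSpace_congr (Q : Prop) (f g : X →ₗ[K] Y) (f' g' : X' →ₗ[K] Y')
    [FiniteDimensional K X'] (φ : X ≃ₗ[K] X')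
    (h : ∀ x y, f x = g y ↔ f' (φ x) = g' (φ y)) (n : ℕ) :
    Module.finrank K (pencilSpace Q f g n) = Module.finrank K (pencilSpace Q f' g' n) := by
  have := finrank_pencilSpace_pi (ι := Unit) Q f g (fun _ => f') (fun _ => g')
    (φ ≪≫ₗ (LinearEquiv.funUnique Unit K X').symm) (by simpa using h) n
  simpa using this

/-- Downward propagation: the entries vanish from n on, and f (u i) = g (u (i + 1)) carries this
back to 0. -/
theorem pencilSpace_eq_bot_of_injective_left (Q : Prop) {f g : X →ₗ[K] Y}
    (hf : ∀ x, f x = 0 → x = 0) (n : ℕ) : pencilSpace Q f g n = ⊥ := by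
  rw [Submodule.eq_bot_iff]
  intro u hu
  obtain ⟨h1, h2, -⟩ := mem_pencilSpace_iff.1 hu
  have : ∀ d i, n ≤ i + d → u i = 0 := by
    intro d
    induction d with
    | zero => exact fun i hi => h1 i hi
    | succ d ih =>
      intro i hi
      exact hf _ (by rw [h2, ih (i + 1) (by omega), map_zero])
  exact funext fun i => this n i (by omega)

/-- Upward propagation, starting from g (u 0) = 0. -/
theorem pencilSpace_true_eq_bot_of_injective_right {f g : X →ₗ[K] Y}
    (hg : ∀ x, g x = 0 → x = 0) (n : ℕ) : pencilSpace True f g n = ⊥ := by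
  rw [Submodule.eq_bot_iff]
  intro u hu
  obtain ⟨h1, h2, h3⟩ := mem_pencilSpace_iff.1 hu
  funext i
  induction i with
  | zero => exact hg _ (by rw [← h3 trivial, map_zero])
  | succ i ih => exact hg _ (by rw [← h2, ih, Pi.zero_apply, map_zero])

/-- Dropping the entry u 0 maps the space for n + 1 to that for n; surjectivity of f makes this map
onto, with kernel isomorphic to ker f. -/
theorem finrank_pencilSpace_of_surjective [FiniteDimensional K X] {f g : X →ₗ[K] Y}
    (hf : Function.Surjective f) (n : ℕ) :
    Module.finrank K (pencilSpace False f g n) = n * Module.finrank K (LinearMap.ker f) := by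
  induction n with
  | zero =>
    have : pencilSpace False f g 0 = ⊥ := by
      rw [Submodule.eq_bot_iff]
      exact fun u hu => funext fun i => hu.1.1 i (Nat.zero_le i)
    rw [this, finrank_bot, zero_mul]
  | succ n ih =>
    let S : pencilSpace False f g (n + 1) →ₗ[K] pencilSpace False f g n :=
      LinearMap.codRestrict _ (LinearMap.pi (fun k : ℕ => LinearMap.proj (k + 1)) ∘ₗ
        (pencilSpace False f g (n + 1)).subtype) fun u =>
          ⟨⟨fun i hi => u.2.1.1 (i + 1) (by omega), fun i => u.2.1.2 (i + 1)⟩, False.elim⟩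
    have hS : Function.Surjective S := by
      intro w
      obtain ⟨x, hx⟩ := hf (g ((w : ℕ → X) 0))
      refine ⟨⟨fun i => Nat.casesOn i x fun i => (w : ℕ → X) i,
        ⟨⟨fun i hi => ?_, fun i => ?_⟩, False.elim⟩⟩, rfl⟩
      · rcases i with _ | i
        · omega
        · exact w.2.1.1 i (by omega)
      · rcases i with _ | i
        · exact hx
        · exact w.2.1.2 i
    have hker : Module.finrank K (LinearMap.ker S) = Module.finrank K (LinearMap.ker f) := by
      refine LinearEquiv.finrank_eq (LinearEquiv.ofBijective
        (LinearMap.codRestrict (LinearMap.ker f) (LinearMap.proj 0 ∘ₗ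
          (pencilSpace False f g (n + 1)).subtype ∘ₗ (LinearMap.ker S).subtype) fun u => ?_)
          ⟨(injective_iff_map_eq_zero _).2 fun u hu => ?_, fun x => ?_⟩)
      · have h1 : ((u : pencilSpace False f g (n + 1)) : ℕ → X) 1 = 0 :=
          congrFun (congrArg Subtype.val u.2) 0
        exact (u.1.2.1.2 0).trans (by rw [h1, map_zero])
      · refine Subtype.ext (Subtype.ext (funext fun i => ?_))
        rcases i with _ | i
        · exact congrArg Subtype.val hu
        · exact congrFun (congrArg Subtype.val u.2) i
      · refine ⟨⟨⟨fun i => Nat.casesOn i x.1 fun _ => 0, ⟨⟨fun i hi => ?_, fun i => ?_⟩,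
          False.elim⟩⟩, ?_⟩, rfl⟩
        · rcases i with _ | i
          · omega
          · rfl
        · rcases i with _ | i
          · exact x.2.trans (map_zero g).symm
          · exact (map_zero f).trans (map_zero g).symm
        · exact Subtype.ext (funext fun i => rfl)
    have := LinearMap.finrank_range_add_finrank_ker S
    rw [LinearMap.range_eq_top.2 hS, finrank_top, ih, hker] at this
    rw [← this]; ring

theorem finrank_pencilSpace_one [FiniteDimensional K X] (f g : X →ₗ[K] Y) :
    Module.finrank K (pencilSpace False f g 1) = Module.finrank K (LinearMap.ker f) := by
  refine LinearEquiv.finrank_eq (LinearEquiv.ofBijective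
    (LinearMap.codRestrict (LinearMap.ker f) (LinearMap.proj 0 ∘ₗ
      (pencilSpace False f g 1).subtype) fun u => ?_)
      ⟨(injective_iff_map_eq_zero _).2 fun u hu => ?_, fun x => ?_⟩)
  · exact (u.2.1.2 0).trans (by rw [u.2.1.1 (0 + 1) le_rfl, map_zero])
  · refine Subtype.ext (funext fun i => ?_)
    rcases i with _ | i
    · exact congrArg Subtype.val hu
    · exact u.2.1.1 _ (by omega)
  · refine ⟨⟨fun i => Nat.casesOn i x.1 fun _ => 0, ⟨⟨fun i hi => ?_, fun i => ?_⟩,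
      False.elim⟩⟩, rfl⟩
    · rcases i with _ | i
      · omega
      · rfl
    · rcases i with _ | i
      · exact x.2.trans (map_zero g).symm
      · exact (map_zero f).trans (map_zero g).symm

end PencilSpace

/-! ### Pencil spaces of the halves of a standard block -/

/-- The entries of a vector, followed by zeros. -/
def zeroExtend {K : Type*} [Field K] {k : ℕ} (x : Fin k → K) (i : ℕ) : K :=
  if h : i < k then x ⟨i, h⟩ else 0

section Half

variable {K : Type*} [Field K]

theorem zeroExtend_val {k : ℕ} (x : Fin k → K) (i : Fin k) : zeroExtend x i = x i := by
  simp [zeroExtend]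

theorem zeroExtend_of_lt {k : ℕ} (x : Fin k → K) {i : ℕ} (h : i < k) :
    zeroExtend x i = x ⟨i, h⟩ := dif_pos h

theorem zeroExtend_of_le {k : ℕ} (x : Fin k → K) {i : ℕ} (h : k ≤ i) : zeroExtend x i = 0 :=
  dif_neg (by omega)

theorem zeroExtend_add {k : ℕ} (x y : Fin k → K) (i : ℕ) :
    zeroExtend (x + y) i = zeroExtend x i + zeroExtend y i := by
  unfold zeroExtend; split_ifs <;> simp

theorem zeroExtend_smul {k : ℕ} (c : K) (x : Fin k → K) (i : ℕ) :
    zeroExtend (c • x) i = c * zeroExtend x i := by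
  unfold zeroExtend; split_ifs <;> simp

theorem zeroExtend_zero {k : ℕ} (i : ℕ) : zeroExtend (0 : Fin k → K) i = 0 := by
  unfold zeroExtend; split_ifs <;> simp

theorem eq_zero_of_zeroExtend {k : ℕ} {x : Fin k → K} (h : ∀ i, zeroExtend x i = 0) : x = 0 :=
  funext fun i => by rw [← zeroExtend_val x i, h]; rfl

theorem sum_ite_eq_zeroExtend {k : ℕ} (x : Fin k → K) (i : ℕ) (a : K) :
    ∑ q : Fin k, x q * (if (q : ℕ) = i then a else 0) = zeroExtend x i * a := by
  by_cases h : i < k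
  · rw [zeroExtend_of_lt x h, Finset.sum_eq_single ⟨i, h⟩]
    · simp
    · intro q _ hq
      rw [if_neg fun h' => hq (Fin.ext h'), mul_zero]
    · simp
  · rw [zeroExtend_of_le x (by omega), zero_mul]
    refine Finset.sum_eq_zero fun q _ => ?_
    rw [if_neg (by have := q.2; omega), mul_zero]

/-- A chain is determined by u 0, since u i is u 0 shifted by i places; it vanishes from n on
exactly when u 0 is supported on the first min n k coordinates. -/
theorem finrank_pencilSpace_shift {Y : Type*} [AddCommGroup Y] [Module K Y] {k : ℕ}
    (f g : (Fin k → K) →ₗ[K] Y)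
    (h : ∀ x y, f x = g y ↔ ∀ i < k, zeroExtend x (i + 1) = zeroExtend y i) (n : ℕ) :
    Module.finrank K (pencilSpace False f g n) = min n k := by
  rw [← Module.finrank_fin_fun (R := K) (n := min n k)]
  refine LinearEquiv.finrank_eq (LinearEquiv.ofBijective
    (LinearMap.pi (fun q : Fin (min n k) =>
      LinearMap.proj (⟨q, lt_of_lt_of_le q.2 (min_le_right _ _)⟩ : Fin k) ∘ₗ LinearMap.proj 0) ∘ₗ
        (pencilSpace False f g n).subtype)
      ⟨(injective_iff_map_eq_zero _).2 fun u hu => ?_, fun w => ?_⟩)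
  · obtain ⟨h1, h2, -⟩ := mem_pencilSpace_iff.1 u.2
    have h3 : ∀ i p, zeroExtend ((u : ℕ → Fin k → K) i) p =
        zeroExtend ((u : ℕ → Fin k → K) 0) (p + i) := by
      intro i
      induction i with
      | zero => intro p; rfl
      | succ i ih =>
        intro p
        rcases lt_or_ge p k with hp | hp
        · rw [← (h _ _).1 (h2 i) p hp, ih]
          congr 1; omega
        · rw [zeroExtend_of_le _ hp, zeroExtend_of_le _ (by omega)]
    have h4 : ∀ q, zeroExtend ((u : ℕ → Fin k → K) 0) q = 0 := by
      intro q
      rcases lt_or_ge q k with hq | hq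
      · rcases lt_or_ge q n with hq' | hq'
        · rw [zeroExtend_of_lt _ hq]
          exact congrFun hu ⟨q, lt_min hq' hq⟩
        · have := h3 q 0
          rw [h1 q hq', zeroExtend_zero, zero_add] at this
          exact this.symm
      · exact zeroExtend_of_le _ hq
    exact Subtype.ext (funext fun i => eq_zero_of_zeroExtend fun p => by rw [h3, h4])
  · refine ⟨⟨fun i p => zeroExtend w (p + i), mem_pencilSpace_iff.2
      ⟨fun i hi => funext fun p => ?_, fun i => (h _ _).2 fun p hp => ?_, False.elim⟩⟩,
      funext fun q => zeroExtend_val w q⟩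
    · exact zeroExtend_of_le _ (le_trans (min_le_left _ _) (by omega))
    · rw [zeroExtend_of_lt _ hp]
      rcases lt_or_ge (p + 1) k with hp' | hp'
      · rw [zeroExtend_of_lt _ hp']
        congr 1
        simp only; omega
      · rw [zeroExtend_of_le _ hp', zeroExtend_of_le]
        have := min_le_right n k
        simp only; omega

/-- Here entry p of u i is entry 0 of u (i - p), and 0 if p > i, so the entries at 0 are the
parameters. Entry 0 of u i reappears as entry m of u (i + m), so it must vanish once i + m ≥ n,
which leaves n - m of them. -/
theorem finrank_pencilSpace_kronecker {Y : Type*} [AddCommGroup Y] [Module K Y] {m : ℕ}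
    (f g : (Fin (m + 1) → K) →ₗ[K] Y)
    (h : ∀ x y, f x = g y ↔ ∀ i < m, zeroExtend x i = zeroExtend y (i + 1)) (n : ℕ) :
    Module.finrank K (pencilSpace True f g n) = n - m := by
  rw [← Module.finrank_fin_fun (R := K) (n := n - m)]
  refine LinearEquiv.finrank_eq (LinearEquiv.ofBijective
    (LinearMap.pi (fun q : Fin (n - m) =>
      LinearMap.proj (0 : Fin (m + 1)) ∘ₗ LinearMap.proj (q : ℕ)) ∘ₗ
        (pencilSpace True f g n).subtype)
      ⟨(injective_iff_map_eq_zero _).2 fun u hu => ?_, fun w => ?_⟩)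
  · obtain ⟨h1, h2, h3⟩ := mem_pencilSpace_iff.1 u.2
    have h4 : ∀ j ≤ m, ∀ i, zeroExtend ((u : ℕ → Fin (m + 1) → K) i) 0 =
        zeroExtend ((u : ℕ → Fin (m + 1) → K) (i + j)) j := by
      intro j
      induction j with
      | zero => intro _ i; rfl
      | succ j ih =>
        intro hj i
        rw [ih (by omega), (h _ _).1 (h2 (i + j)) j (by omega)]
        rfl
    have h5 : ∀ i, zeroExtend ((u : ℕ → Fin (m + 1) → K) i) 0 = 0 := by
      intro i
      rcases lt_or_ge i (n - m) with hi | hi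
      · rw [zeroExtend_of_lt _ (by omega)]
        exact congrFun hu ⟨i, hi⟩
      · rw [h4 m le_rfl, h1 _ (by omega), zeroExtend_zero]
    have h6 : ∀ p i, zeroExtend ((u : ℕ → Fin (m + 1) → K) i) p = 0 := by
      intro p
      induction p with
      | zero => exact h5
      | succ p ih =>
        intro i
        rcases lt_or_ge p m with hp | hp
        · rcases i with _ | i
          · rw [← (h _ _).1 (h3 trivial) p hp, zeroExtend_zero]
          · rw [← (h _ _).1 (h2 i) p hp, ih]
        · exact zeroExtend_of_le _ (by omega)
    exact Subtype.ext (funext fun i => eq_zero_of_zeroExtend fun p => h6 p i)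
  · refine ⟨⟨fun i p => if (p : ℕ) ≤ i then zeroExtend w (i - p) else 0, mem_pencilSpace_iff.2
      ⟨fun i hi => funext fun p => ?_, fun i => (h _ _).2 fun p hp => ?_,
        fun _ => (h _ _).2 fun p hp => ?_⟩⟩, funext fun q => ?_⟩
    · have := p.2
      rw [zeroExtend_of_le _ (by omega)]; simp
    · rw [zeroExtend_of_lt _ (show p < m + 1 by omega),
        zeroExtend_of_lt _ (show p + 1 < m + 1 by omega)]
      simp
    · rw [zeroExtend_zero, zeroExtend_of_lt _ (by omega)]
      simp
    · simpa using zeroExtend_val w q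

/-- The action of the upper right quarter of a pencil of blocks on column vectors. -/
def colMap (r c : ℕ) (a d : K) : (Fin c → K) →ₗ[K] (Fin r → K) where
  toFun x p := a * zeroExtend x p + d * zeroExtend x (p + 1)
  map_add' x y := by ext p; simp [zeroExtend_add]; ring
  map_smul' t x := by ext p; simp [zeroExtend_smul]; ring

/-- The action of the upper right quarter of a pencil of blocks on row vectors. -/
def rowMap (r c : ℕ) (a d : K) : (Fin r → K) →ₗ[K] (Fin c → K) where
  toFun x q := a * zeroExtend x q + d * (if (q : ℕ) = 0 then 0 else zeroExtend x (q - 1))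
  map_add' x y := by ext p; simp only [zeroExtend_add, Pi.add_apply]; split_ifs <;> ring
  map_smul' t x := by
    ext p
    simp only [zeroExtend_smul, Pi.smul_apply, smul_eq_mul, RingHom.id_apply]
    split_ifs <;> ring

theorem eq_zero_of_recurrence {k : ℕ} {x : Fin k → K} {a d : K} (ha : a ≠ 0)
    (h : ∀ i < k, a * zeroExtend x i + d * zeroExtend x (i + 1) = 0) : x = 0 := by
  have : ∀ t i, k ≤ i + t → zeroExtend x i = 0 := by
    intro t
    induction t with
    | zero => exact fun i hi => zeroExtend_of_le _ hi
    | succ t ih =>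
      intro i hi
      rcases lt_or_ge i k with h' | h'
      · have := h i h'
        rw [ih (i + 1) (by omega), mul_zero, add_zero] at this
        exact (mul_eq_zero.1 this).resolve_left ha
      · exact zeroExtend_of_le _ h'
  exact eq_zero_of_zeroExtend fun i => this k i (by omega)

theorem colMap_injective {k : ℕ} {a : K} (d : K) (ha : a ≠ 0) (x : Fin k → K)
    (hx : colMap k k a d x = 0) : x = 0 :=
  eq_zero_of_recurrence ha fun i hi => congrFun hx ⟨i, hi⟩

theorem rowMap_injective {r c : ℕ} (hrc : r ≤ c) {a : K} (d : K) (ha : a ≠ 0) (x : Fin r → K)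
    (hx : rowMap r c a d x = 0) : x = 0 := by
  refine eq_zero_of_zeroExtend fun i => ?_
  induction i with
  | zero =>
    rcases lt_or_ge 0 r with h | h
    · have : a * zeroExtend x 0 + d * (if 0 = 0 then 0 else zeroExtend x (0 - 1)) = 0 :=
        congrFun hx ⟨0, by omega⟩
      simpa [ha] using this
    · exact zeroExtend_of_le _ h
  | succ i ih =>
    rcases lt_or_ge (i + 1) r with h | h
    · have : a * zeroExtend x (i + 1) +
          d * (if i + 1 = 0 then 0 else zeroExtend x (i + 1 - 1)) = 0 :=
        congrFun hx ⟨i + 1, by omega⟩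
      simpa [ha, ih] using this
    · exact zeroExtend_of_le _ h

theorem rowMap_injective_of_right {r : ℕ} {d : K} (hd : d ≠ 0) (x : Fin r → K)
    (hx : rowMap r (r + 1) 0 d x = 0) : x = 0 := by
  refine eq_zero_of_zeroExtend fun i => ?_
  rcases lt_or_ge i r with h | h
  · have : 0 * zeroExtend x (i + 1) +
        d * (if i + 1 = 0 then 0 else zeroExtend x (i + 1 - 1)) = 0 :=
      congrFun hx ⟨i + 1, by omega⟩
    simpa [hd] using this
  · exact zeroExtend_of_le _ h

/-- The hypothesis bounds the kernel by dimension 1; rank–nullity then makes f surjective with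
kernel of dimension exactly 1. -/
theorem finrank_pencilSpace_of_ker_le {m : ℕ} {f g : (Fin (m + 1) → K) →ₗ[K] (Fin m → K)}
    (j : Fin (m + 1)) (hf : ∀ x, f x = 0 → x j = 0 → x = 0) (n : ℕ) :
    Module.finrank K (pencilSpace False f g n) = n := by
  have h1 : Module.finrank K (LinearMap.ker f) ≤ 1 := by
    refine le_of_le_of_eq ?_ (Module.finrank_self K)
    refine LinearMap.finrank_le_finrank_of_injective
      (f := LinearMap.proj j ∘ₗ (LinearMap.ker f).subtype)
      ((injective_iff_map_eq_zero _).2 fun x hx => Subtype.ext (hf x x.2 hx))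
  have h2 := LinearMap.finrank_range_add_finrank_ker f
  have h3 := (LinearMap.range f).finrank_le
  rw [Module.finrank_fin_fun] at h2 h3
  have h4 : Function.Surjective f := by
    rw [← LinearMap.range_eq_top]
    exact Submodule.eq_top_of_finrank_eq (by rw [Module.finrank_fin_fun]; omega)
  rw [finrank_pencilSpace_of_surjective h4, show Module.finrank K (LinearMap.ker f) = 1 by omega,
    mul_one]

theorem finrank_pencilSpace_colMap {m : ℕ} {a d : K} (h : a ≠ 0 ∨ (a = 0 ∧ d ≠ 0))
    (g : (Fin (m + 1) → K) →ₗ[K] (Fin m → K)) (n : ℕ) :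
    Module.finrank K (pencilSpace False (colMap m (m + 1) a d) g n) = n := by
  rcases h with ha | ⟨rfl, hd⟩
  · refine finrank_pencilSpace_of_ker_le (Fin.last m) (fun x hx hm => ?_) n
    refine eq_zero_of_recurrence (d := d) ha fun i hi => ?_
    rcases (Nat.le_of_lt_succ hi).lt_or_eq with h' | h'
    · exact congrFun hx ⟨i, h'⟩
    · rw [h', zeroExtend_of_lt _ (Nat.lt_succ_self m), zeroExtend_of_le _ le_rfl,
        show x ⟨m, _⟩ = 0 from hm]
      simp
  · refine finrank_pencilSpace_of_ker_le 0 (fun x hx hm => ?_) n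
    refine eq_zero_of_zeroExtend fun i => ?_
    rcases i with _ | i
    · exact hm
    · rcases lt_or_ge i m with h' | h'
      · have : 0 * zeroExtend x i + d * zeroExtend x (i + 1) = 0 := congrFun hx ⟨i, h'⟩
        simpa [hd] using this
      · exact zeroExtend_of_le _ (by omega)

theorem finrank_pencilSpace_colMap_shift (k n : ℕ) :
    Module.finrank K (pencilSpace False (colMap k k (0 : K) 1) (colMap k k 1 0) n) = min n k := by
  refine finrank_pencilSpace_shift _ _ (fun x y => ⟨fun h i hi => ?_, fun h => funext fun i => ?_⟩) n
  · simpa [colMap] using congrFun h ⟨i, hi⟩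
  · simpa [colMap] using h i i.2

/-- Reversing the order of the coordinates turns the row shift into the column shift. -/
theorem finrank_pencilSpace_rowMap_shift (k n : ℕ) :
    Module.finrank K (pencilSpace False (rowMap k k (0 : K) 1) (rowMap k k 1 0) n) = min n k := by
  rw [← finrank_pencilSpace_colMap_shift (K := K) k n]
  have hrev : ∀ (x : Fin k → K) i, i < k →
      zeroExtend (LinearEquiv.funCongrLeft K K Fin.revPerm x) i = zeroExtend x (k - 1 - i) := by
    intro x i hi
    rw [zeroExtend_of_lt _ hi, zeroExtend_of_lt _ (by omega)]
    change x (Fin.rev _) = _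
    congr 1
    ext; simp [Fin.val_rev]; omega
  refine finrank_pencilSpace_congr False _ _ _ _ (LinearEquiv.funCongrLeft K K Fin.revPerm)
    (fun x y => ?_) n
  have e : ∀ x : Fin k → K, ∀ i < k, (if i = 0 then 0 else zeroExtend x (i - 1)) =
      zeroExtend (LinearEquiv.funCongrLeft K K Fin.revPerm x) (k - 1 - i + 1) := by
    intro x i hi
    split_ifs with h
    · rw [zeroExtend_of_le _ (by omega)]
    · rw [hrev _ _ (by omega)]; congr 1; omega
  have e1 : rowMap k k (0 : K) 1 x = rowMap k k 1 0 y ↔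
      ∀ i < k, zeroExtend (LinearEquiv.funCongrLeft K K Fin.revPerm x) (k - 1 - i + 1) =
        zeroExtend y i := by
    constructor
    · intro h i hi
      rw [← e x i hi]
      simpa [rowMap] using congrFun h ⟨i, hi⟩
    · intro h
      funext i
      have := h i i.2
      rw [← e x i i.2] at this
      simpa [rowMap] using this
  rw [e1]
  constructor
  · intro h
    funext i
    have := h (k - 1 - i) (by have := i.2; omega)
    rw [show k - 1 - (k - 1 - (i : ℕ)) = i by have := i.2; omega, ← hrev _ _ i.2] at this
    simpa [colMap] using this
  · intro h i hi
    have := congrFun h ⟨k - 1 - i, by omega⟩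
    simp only [colMap, LinearMap.coe_mk, AddHom.coe_mk, zero_mul, zero_add, one_mul,
      add_zero] at this
    rw [this, hrev _ _ (by omega)]
    congr 1; omega

end Half

/-! ### Pencil spaces of standard blocks -/

section Blocks

variable {K : Type*} [Field K]

/-- The form `αA + βB` of a standard block in coordinates. -/
def JKBlock.pencilMap (b : JKBlock K) (α β : K) : (b.Index → K) →ₗ[K] (b.Index → K) :=
  Matrix.vecMulLinear (α • b.matrixA + β • b.matrixB)

/-- The dimension of the pencil space of a block with the given coefficients. -/
noncomputable def blockDim (Q : Prop) (r c : ℕ) (a d a' d' : K) (n : ℕ) : ℕ :=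
  Module.finrank K (pencilSpace Q (rowMap r c a d) (rowMap r c a' d') n) +
    Module.finrank K (pencilSpace Q (colMap r c a d) (colMap r c a' d') n)

/-- All blocks have constants on the diagonal and the superdiagonal of the upper right quarter, so
one computation serves them all. A skew matrix of this shape interchanges the two halves of the
basis, hence the pencil space splits into a row part and a column part. -/
theorem JKBlock.finrank_pencilSpace (b : JKBlock K) {a₁ d₁ a₂ d₂ : K}
    (hA : ∀ i j, b.entryA i j = if j = i then a₁ else if j = i + 1 then d₁ else 0)
    (hB : ∀ i j, b.entryB i j = if j = i then a₂ else if j = i + 1 then d₂ else 0)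
    (Q : Prop) (α β γ δ : K) (n : ℕ) :
    Module.finrank K (pencilSpace Q (b.pencilMap α β) (b.pencilMap γ δ) n) =
      blockDim Q b.rows b.cols (α * a₁ + β * a₂) (α * d₁ + β * d₂) (γ * a₁ + δ * a₂)
        (γ * d₁ + δ * d₂) n := by
  have hsum : ∀ (α β : K) (i j : ℕ), α * b.entryA i j + β * b.entryB i j =
      (if j = i then α * a₁ + β * a₂ else 0) + (if j = i + 1 then α * d₁ + β * d₂ else 0) := by
    intro α β i j
    rw [hA, hB]
    by_cases h : j = i
    · have : j ≠ i + 1 := by omega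
      simp [h]
    · by_cases h' : j = i + 1
      · simp [h']
      · simp [h, h']
  have hvec : ∀ (α β : K) (x : b.Index → K) (q : b.Index), b.pencilMap α β x q =
      ∑ p, x p * (α • b.matrixA + β • b.matrixB) p q := fun _ _ _ _ => rfl
  have hr : ∀ (α β : K) (x : b.Index → K) (q : Fin b.cols), b.pencilMap α β x (Sum.inr q) =
      rowMap b.rows b.cols (α * a₁ + β * a₂) (α * d₁ + β * d₂) (fun p => x (Sum.inl p)) q := by
    intro α β x q
    have h1 : b.pencilMap α β x (Sum.inr q) =
        ∑ p : Fin b.rows, x (Sum.inl p) * (α * b.entryA p q + β * b.entryB p q) := by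
      rw [hvec, Fintype.sum_sum_type]
      refine (congrArg₂ (· + ·) rfl (Finset.sum_eq_zero fun q' _ => ?_)).trans (add_zero _)
      simp [JKBlock.matrixA, JKBlock.matrixB, JKBlock.skewMatrix]
    have h2 : ∑ p : Fin b.rows, x (Sum.inl p) * (if (q : ℕ) = p + 1 then α * d₁ + β * d₂ else 0) =
        (if (q : ℕ) = 0 then 0 else zeroExtend (fun p => x (Sum.inl p)) (q - 1)) *
          (α * d₁ + β * d₂) := by
      split_ifs with hq
      · rw [zero_mul]
        refine Finset.sum_eq_zero fun p _ => ?_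
        rw [if_neg (by omega), mul_zero]
      · rw [← sum_ite_eq_zeroExtend]
        refine Finset.sum_congr rfl fun p _ => ?_
        congr 2
        exact propext (by omega)
    have h3 := sum_ite_eq_zeroExtend (fun p => x (Sum.inl p)) (q : ℕ) (α * a₁ + β * a₂)
    rw [h1]
    simp only [hsum, mul_add, Finset.sum_add_distrib] at h2 h3 ⊢
    simp only [eq_comm (a := (q : ℕ))] at h2 h3 ⊢
    rw [h2, h3]
    simp only [rowMap, LinearMap.coe_mk, AddHom.coe_mk, eq_comm (a := (q : ℕ))]
    ring
  have hc : ∀ (α β : K) (x : b.Index → K) (p : Fin b.rows), b.pencilMap α β x (Sum.inl p) =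
      -colMap b.rows b.cols (α * a₁ + β * a₂) (α * d₁ + β * d₂) (fun q => x (Sum.inr q)) p := by
    intro α β x p
    have h1 : b.pencilMap α β x (Sum.inl p) =
        -∑ q : Fin b.cols, x (Sum.inr q) * (α * b.entryA p q + β * b.entryB p q) := by
      rw [← Finset.sum_neg_distrib]
      rw [hvec, Fintype.sum_sum_type]
      refine (congrArg₂ (· + ·) (Finset.sum_eq_zero fun p' _ => ?_)
        (Finset.sum_congr rfl fun q _ => ?_)).trans (zero_add _)
      · simp [JKBlock.matrixA, JKBlock.matrixB, JKBlock.skewMatrix]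
      · simp only [JKBlock.matrixA, JKBlock.matrixB, JKBlock.skewMatrix, Matrix.add_apply,
          Matrix.smul_apply, Matrix.fromBlocks_apply₂₁, Matrix.of_apply, smul_eq_mul]
        ring
    have h2 := sum_ite_eq_zeroExtend (fun p => x (Sum.inr p)) (p + 1 : ℕ) (α * d₁ + β * d₂)
    have h3 := sum_ite_eq_zeroExtend (fun p => x (Sum.inr p)) (p : ℕ) (α * a₁ + β * a₂)
    rw [h1]
    simp only [hsum, mul_add, Finset.sum_add_distrib] at h2 h3 ⊢
    rw [h2, h3]
    simp only [colMap, LinearMap.coe_mk, AddHom.coe_mk]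
    ring
  refine finrank_pencilSpace_prod Q _ _ _ _ _ _
    (LinearEquiv.sumArrowLequivProdArrow (Fin b.rows) (Fin b.cols) K K) (fun x y => ?_) n
  constructor
  · intro h
    constructor
    · ext q
      have := congrFun h (Sum.inr q)
      rwa [hr, hr] at this
    · ext p
      have := congrFun h (Sum.inl p)
      rwa [hc, hc, neg_inj] at this
  · rintro ⟨h1, h2⟩
    ext p
    rcases p with p | q
    · rw [hc, hc, neg_inj]
      exact congrFun h2 p
    · rw [hr, hr]
      exact congrFun h1 q

theorem JKBlock.entryA_jordan (μ : K) (n : ℕ+) (i j : ℕ) : (JKBlock.jordan μ n).entryA i j =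
    if j = i then μ else if j = i + 1 then 1 else 0 := rfl

theorem JKBlock.entryB_jordan (μ : K) (n : ℕ+) (i j : ℕ) : (JKBlock.jordan μ n).entryB i j =
    if j = i then 1 else if j = i + 1 then 0 else 0 := by
  simp [JKBlock.entryB]

theorem JKBlock.entryA_jordanInf (n : ℕ+) (i j : ℕ) :
    (JKBlock.jordanInf n : JKBlock K).entryA i j =
      if j = i then 1 else if j = i + 1 then 0 else 0 := by
  simp [JKBlock.entryA]

theorem JKBlock.entryB_jordanInf (n : ℕ+) (i j : ℕ) :
    (JKBlock.jordanInf n : JKBlock K).entryB i j =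
      if j = i then 0 else if j = i + 1 then 1 else 0 := by
  simp only [JKBlock.entryB]
  split_ifs <;> first | rfl | omega

theorem JKBlock.entryA_kronecker (m : ℕ) (i j : ℕ) :
    (JKBlock.kronecker m : JKBlock K).entryA i j =
      if j = i then 1 else if j = i + 1 then 0 else 0 := by
  simp [JKBlock.entryA]

theorem JKBlock.entryB_kronecker (m : ℕ) (i j : ℕ) :
    (JKBlock.kronecker m : JKBlock K).entryB i j =
      if j = i then 0 else if j = i + 1 then 1 else 0 := by
  simp only [JKBlock.entryB]
  split_ifs <;> first | rfl | omega

/-- The coefficients of the form of the pencil which is degenerate at the given eigenvalue. -/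
def degenerateCoeffs : OnePoint K → K × K
  | some μ => (1, -μ)
  | none => (0, 1)

/-- The coefficients of a form of the pencil complementary to `degenerateCoeffs`. -/
def regularCoeffs : OnePoint K → K × K
  | some _ => (0, 1)
  | none => (1, 0)

open Classical in
/-- The contribution of a block to the dimension of a pencil space at an eigenvalue. -/
noncomputable def JKBlock.chainDim (b : JKBlock K) (μ : OnePoint K) (n : ℕ) : ℕ :=
  if b.eigenvalue? = some μ then 2 * min n b.rows else if b.eigenvalue? = none then n else 0

/-- The contribution of a block to the dimension of the polynomial kernel. -/
def JKBlock.kernelDim (b : JKBlock K) (n : ℕ) : ℕ :=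
  match b with
  | kronecker m => n - m
  | _ => 0

/-- Jordan blocks with another eigenvalue contribute nothing because the first form is injective on
them; those at μ become two nilpotent shifts. A Kronecker block contributes n at every μ, its column
half being surjective with a one-dimensional kernel. -/
theorem JKBlock.finrank_pencilSpace_false (b : JKBlock K) (μ : OnePoint K) (n : ℕ) :
    Module.finrank K (pencilSpace False
      (b.pencilMap (degenerateCoeffs μ).1 (degenerateCoeffs μ).2)
      (b.pencilMap (regularCoeffs μ).1 (regularCoeffs μ).2) n) = b.chainDim μ n := by
  have hinj : ∀ (k : ℕ) (a d a' d' : K), a ≠ 0 → blockDim False k k a d a' d' n = 0 := by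
    intro k a d a' d' ha
    rw [blockDim, pencilSpace_eq_bot_of_injective_left _ (rowMap_injective le_rfl d ha),
      pencilSpace_eq_bot_of_injective_left _ (colMap_injective d ha)]
    simp
  have hshift : ∀ (k : ℕ), blockDim False k k (0 : K) 1 1 0 n = 2 * min n k := by
    intro k
    rw [blockDim, finrank_pencilSpace_rowMap_shift, finrank_pencilSpace_colMap_shift, two_mul]
  cases b with
  | jordan ν k =>
    rw [JKBlock.finrank_pencilSpace _ (JKBlock.entryA_jordan ν k) (JKBlock.entryB_jordan ν k)]
    cases μ with
    | infty =>
      refine (hinj k _ _ _ _ (by simp [degenerateCoeffs])).trans ?_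
      simp [JKBlock.chainDim, JKBlock.eigenvalue?]
    | coe μ =>
      by_cases h : ν = μ
      · subst h
        refine Eq.trans ?_ ((hshift k).trans (if_pos rfl).symm)
        simp [degenerateCoeffs, regularCoeffs, JKBlock.rows, JKBlock.cols]
      · refine (hinj k _ _ _ _ ?_).trans ?_
        · simp only [degenerateCoeffs]
          simpa [← sub_eq_add_neg, sub_eq_zero] using h
        · simp [JKBlock.chainDim, JKBlock.eigenvalue?, h]
  | jordanInf k =>
    rw [JKBlock.finrank_pencilSpace _ (JKBlock.entryA_jordanInf k) (JKBlock.entryB_jordanInf k)]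
    cases μ with
    | infty =>
      refine Eq.trans ?_ ((hshift k).trans (if_pos rfl).symm)
      simp [degenerateCoeffs, regularCoeffs, JKBlock.rows, JKBlock.cols]
    | coe μ =>
      refine (hinj k _ _ _ _ (by simp [degenerateCoeffs])).trans ?_
      simp [JKBlock.chainDim, JKBlock.eigenvalue?]
  | kronecker m =>
    rw [JKBlock.finrank_pencilSpace _ (JKBlock.entryA_kronecker m) (JKBlock.entryB_kronecker m)]
    have h0 : (JKBlock.kronecker m : JKBlock K).chainDim μ n = n := by
      simp [JKBlock.chainDim, JKBlock.eigenvalue?]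
    rw [h0]
    cases μ with
    | infty =>
      have h1 : blockDim False m (m + 1) (0 : K) 1 1 0 n = n := by
        rw [blockDim, pencilSpace_eq_bot_of_injective_left False
          (rowMap_injective_of_right (one_ne_zero' K)), finrank_pencilSpace_colMap
          (Or.inr ⟨rfl, one_ne_zero⟩), finrank_bot, zero_add]
      refine Eq.trans ?_ h1
      simp [degenerateCoeffs, regularCoeffs, JKBlock.rows, JKBlock.cols]
    | coe μ =>
      have h1 : blockDim False m (m + 1) (1 : K) (-μ) 0 1 n = n := by
        rw [blockDim, pencilSpace_eq_bot_of_injective_left False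
          (rowMap_injective (by omega) (-μ) (one_ne_zero' K)), finrank_pencilSpace_colMap
          (Or.inl one_ne_zero), finrank_bot, zero_add]
      refine Eq.trans ?_ h1
      simp [degenerateCoeffs, regularCoeffs, JKBlock.rows, JKBlock.cols]

/-- On a Jordan block one of the two forms is injective, so only Kronecker blocks have polynomial
kernel vectors. -/
theorem JKBlock.finrank_pencilSpace_true (b : JKBlock K) (n : ℕ) :
    Module.finrank K (pencilSpace True (b.pencilMap 1 0) (b.pencilMap 0 1) n) =
      b.kernelDim n := by
  cases b with
  | jordan ν k =>
    rw [JKBlock.finrank_pencilSpace _ (JKBlock.entryA_jordan ν k) (JKBlock.entryB_jordan ν k)]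
    have h1 : blockDim True k k ν 1 1 0 n = 0 := by
      rw [blockDim, pencilSpace_true_eq_bot_of_injective_right
          (rowMap_injective le_rfl 0 (one_ne_zero' K)),
        pencilSpace_true_eq_bot_of_injective_right (colMap_injective 0 (one_ne_zero' K))]
      simp
    refine Eq.trans ?_ h1
    simp [JKBlock.rows, JKBlock.cols]
  | jordanInf k =>
    rw [JKBlock.finrank_pencilSpace _ (JKBlock.entryA_jordanInf k) (JKBlock.entryB_jordanInf k)]
    have h1 : blockDim True k k (1 : K) 0 0 1 n = 0 := by
      rw [blockDim, pencilSpace_eq_bot_of_injective_left _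
          (rowMap_injective le_rfl 0 (one_ne_zero' K)),
        pencilSpace_eq_bot_of_injective_left _ (colMap_injective 0 (one_ne_zero' K))]
      simp
    refine Eq.trans ?_ h1
    simp [JKBlock.rows, JKBlock.cols]
  | kronecker m =>
    rw [JKBlock.finrank_pencilSpace _ (JKBlock.entryA_kronecker m) (JKBlock.entryB_kronecker m)]
    have h1 : blockDim True m (m + 1) (1 : K) 0 0 1 n = n - m := by
      rw [blockDim, pencilSpace_eq_bot_of_injective_left _
        (rowMap_injective (by omega) 0 (one_ne_zero' K)), finrank_bot, zero_add]
      refine finrank_pencilSpace_kronecker _ _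
        (fun x y => ⟨fun h i hi => ?_, fun h => funext fun i => ?_⟩) n
      · simpa [colMap] using congrFun h ⟨i, hi⟩
      · simpa [colMap] using h i i.2
    refine Eq.trans ?_ h1
    simp [JKBlock.rows, JKBlock.cols]

/-- The dimensions of the pencil spaces are sums over the blocks. -/
theorem HasJKBlocks.finrank_pencilSpace {V : Type*} [AddCommGroup V] [Module K V]
    {A B : LinearMap.BilinForm K V} {s : Multiset (JKBlock K)} (h : HasJKBlocks A B s)
    (Q : Prop) (α β γ δ : K) (n : ℕ) :
    Module.finrank K (pencilSpace Q (α • A + β • B) (γ • A + δ • B) n) =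
      (s.map fun b => Module.finrank K
        (pencilSpace Q (b.pencilMap α β) (b.pencilMap γ δ) n)).sum := by
  obtain ⟨N, b, e, rfl, hA, hB⟩ := h
  rw [Multiset.map_map]
  change _ = ∑ i, _
  let φ : V ≃ₗ[K] ∀ i, (b i).Index → K :=
    e.equivFun ≪≫ₗ LinearEquiv.piCurry K fun (i : Fin N) (_ : (b i).Index) => K
  have hφ : ∀ x i p, φ x i p = e.repr x ⟨i, p⟩ := fun x i p => rfl
  have key : ∀ α β x i q, (α • A + β • B) x (e ⟨i, q⟩) = (b i).pencilMap α β (φ x i) q := by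
    intro α β x i q
    have hM : ∀ p, (α • A + β • B) (e p) (e ⟨i, q⟩) =
        Matrix.blockDiagonal' (fun i => α • (b i).matrixA + β • (b i).matrixB) p ⟨i, q⟩ := by
      intro p
      have h1 : A (e p) (e ⟨i, q⟩) = Matrix.blockDiagonal' (fun i => (b i).matrixA) p ⟨i, q⟩ := by
        rw [← hA, LinearMap.BilinForm.toMatrix_apply]
      have h2 : B (e p) (e ⟨i, q⟩) = Matrix.blockDiagonal' (fun i => (b i).matrixB) p ⟨i, q⟩ := by
        rw [← hB, LinearMap.BilinForm.toMatrix_apply]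
      simp only [LinearMap.add_apply, LinearMap.smul_apply, h1, h2, smul_eq_mul]
      obtain ⟨j, p⟩ := p
      by_cases hij : j = i
      · subst hij
        simp only [Matrix.blockDiagonal'_apply_eq]
        rfl
      · simp [Matrix.blockDiagonal'_apply_ne _ _ _ hij]
    conv_lhs => rw [← e.sum_repr x, map_sum, LinearMap.sum_apply]
    simp only [map_smul, LinearMap.smul_apply, smul_eq_mul, hM]
    rw [Fintype.sum_sigma, Finset.sum_eq_single i]
    · simp only [Matrix.blockDiagonal'_apply_eq]
      rfl
    · intro j _ hj
      simp [Matrix.blockDiagonal'_apply_ne _ _ _ hj]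
    · simp
  refine finrank_pencilSpace_pi Q _ _ (fun i => (b i).pencilMap α β)
    (fun i => (b i).pencilMap γ δ) φ (fun x y => ?_) n
  constructor
  · intro h i
    ext q
    rw [← key, ← key, h]
  · intro h
    refine e.ext fun p => ?_
    obtain ⟨i, q⟩ := p
    rw [key, key, h]

end Blocks

/-! ### Uniqueness of the algebraic type -/

/-- With truncated subtraction, the first difference in n counts the elements that are at most n,
and a second difference gives the multiplicities. -/
theorem Multiset.eq_of_sum_tsub_eq {M M' : Multiset ℕ}
    (h : ∀ n, (M.map (n - ·)).sum = (M'.map (n - ·)).sum) : M = M' := by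
  have hstep : ∀ (M : Multiset ℕ) n,
      (M.map (n + 1 - ·)).sum = (M.map (n - ·)).sum + M.countP (· ≤ n) := by
    intro M n
    induction M using Multiset.induction_on with
    | empty => simp
    | cons a M ih =>
      rw [Multiset.map_cons, Multiset.map_cons, Multiset.sum_cons, Multiset.sum_cons, ih,
        Multiset.countP_cons]
      split_ifs <;> omega
  have hcountP : ∀ n, M.countP (· ≤ n) = M'.countP (· ≤ n) := by
    intro n
    have h1 := hstep M n
    have h2 := hstep M' n
    rw [h, h] at h1
    omega
  have hsucc : ∀ (M : Multiset ℕ) n,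
      M.countP (· ≤ n + 1) = M.countP (· ≤ n) + M.count (n + 1) := by
    intro M n
    induction M using Multiset.induction_on with
    | empty => simp
    | cons a M ih =>
      rw [Multiset.countP_cons, Multiset.countP_cons, Multiset.count_cons, ih]
      split_ifs <;> omega
  have hzero : ∀ (M : Multiset ℕ), M.countP (· ≤ 0) = M.count 0 := by
    intro M
    rw [Multiset.count]
    exact Multiset.countP_congr rfl fun x _ => by simp [eq_comm]
  ext n
  rcases n with _ | n
  · rw [← hzero, ← hzero, hcountP]
  · have h1 := hsucc M n
    have h2 := hsucc M' n
    rw [hcountP, hcountP] at h1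
    omega

/-- From (n - m) + min n m = n this reduces to the truncated differences once the cardinalities
agree; positivity lets n = 1 supply them. -/
theorem Multiset.eq_of_sum_min_eq {M M' : Multiset ℕ} (hM : ∀ m ∈ M, 0 < m)
    (hM' : ∀ m ∈ M', 0 < m) (h : ∀ n, (M.map (min n ·)).sum = (M'.map (min n ·)).sum) :
    M = M' := by
  have hcard : ∀ M : Multiset ℕ, (∀ m ∈ M, 0 < m) → (M.map (min 1 ·)).sum = M.card := by
    intro M hM
    have : M.map (min 1 ·) = M.map fun _ => 1 :=
      Multiset.map_congr rfl fun m hm => min_eq_left (hM m hm)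
    rw [this]; simp
  have hsum : ∀ (M : Multiset ℕ) n, (M.map (n - ·)).sum + (M.map (min n ·)).sum = n * M.card := by
    intro M n
    induction M using Multiset.induction_on with
    | empty => simp
    | cons a M ih =>
      simp only [Multiset.map_cons, Multiset.sum_cons, Multiset.card_cons, mul_add, ← ih]
      omega
  refine Multiset.eq_of_sum_tsub_eq fun n => ?_
  have h1 := hsum M n
  have h2 := hsum M' n
  rw [h n, ← hcard M hM, h 1, hcard M' hM'] at h1
  omega

section Uniqueness

variable {K : Type*}

open Classical in
/-- The numbers of rows of the Jordan blocks with a given eigenvalue. -/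
noncomputable def jordanRows (s : Multiset (JKBlock K)) (μ : OnePoint K) : Multiset ℕ :=
  (s.filter fun b => b.eigenvalue? = some μ).map JKBlock.rows

open Classical in
/-- The numbers of rows of the Kronecker blocks. -/
noncomputable def kroneckerRows (s : Multiset (JKBlock K)) : Multiset ℕ :=
  (s.filter fun b => b.eigenvalue? = none).map JKBlock.rows

theorem JKBlock.size_of_eigenvalue?_eq_some {b : JKBlock K} {μ : OnePoint K}
    (h : b.eigenvalue? = some μ) : b.size = 2 * b.rows := by
  cases b with
  | jordan ν n => exact (two_mul _).symm
  | jordanInf n => exact (two_mul _).symm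
  | kronecker m => simp [JKBlock.eigenvalue?] at h

theorem JKBlock.size_of_eigenvalue?_eq_none {b : JKBlock K}
    (h : b.eigenvalue? = none) : b.size = 2 * b.rows + 1 := by
  cases b with
  | jordan ν n => simp [JKBlock.eigenvalue?] at h
  | jordanInf n => simp [JKBlock.eigenvalue?] at h
  | kronecker m => exact (by simp only [size, rows, cols]; omega)

theorem JKBlock.rows_pos {b : JKBlock K} {μ : OnePoint K} (h : b.eigenvalue? = some μ) :
    0 < b.rows := by
  cases b with
  | jordan ν n => exact n.2
  | jordanInf n => exact n.2
  | kronecker m => simp [JKBlock.eigenvalue?] at h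

theorem jordanRows_pos {s : Multiset (JKBlock K)} {μ : OnePoint K} :
    ∀ m ∈ jordanRows s μ, 0 < m := by
  classical
  intro m hm
  obtain ⟨b, hb, rfl⟩ := Multiset.mem_map.1 hm
  exact JKBlock.rows_pos (Multiset.mem_filter.1 hb).2

theorem mem_jkEigenvalues {s : Multiset (JKBlock K)} {μ : OnePoint K} :
    μ ∈ jkEigenvalues s ↔ ∃ b ∈ s, b.eigenvalue? = some μ := by
  classical
  simp [jkEigenvalues, Multiset.mem_filterMap]

theorem mem_jkEigenvalues_iff_jordanRows {s : Multiset (JKBlock K)} {μ : OnePoint K} :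
    μ ∈ jkEigenvalues s ↔ jordanRows s μ ≠ 0 := by
  classical
  rw [mem_jkEigenvalues, jordanRows, Ne, Multiset.map_eq_zero, Multiset.filter_eq_nil]
  push Not
  rfl

theorem jordanSizes_eq (s : Multiset (JKBlock K)) (μ : OnePoint K) :
    jordanSizes s μ = ((jordanRows s μ).map (2 * ·)).sort (· ≥ ·) := by
  classical
  rw [jordanSizes, jordanRows, Multiset.map_map]
  congr 1
  exact Multiset.map_congr rfl fun b hb =>
    JKBlock.size_of_eigenvalue?_eq_some (Multiset.mem_filter.1 hb).2

theorem kroneckerSizes_eq (s : Multiset (JKBlock K)) :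
    kroneckerSizes s = (kroneckerRows s).map (2 * · + 1) := by
  classical
  rw [kroneckerSizes, kroneckerRows, Multiset.map_map]
  exact Multiset.map_congr rfl fun b hb =>
    JKBlock.size_of_eigenvalue?_eq_none (Multiset.mem_filter.1 hb).2

open Classical in
theorem jordanRows_cons (b : JKBlock K) (s : Multiset (JKBlock K)) (μ : OnePoint K) :
    jordanRows (b ::ₘ s) μ =
      if b.eigenvalue? = some μ then b.rows ::ₘ jordanRows s μ else jordanRows s μ := by
  unfold jordanRows
  split_ifs with h
  · rw [Multiset.filter_cons_of_pos (p := fun b : JKBlock K => b.eigenvalue? = some μ) s h,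
      Multiset.map_cons]
  · rw [Multiset.filter_cons_of_neg (p := fun b : JKBlock K => b.eigenvalue? = some μ) s h]

open Classical in
theorem kroneckerRows_cons (b : JKBlock K) (s : Multiset (JKBlock K)) :
    kroneckerRows (b ::ₘ s) =
      if b.eigenvalue? = none then b.rows ::ₘ kroneckerRows s else kroneckerRows s := by
  unfold kroneckerRows
  split_ifs with h
  · rw [Multiset.filter_cons_of_pos (p := fun b : JKBlock K => b.eigenvalue? = none) s h,
      Multiset.map_cons]
  · rw [Multiset.filter_cons_of_neg (p := fun b : JKBlock K => b.eigenvalue? = none) s h]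

theorem sum_chainDim (s : Multiset (JKBlock K)) (μ : OnePoint K) (n : ℕ) [Field K] :
    (s.map fun b => b.chainDim μ n).sum =
      2 * ((jordanRows s μ).map (min n ·)).sum + n * (kroneckerRows s).card := by
  classical
  induction s using Multiset.induction_on with
  | empty => simp [jordanRows, kroneckerRows]
  | cons b s ih =>
    rw [Multiset.map_cons, Multiset.sum_cons, ih, JKBlock.chainDim, jordanRows_cons,
      kroneckerRows_cons]
    by_cases h : b.eigenvalue? = some μ
    · have h' : ¬ b.eigenvalue? = none := by simp [h]
      rw [if_pos h, if_pos h, if_neg h', Multiset.map_cons, Multiset.sum_cons]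
      ring
    · rw [if_neg h, if_neg h]
      by_cases h' : b.eigenvalue? = none
      · rw [if_pos h', if_pos h', Multiset.card_cons]
        ring
      · rw [if_neg h', if_neg h']
        ring

theorem sum_kernelDim (s : Multiset (JKBlock K)) (n : ℕ) [Field K] :
    (s.map fun b => b.kernelDim n).sum = ((kroneckerRows s).map (n - ·)).sum := by
  classical
  induction s using Multiset.induction_on with
  | empty => simp [kroneckerRows]
  | cons b s ih =>
    rw [Multiset.map_cons, Multiset.sum_cons, ih, kroneckerRows_cons]
    cases b with
    | jordan ν k =>
      rw [if_neg (by simp [JKBlock.eigenvalue?])]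
      exact zero_add _
    | jordanInf k =>
      rw [if_neg (by simp [JKBlock.eigenvalue?])]
      exact zero_add _
    | kronecker m =>
      rw [if_pos (by simp [JKBlock.eigenvalue?]), Multiset.map_cons, Multiset.sum_cons]
      rfl

theorem algebraicType_congr {s s' : Multiset (JKBlock K)}
    (hJ : ∀ μ, jordanRows s μ = jordanRows s' μ)
    (hK : kroneckerRows s = kroneckerRows s') : algebraicType s = algebraicType s' := by
  have h1 : jkEigenvalues s = jkEigenvalues s' := by
    ext μ
    rw [mem_jkEigenvalues_iff_jordanRows, mem_jkEigenvalues_iff_jordanRows, hJ]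
  simp only [algebraicType, kroneckerSizes_eq, hK, h1, jordanSizes_eq, hJ]

variable [Field K] {V : Type*} [AddCommGroup V] [Module K V] {A B : LinearMap.BilinForm K V}
  {s s' : Multiset (JKBlock K)}

/-- The left side knows only the pencil and the right side only the blocks, so two decompositions
can be compared through it. -/
theorem HasJKBlocks.finrank_chain (h : HasJKBlocks A B s) (μ : OnePoint K) (n : ℕ) :
    Module.finrank K (pencilSpace False
      ((degenerateCoeffs μ).1 • A + (degenerateCoeffs μ).2 • B)
      ((regularCoeffs μ).1 • A + (regularCoeffs μ).2 • B) n) =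
      2 * ((jordanRows s μ).map (min n ·)).sum + n * (kroneckerRows s).card := by
  rw [h.finrank_pencilSpace, ← sum_chainDim]
  simp only [JKBlock.finrank_pencilSpace_false]

/-- The dimension of the kernel of a form of the pencil. -/
theorem HasJKBlocks.finrank_ker [FiniteDimensional K V] (h : HasJKBlocks A B s)
    (μ : OnePoint K) :
    Module.finrank K (LinearMap.ker ((degenerateCoeffs μ).1 • A + (degenerateCoeffs μ).2 • B)) =
      2 * (jordanRows s μ).card + (kroneckerRows s).card := by
  have h1 := h.finrank_chain μ 1
  rw [finrank_pencilSpace_one] at h1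
  rw [h1, one_mul]
  congr 2
  have : (jordanRows s μ).map (min 1 ·) = (jordanRows s μ).map fun _ => 1 :=
    Multiset.map_congr rfl fun m hm => min_eq_left (jordanRows_pos m hm)
  rw [this]; simp

theorem HasJKBlocks.kroneckerRows_eq (h : HasJKBlocks A B s) (h' : HasJKBlocks A B s') :
    kroneckerRows s = kroneckerRows s' := by
  refine Multiset.eq_of_sum_tsub_eq fun n => ?_
  have h1 := h.finrank_pencilSpace True 1 0 0 1 n
  rw [h'.finrank_pencilSpace True 1 0 0 1 n] at h1
  simp only [JKBlock.finrank_pencilSpace_true, sum_kernelDim] at h1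
  exact h1.symm

/-- The Kronecker terms of the chain dimensions agree and cancel; the sums of min n r that remain
determine the positive numbers r. -/
theorem HasJKBlocks.jordanRows_eq (h : HasJKBlocks A B s) (h' : HasJKBlocks A B s')
    (μ : OnePoint K) : jordanRows s μ = jordanRows s' μ := by
  refine Multiset.eq_of_sum_min_eq jordanRows_pos jordanRows_pos fun n => ?_
  have h1 := h.finrank_chain μ n
  rw [h'.finrank_chain μ n, h.kroneckerRows_eq h'] at h1
  omega

/-- The algebraic type of a pencil does not depend on the decomposition. -/
theorem HasJKBlocks.algebraicType_eq (h : HasJKBlocks A B s) (h' : HasJKBlocks A B s') :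
    algebraicType s = algebraicType s' :=
  algebraicType_congr (h.jordanRows_eq h') (h.kroneckerRows_eq h')

end Uniqueness

/-! ### Specialization of algebraic functions -/

/-- Points of `k` lift along integral extensions. -/
theorem exists_ringHom_of_isIntegral {k R S : Type*} [Field k] [IsAlgClosed k] [CommRing R]
    [Algebra k R] [CommRing S] [Algebra R S] [Algebra.IsIntegral R S]
    (hinj : Function.Injective (algebraMap R S)) (p : R →ₐ[k] k) :
    ∃ φ : S →+* k, ∀ r, φ (algebraMap R S r) = p r := by
  have hp : Function.Surjective p := fun c => ⟨algebraMap k R c, p.commutes c⟩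
  have hmax : (RingHom.ker p).IsMaximal := RingHom.ker_isMaximal_of_surjective p hp
  obtain ⟨Q, hQ, hQp⟩ := Ideal.exists_ideal_over_maximal_of_isIntegral (S := S) (RingHom.ker p)
    (by rw [(RingHom.injective_iff_ker_eq_bot _).1 hinj]; exact bot_le)
  let q : R →+* S ⧸ Q := (Ideal.Quotient.mk Q).comp (algebraMap R S)
  let j : k →+* S ⧸ Q := q.comp (algebraMap k R)
  have hj : j.comp (p : R →+* k) = q := by
    ext r
    refine Ideal.Quotient.eq.2 ?_
    rw [← map_sub, ← Ideal.mem_comap, hQp, RingHom.mem_ker, map_sub]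
    exact sub_eq_zero.2 (p.commutes _)
  have hint : q.IsIntegral := (algebraMap_isIntegral_iff.2 inferInstance).trans _ _
    (RingHom.isIntegral_of_surjective _ Ideal.Quotient.mk_surjective)
  -- The residue field at a maximal ideal over ker p is integral over the algebraically closed field
  -- k, hence equal to k.
  have hjint : j.IsIntegral := RingHom.IsIntegral.tower_top _ _ (hj ▸ hint)
  have hbij := IsAlgClosed.ringHom_bijective_of_isIntegral j hjint
  let je := RingEquiv.ofBijective j hbij
  refine ⟨(je.symm : S ⧸ Q →+* k).comp (Ideal.Quotient.mk Q), fun r => ?_⟩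
  refine je.injective ((je.apply_symm_apply _).trans ?_)
  exact (RingHom.congr_fun hj r).symm

/-- Finitely many elements which are algebraic over `R` can be specialized over all points of a
non-empty basic open set. -/
theorem exists_specialization {k R Ω : Type*} [Field k] [IsAlgClosed k] [CommRing R]
    [Algebra k R] [Field Ω] [Algebra R Ω] [Algebra.IsAlgebraic R Ω]
    (hinj : Function.Injective (algebraMap R Ω)) (S : Finset Ω) :
    ∃ f : R, f ≠ 0 ∧ ∀ p : R →ₐ[k] k, p f ≠ 0 → ∃ (L : Subring Ω) (φ : L →+* k),
      (∀ x ∈ S, x ∈ L) ∧ ∀ r, ∃ h : algebraMap R Ω r ∈ L, φ ⟨_, h⟩ = p r := by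
  have : IsDomain R := hinj.isDomain
  obtain ⟨f, hf0, hf⟩ := Algebra.IsAlgebraic.exists_integral_multiples R S
  refine ⟨f, hf0, fun p hpf => ?_⟩
  let A := (integralClosure R Ω).toSubring
  obtain ⟨φ, hφ⟩ := exists_ringHom_of_isIntegral (S := integralClosure R Ω)
    (fun x y h => hinj (congrArg Subtype.val h)) p
  let φA : A →+* k := φ
  -- The localization of A at ker φ is a subring L of Ω to which φ extends. It contains every x in
  -- S, written as (f x)/f with f x integral and f outside the kernel.
  let P : Ideal A := RingHom.ker φA
  have hP : P.IsPrime := RingHom.ker_isPrime φA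
  let L := (LocalSubring.ofPrime A P).toSubring
  have hunit : ∀ y : P.primeCompl, IsUnit (φA y) := fun y => isUnit_iff_ne_zero.2 y.2
  have hAL : A ≤ L := LocalSubring.le_ofPrime A P
  have hL : ∀ x : A, IsLocalization.lift hunit (⟨x, hAL x.2⟩ : L) = φA x := fun x =>
    IsLocalization.lift_eq hunit x
  have hfA : algebraMap R Ω f ∈ A := (integralClosure R Ω).algebraMap_mem f
  have hfP : (⟨_, hfA⟩ : A) ∈ P.primeCompl := fun h => hpf ((hφ f).symm.trans h)
  refine ⟨L, IsLocalization.lift hunit, fun x hx => ?_, fun r =>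
    ⟨hAL ((integralClosure R Ω).algebraMap_mem r), ?_⟩⟩
  · have hxA : f • x ∈ A := hf x hx
    have h1 := IsLocalization.mk'_spec L (⟨_, hxA⟩ : A) (⟨_, hfP⟩ : P.primeCompl)
    have h2 : ((IsLocalization.mk' L (⟨_, hxA⟩ : A) (⟨_, hfP⟩ : P.primeCompl) : L) : Ω) *
      algebraMap R Ω f = f • x := congrArg Subtype.val h1
    have h3 : algebraMap R Ω f ≠ 0 := fun h => hf0 (hinj (h.trans (map_zero _).symm))
    rw [← mul_right_cancel₀ h3 (h2.trans ((Algebra.smul_def f x).trans (mul_comm _ _)))]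
    exact SetLike.coe_mem _
  · exact (hL ⟨_, (integralClosure R Ω).algebraMap_mem r⟩).trans (hφ r)

/-! ### Specialization of decompositions -/

section Specialization

/-- Apply a function to the finite eigenvalue of a block. -/
def JKBlock.map {K K' : Type*} (g : K → K') : JKBlock K → JKBlock K'
  | jordan μ n => jordan (g μ) n
  | jordanInf n => jordanInf n
  | kronecker m => kronecker m

variable {K K' : Type*} (g : K → K')

theorem JKBlock.rows_map (b : JKBlock K) : (b.map g).rows = b.rows := by cases b <;> rfl

theorem JKBlock.cols_map (b : JKBlock K) : (b.map g).cols = b.cols := by cases b <;> rfl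

theorem JKBlock.eigenvalue?_map (b : JKBlock K) :
    (b.map g).eigenvalue? = b.eigenvalue?.map (OnePoint.map g) := by cases b <;> rfl

/-- The identification of the indices of a block and of its image under `JKBlock.map`. -/
def JKBlock.indexMap (b : JKBlock K) : b.Index ≃ (b.map g).Index :=
  Equiv.sumCongr (finCongr (b.rows_map g).symm) (finCongr (b.cols_map g).symm)

/-- Jordan-Kronecker types do not change if a map which is injective on the eigenvalues is
applied to all blocks. -/
theorem algebraicType_map {s : Multiset (JKBlock K)}
    (hg : Set.InjOn g {μ : K | ((μ : OnePoint K)) ∈ jkEigenvalues s}) :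
    algebraicType (s.map (JKBlock.map g)) = algebraicType s := by
  classical
  let G : OnePoint K → OnePoint K' := OnePoint.map g
  have hG : Set.InjOn G (jkEigenvalues s) := by
    rintro (_ | μ) hμ (_ | ν) hν h
    · rfl
    · cases h
    · cases h
    · exact congrArg some (hg hμ hν (Option.some.inj h))
  have hev : jkEigenvalues (s.map (JKBlock.map g)) = (jkEigenvalues s).image G := by
    ext μ
    rw [mem_jkEigenvalues, Finset.mem_image]
    constructor
    · rintro ⟨b', hb', hb⟩
      obtain ⟨b, hbs, rfl⟩ := Multiset.mem_map.1 hb'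
      rw [JKBlock.eigenvalue?_map] at hb
      obtain ⟨ν, hν, rfl⟩ := Option.map_eq_some_iff.1 hb
      exact ⟨ν, mem_jkEigenvalues.2 ⟨b, hbs, hν⟩, rfl⟩
    · rintro ⟨ν, hν, rfl⟩
      obtain ⟨b, hb, hbν⟩ := mem_jkEigenvalues.1 hν
      exact ⟨_, Multiset.mem_map_of_mem _ hb, by rw [JKBlock.eigenvalue?_map, hbν]; rfl⟩
  have hK : kroneckerRows (s.map (JKBlock.map g)) = kroneckerRows s := by
    simp only [kroneckerRows, Multiset.filter_map, Multiset.map_map]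
    rw [Multiset.filter_congr (q := fun b : JKBlock K => b.eigenvalue? = none)
      fun b _ => by
        rw [Function.comp_apply, JKBlock.eigenvalue?_map, Option.map_eq_none_iff]]
    exact Multiset.map_congr rfl fun b _ => b.rows_map g
  have hJ : ∀ μ ∈ jkEigenvalues s,
      jordanRows (s.map (JKBlock.map g)) (G μ) = jordanRows s μ := by
    intro μ hμ
    simp only [jordanRows, Multiset.filter_map, Multiset.map_map]
    rw [Multiset.filter_congr (q := fun b : JKBlock K => b.eigenvalue? = some μ)]
    · exact Multiset.map_congr rfl fun b _ => b.rows_map g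
    · intro b hb
      simp only [Function.comp_apply, JKBlock.eigenvalue?_map]
      refine ⟨fun h => ?_, fun h => by rw [h]; rfl⟩
      obtain ⟨ν, hν, h⟩ := Option.map_eq_some_iff.1 h
      exact hν.trans (congrArg some (hG (mem_jkEigenvalues.2 ⟨b, hb, hν⟩) hμ h))
  simp only [algebraicType, kroneckerSizes_eq, hK, hev, jordanSizes_eq]
  rw [Finset.image_val_of_injOn hG, Multiset.map_map]
  congr 1
  exact Multiset.map_congr rfl fun μ hμ => by rw [Function.comp_apply, hJ μ hμ]

theorem JKBlock.skewMatrix_map [Field K] [Field K'] (b : JKBlock K) {c : ℕ → ℕ → K}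
    {c' : ℕ → ℕ → K'} (h0 : g 0 = 0) (hc : ∀ i j, g (c i j) = c' i j)
    (hn : ∀ i j, g (-c i j) = -c' i j) (p q : b.Index) :
    (b.map g).skewMatrix c' (b.indexMap g p) (b.indexMap g q) = g (b.skewMatrix c p q) := by
  rcases p with p | p <;> rcases q with q | q
  · exact h0.symm
  · exact (hc _ _).symm
  · exact (hn _ _).symm
  · exact h0.symm

theorem blockDiagonal'_map_skewMatrix [Field K] [Field K'] {ι : Type*} [DecidableEq ι]
    (b : ι → JKBlock K) {c : JKBlock K → ℕ → ℕ → K} {c' : JKBlock K' → ℕ → ℕ → K'}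
    (h0 : g 0 = 0) (hc : ∀ n i j, g (c (b n) i j) = c' ((b n).map g) i j)
    (hn : ∀ n i j, g (-c (b n) i j) = -c' ((b n).map g) i j) (p q : Σ i, (b i).Index) :
    Matrix.blockDiagonal' (fun i => ((b i).map g).skewMatrix (c' ((b i).map g)))
      ⟨p.1, (b p.1).indexMap g p.2⟩ ⟨q.1, (b q.1).indexMap g q.2⟩ =
    g (Matrix.blockDiagonal' (fun i => (b i).skewMatrix (c (b i))) p q) := by
  obtain ⟨i, p⟩ := p
  obtain ⟨j, q⟩ := q
  by_cases h : i = j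
  · subst h
    rw [Matrix.blockDiagonal'_apply_eq, Matrix.blockDiagonal'_apply_eq]
    exact JKBlock.skewMatrix_map g _ h0 (hc i) (hn i) p q
  · rw [Matrix.blockDiagonal'_apply_ne _ _ _ h, Matrix.blockDiagonal'_apply_ne _ _ _ h, h0]

open Matrix in
/-- A Jordan-Kronecker decomposition over a field of functions specializes to points which avoid
finitely many poles. -/
theorem HasJKBlocks.specialize {Ω k V n : Type*} [Field Ω] [Field k] [AddCommGroup V] [Module k V]
    [Fintype n] [DecidableEq n] {MA MB : Matrix n n Ω} {s : Multiset (JKBlock Ω)}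
    (h : HasJKBlocks (Matrix.toBilin' MA) (Matrix.toBilin' MB) s) (bs : Module.Basis n k V) :
    ∃ S : Finset Ω, ∀ (L : Subring Ω) (φ : L →+* k), (∀ x ∈ S, x ∈ L) →
      ∀ (NA NB : Matrix n n L), NA.map L.subtype = MA → NB.map L.subtype = MB →
      ∀ (A B : LinearMap.BilinForm k V), LinearMap.BilinForm.toMatrix bs A = NA.map φ →
        LinearMap.BilinForm.toMatrix bs B = NB.map φ → HasAlgebraicType A B (algebraicType s) := by
  classical
  obtain ⟨N, b, e, hs, hA, hB⟩ := h
  let P : Matrix n (Σ i, (b i).Index) Ω := (Pi.basisFun Ω n).toMatrix e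
  let Q : Matrix (Σ i, (b i).Index) n Ω := e.toMatrix (Pi.basisFun Ω n)
  have hPQ : P * Q = 1 := Module.Basis.toMatrix_mul_toMatrix_flip _ _
  have hQP : Q * P = 1 := Module.Basis.toMatrix_mul_toMatrix_flip _ _
  have hform : ∀ M : Matrix n n Ω,
      LinearMap.BilinForm.toMatrix e (Matrix.toBilin' M) = Pᵀ * M * P := by
    intro M
    ext p q
    rw [LinearMap.BilinForm.toMatrix_apply, Matrix.toBilin'_apply', Matrix.mul_assoc,
      Matrix.mul_apply]
    rfl
  rw [hform] at hA hB
  let D : Finset Ω := Finset.univ.image fun i => match b i with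
    | .jordan μ _ => μ
    | _ => 0
  have hD : ∀ i μ m, b i = .jordan μ m → μ ∈ D := fun i μ m hi =>
    Finset.mem_image.2 ⟨i, Finset.mem_univ _, by rw [hi]⟩
  -- The inverse differences keep distinct eigenvalues distinct after specialization; with both P
  -- and Q defined, the specialized transition matrix stays invertible.
  refine ⟨D ∪ (D ×ˢ D).image (fun d => (d.1 - d.2)⁻¹) ∪
    Finset.univ.image (fun d : _ × _ => P d.1 d.2) ∪ Finset.univ.image (fun d : _ × _ => Q d.1 d.2), ?_⟩
  intro L φ hL NA NB hNA hNB A B hA' hB'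
  simp only [Finset.mem_union, Finset.mem_image, Finset.mem_univ, true_and,
    Finset.mem_product] at hL
  have hLD : ∀ μ ∈ D, μ ∈ L := fun μ hμ => hL _ (Or.inl (Or.inl (Or.inl hμ)))
  have hLP : ∀ i j, P i j ∈ L := fun i j => hL _ (Or.inl (Or.inr ⟨(i, j), rfl⟩))
  have hLQ : ∀ i j, Q i j ∈ L := fun i j => hL _ (Or.inr ⟨(i, j), rfl⟩)
  have hLI : ∀ μ ∈ D, ∀ ν ∈ D, (μ - ν)⁻¹ ∈ L := fun μ hμ ν hν =>
    hL _ (Or.inl (Or.inl (Or.inr ⟨(μ, ν), ⟨hμ, hν⟩, rfl⟩)))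
  -- A total function extending φ, so that it can be applied to blocks; the value off L is never
  -- relevant.
  let g : Ω → k := fun x => if h : x ∈ L then φ ⟨x, h⟩ else 0
  have hg : ∀ x : L, g x = φ x := fun x => dif_pos x.2
  have hg0 : g 0 = 0 := (hg 0).trans (map_zero φ)
  have hg1 : g 1 = 1 := (hg 1).trans (map_one φ)
  have hgn : ∀ x ∈ L, g (-x) = -g x := fun x hx =>
    (hg (-⟨x, hx⟩)).trans ((map_neg φ _).trans (congrArg _ (hg ⟨x, hx⟩).symm))
  have hginj : Set.InjOn g D := by
    intro μ hμ ν hν h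
    by_contra hne
    have h1 : (⟨μ, hLD μ hμ⟩ - ⟨ν, hLD ν hν⟩ : L) * ⟨_, hLI μ hμ ν hν⟩ = 1 :=
      Subtype.ext (mul_inv_cancel₀ (sub_ne_zero.2 hne))
    have h2 := congrArg φ h1
    rw [map_mul, map_sub, ← hg, ← hg, map_one] at h2
    simp only at h2
    rw [h, sub_self, zero_mul] at h2
    exact zero_ne_one h2
  let P' : Matrix n (Σ i, (b i).Index) L := Matrix.of fun i j => ⟨P i j, hLP i j⟩
  let Q' : Matrix (Σ i, (b i).Index) n L := Matrix.of fun i j => ⟨Q i j, hLQ i j⟩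
  have hP'm : P'.map L.subtype = P := rfl
  have hQ'm : Q'.map L.subtype = Q := rfl
  have hinj : Function.Injective L.subtype := Subtype.val_injective
  have hPQ' : P' * Q' = 1 := Matrix.map_injective hinj (by
    beta_reduce
    rw [Matrix.map_mul, hP'm, hQ'm, hPQ, Matrix.map_one _ (map_zero _) (map_one _)])
  have hQP' : Q' * P' = 1 := Matrix.map_injective hinj (by
    beta_reduce
    rw [Matrix.map_mul, hP'm, hQ'm, hQP, Matrix.map_one _ (map_zero _) (map_one _)])
  have hPQφ : P'.map φ * Q'.map φ = 1 := by
    rw [← Matrix.map_mul, hPQ', Matrix.map_one _ (map_zero _) (map_one _)]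
  have hQPφ : Q'.map φ * P'.map φ = 1 := by
    rw [← Matrix.map_mul, hQP', Matrix.map_one _ (map_zero _) (map_one _)]
  let e' : Module.Basis (Σ i, (b i).Index) k V :=
    Module.Basis.ofEquivFun (bs.equivFun.trans (Matrix.toLin'OfInv hPQφ hQPφ))
  have he' : bs.toMatrix e' = P'.map φ := by
    ext i p
    rw [Module.Basis.toMatrix_apply, ← Module.Basis.equivFun_apply]
    have : bs.equivFun (e' p) = (P'.map φ) *ᵥ Pi.single p 1 := by
      refine (Matrix.toLin'OfInv hPQφ hQPφ).injective ?_
      have h1 : e'.equivFun (e' p) = Pi.single p 1 := by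
        ext q
        rw [Module.Basis.equivFun_self, Pi.single_apply]
        exact if_congr eq_comm rfl rfl
      have h2 : Matrix.toLin'OfInv hPQφ hQPφ ((P'.map φ) *ᵥ Pi.single p 1) = Pi.single p 1 := by
        change (Q'.map φ) *ᵥ ((P'.map φ) *ᵥ Pi.single p 1) = _
        rw [Matrix.mulVec_mulVec, hQPφ, Matrix.one_mulVec]
      rw [h2]
      exact h1
    rw [this, Matrix.mulVec_single_one]
    rfl
  let τ : (Σ i, (b i).Index) ≃ Σ i, ((b i).map g).Index :=
    Equiv.sigmaCongrRight fun i => (b i).indexMap g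
  have key : ∀ (M : Matrix n n Ω) (N : Matrix n n L) (F : LinearMap.BilinForm k V)
      (W : Matrix (Σ i, (b i).Index) (Σ i, (b i).Index) Ω), Pᵀ * M * P = W →
      N.map L.subtype = M → LinearMap.BilinForm.toMatrix bs F = N.map φ → ∀ p q,
      F (e' p) (e' q) = g (W p q) := by
    intro M N F W hW hN hF p q
    have h1 : LinearMap.BilinForm.toMatrix e' F = (P'ᵀ * N * P').map φ := by
      rw [← LinearMap.BilinForm.toMatrix_mul_basis_toMatrix bs e' F, he', hF, Matrix.map_mul,
        Matrix.map_mul, Matrix.transpose_map]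
    rw [← LinearMap.BilinForm.toMatrix_apply e' F, h1, Matrix.map_apply, ← hg]
    have h2 : (P'ᵀ * N * P').map L.subtype = W := by
      rw [Matrix.map_mul, Matrix.map_mul, hN, ← hW]; rfl
    rw [← h2]; rfl
  refine ⟨Finset.univ.val.map fun i => (b i).map g, ?_, ?_⟩
  · have hgA : ∀ n i j, g ((b n).entryA i j) = ((b n).map g).entryA i j := by
      intro n i j
      cases h : b n <;> simp only [JKBlock.map, JKBlock.entryA] <;> split_ifs <;>
        first | rfl | assumption
    have hgB : ∀ n i j, g ((b n).entryB i j) = ((b n).map g).entryB i j := by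
      intro n i j
      cases h : b n <;> simp only [JKBlock.map, JKBlock.entryB] <;> split_ifs <;>
        first | rfl | assumption
    have hmA : ∀ n i j, (b n).entryA i j ∈ L := by
      intro n i j
      cases h : b n <;> simp only [JKBlock.entryA] <;> split_ifs <;>
        first | exact L.zero_mem | exact L.one_mem | exact hLD _ (hD _ _ _ h)
    have hmB : ∀ n i j, (b n).entryB i j ∈ L := by
      intro n i j
      cases h : b n <;> simp only [JKBlock.entryB] <;> split_ifs <;>
        first | exact L.zero_mem | exact L.one_mem
    refine hasJKBlocks_of_basis _ (e'.reindex τ) ?_ ?_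
    · intro p q
      obtain ⟨p, rfl⟩ := τ.surjective p
      obtain ⟨q, rfl⟩ := τ.surjective q
      rw [Module.Basis.reindex_apply, Module.Basis.reindex_apply, Equiv.symm_apply_apply,
        Equiv.symm_apply_apply, key MA NA A _ hA hNA hA']
      exact (blockDiagonal'_map_skewMatrix g b (c := JKBlock.entryA) (c' := JKBlock.entryA) hg0 hgA
        (fun n i j => (hgn _ (hmA n i j)).trans (congrArg _ (hgA n i j))) p q).symm
    · intro p q
      obtain ⟨p, rfl⟩ := τ.surjective p
      obtain ⟨q, rfl⟩ := τ.surjective q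
      rw [Module.Basis.reindex_apply, Module.Basis.reindex_apply, Equiv.symm_apply_apply,
        Equiv.symm_apply_apply, key MB NB B _ hB hNB hB']
      exact (blockDiagonal'_map_skewMatrix g b (c := JKBlock.entryB) (c' := JKBlock.entryB) hg0 hgB
        (fun n i j => (hgn _ (hmB n i j)).trans (congrArg _ (hgB n i j))) p q).symm
  · rw [hs, ← algebraicType_map g (s := Multiset.map b Finset.univ.val), Multiset.map_map]
    · rfl
    · have hsub : ∀ μ : Ω, (μ : OnePoint Ω) ∈ jkEigenvalues (Multiset.map b Finset.univ.val) →
          μ ∈ D := by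
        intro μ hμ
        obtain ⟨b', hb', hμ⟩ := mem_jkEigenvalues.1 hμ
        obtain ⟨i, -, rfl⟩ := Multiset.mem_map.1 hb'
        cases h : b i with
        | jordan ν m =>
          rw [h] at hμ
          have : ν = μ := OnePoint.coe_injective (Option.some.inj hμ)
          exact this ▸ hD i ν m h
        | jordanInf m => rw [h] at hμ; exact absurd (Option.some.inj hμ) (OnePoint.infty_ne_coe μ)
        | kronecker m => rw [h] at hμ; cases hμ
      exact fun μ hμ ν hν hh => hginj (hsub μ hμ) (hsub ν hν) hh

end Specialization

/-! ### Zariski open sets -/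

section Zariski

variable {K E F : Type*} [Field K] [AddCommGroup E] [Module K E] [AddCommGroup F] [Module K F]

theorem IsZariskiOpen.inter {U W : Set E} (hU : IsZariskiOpen K U) (hW : IsZariskiOpen K W) :
    IsZariskiOpen K (U ∩ W) := by
  obtain ⟨S, rfl⟩ := hU
  obtain ⟨T, rfl⟩ := hW
  refine ⟨Set.image2 (· * ·) S T, ?_⟩
  ext v
  constructor
  · rintro ⟨⟨p, hp, hpv⟩, q, hq, hqv⟩
    exact ⟨p * q, ⟨p, hp, q, hq, rfl⟩, by rw [map_mul]; exact mul_ne_zero hpv hqv⟩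
  · rintro ⟨_, ⟨p, hp, q, hq, rfl⟩, hpq⟩
    rw [map_mul] at hpq
    exact ⟨⟨p, hp, left_ne_zero_of_mul hpq⟩, q, hq, right_ne_zero_of_mul hpq⟩

theorem IsZariskiOpen.preimage {U : Set F} (hU : IsZariskiOpen K U) (f : E →ₗ[K] F) :
    IsZariskiOpen K (f ⁻¹' U) := by
  obtain ⟨S, rfl⟩ := hU
  refine ⟨(MvPolynomial.rename fun φ : Module.Dual K F => φ ∘ₗ f) '' S, ?_⟩
  ext v
  simp only [Set.mem_preimage, Set.mem_ofPred_eq, Set.exists_mem_image, MvPolynomial.eval_rename]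
  rfl

/-- All but finitely many points of a line through a point of a Zariski open set belong to it. -/
theorem IsZariskiOpen.finite_line {U : Set E} (hU : IsZariskiOpen K U) {v w : E} {t₀ : K}
    (hv : v + t₀ • w ∈ U) : {t : K | v + t • w ∉ U}.Finite := by
  obtain ⟨S, rfl⟩ := hU
  obtain ⟨p, hp, hpv⟩ := hv
  -- The restriction of p to the line, as a polynomial in one variable; it is non-zero because of
  -- its value at t₀.
  let q : Polynomial K := MvPolynomial.aeval
    (fun φ : Module.Dual K E => Polynomial.C (φ v) + Polynomial.X * Polynomial.C (φ w)) p
  have hq : ∀ t, q.eval t = MvPolynomial.eval (fun φ : Module.Dual K E => φ (v + t • w)) p := by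
    intro t
    rw [← Polynomial.coe_evalRingHom, MvPolynomial.map_aeval, MvPolynomial.eval]
    congr 1
    ext x
    · simp
    · simp only [MvPolynomial.coe_eval₂Hom, MvPolynomial.eval₂_X,
        Polynomial.coe_evalRingHom, Polynomial.eval_mul, Polynomial.eval_C,
        Polynomial.eval_X, map_add, map_smul, smul_eq_mul]
  have hq0 : q ≠ 0 := fun h => hpv (by rw [← hq, h, Polynomial.eval_zero])
  refine (Polynomial.finite_setOfPred_isRoot hq0).subset fun t ht => ?_
  by_contra hne
  exact ht ⟨p, hp, fun h => hne ((hq t).trans h)⟩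

/-- On the line joining a point of U to a point of W, each set misses only finitely many parameters.
-/
theorem IsZariskiOpen.inter_nonempty [Infinite K] {U W : Set E} (hU : IsZariskiOpen K U)
    (hW : IsZariskiOpen K W) (hU' : U.Nonempty) (hW' : W.Nonempty) : (U ∩ W).Nonempty := by
  obtain ⟨u, hu⟩ := hU'
  obtain ⟨w, hw⟩ := hW'
  have h1 := hU.finite_line (v := u) (w := w - u) (t₀ := 0) (by simpa using hu)
  have h2 := hW.finite_line (v := u) (w := w - u) (t₀ := 1) (by simpa using hw)
  obtain ⟨t, ht⟩ := (h1.union h2).infinite_compl.nonempty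
  simp only [Set.mem_compl_iff, Set.mem_union, Set.mem_ofPred_eq, not_or, not_not] at ht
  exact ⟨_, ht⟩

end Zariski

theorem Matrix.isAlt_toBilin'_of_transpose_eq_neg {K n : Type*} [Field K] [NeZero (2 : K)]
    [Fintype n] [DecidableEq n] {M : Matrix n n K} (h : M.transpose = -M) :
    (Matrix.toBilin' M).IsAlt := by
  intro v
  have h1 : v ⬝ᵥ (M.mulVec v) = -(v ⬝ᵥ M.mulVec v) := by
    conv_lhs => rw [Matrix.dotProduct_mulVec, ← Matrix.mulVec_transpose, h, Matrix.neg_mulVec,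
      neg_dotProduct, dotProduct_comm]
  rw [Matrix.toBilin'_apply']
  have h2 : (2 : K) * (v ⬝ᵥ M.mulVec v) = 0 := by rw [two_mul]; exact eq_neg_iff_add_eq_zero.1 h1
  exact (mul_eq_zero.1 h2).resolve_left two_ne_zero

/-! ### Existence and uniqueness of the generic type -/

section Generic

theorem lieForm_apply {K L : Type*} [Field K] [LieRing L] [LieAlgebra K L] (x : Module.Dual K L)
    (ξ η : L) : lieForm x ξ η = x ⁅ξ, η⁆ := rfl

/-- The matrix of the form `lieForm x` with indeterminates as the coordinates of `x`. -/
noncomputable def genericLieMatrix {K L ι σ : Type*} [Field K] [LieRing L] [LieAlgebra K L]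
    [Fintype ι] (bs : Module.Basis ι K L) (c : ι → σ) : Matrix ι ι (MvPolynomial σ K) :=
  Matrix.of fun i j => ∑ k, MvPolynomial.C (bs.repr ⁅bs i, bs j⁆ k) * MvPolynomial.X (c k)

section

variable {K L ι σ : Type*} [Field K] [LieRing L] [LieAlgebra K L] [Fintype ι]
  (bs : Module.Basis ι K L) (c : ι → σ)

theorem genericLieMatrix_transpose :
    (genericLieMatrix bs c).transpose = -genericLieMatrix bs c := by
  ext1 i j
  simp only [genericLieMatrix, Matrix.transpose_apply, Matrix.of_apply, Matrix.neg_apply,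
    ← Finset.sum_neg_distrib, ← neg_mul, ← map_neg]
  refine Finset.sum_congr rfl fun k _ => ?_
  rw [← lie_skew, map_neg, Finsupp.neg_apply, map_neg]

theorem aeval_genericLieMatrix [DecidableEq ι] (v : σ → K) (x : Module.Dual K L)
    (hx : ∀ k, v (c k) = x (bs k)) :
    LinearMap.BilinForm.toMatrix bs (lieForm x) =
      (genericLieMatrix bs c).map (MvPolynomial.aeval v : MvPolynomial σ K →ₐ[K] K) := by
  ext i j
  rw [LinearMap.BilinForm.toMatrix_apply, lieForm_apply, Matrix.map_apply, genericLieMatrix,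
    Matrix.of_apply, map_sum]
  conv_lhs => rw [← bs.sum_repr ⁅bs i, bs j⁆, map_sum]
  refine Finset.sum_congr rfl fun k _ => ?_
  rw [map_smul, map_mul, MvPolynomial.aeval_X, hx, MvPolynomial.aeval_C]
  rfl

end

/-- The generic algebraic type of a finite-dimensional Lie algebra exists. -/
theorem exists_isGenericJKType (L : Type*) [LieRing L] [LieAlgebra ℂ L] [FiniteDimensional ℂ L] :
    ∃ T, IsGenericJKType L T := by
  classical
  let bs := Module.finBasis ℂ L
  let n := Fin (Module.finrank ℂ L)
  -- The coordinate ring of L* × L*: left variables are the coordinates of x, right variables those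
  -- of a.
  let R := MvPolynomial (n ⊕ n) ℂ
  let Ω := AlgebraicClosure (FractionRing R)
  have hinj : Function.Injective (algebraMap R Ω) := by
    rw [IsScalarTower.algebraMap_eq R (FractionRing R) Ω]
    exact (algebraMap (FractionRing R) Ω).injective.comp (IsFractionRing.injective R _)
  have halg : Algebra.IsAlgebraic R Ω :=
    (IsFractionRing.comap_isAlgebraic_iff (A := R) (K := FractionRing R) (C := Ω)).2 inferInstance
  have h2 : NeZero (2 : Ω) := inferInstance
  have halt : ∀ c : n → n ⊕ n,
      (Matrix.toBilin' ((genericLieMatrix bs c).map (algebraMap R Ω))).IsAlt := by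
    intro c
    refine Matrix.isAlt_toBilin'_of_transpose_eq_neg ?_
    ext1 i j
    exact (congrArg _ (congrFun₂ (genericLieMatrix_transpose bs c) i j)).trans
      (map_neg (algebraMap R Ω) _)
  obtain ⟨s, hs⟩ := exists_hasJKBlocks (halt Sum.inl) (halt Sum.inr)
  obtain ⟨S, hS⟩ := hs.specialize bs
  obtain ⟨f, hf0, hf⟩ := exists_specialization (k := ℂ) hinj S
  let c : n ⊕ n → Module.Dual ℂ (Module.Dual ℂ L × Module.Dual ℂ L) :=
    Sum.elim (fun i => Module.Dual.eval ℂ L (bs i) ∘ₗ LinearMap.fst ℂ _ _)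
      (fun i => Module.Dual.eval ℂ L (bs i) ∘ₗ LinearMap.snd ℂ _ _)
  refine ⟨algebraicType s, {v | MvPolynomial.eval (fun i => c i v) f ≠ 0},
    ⟨{MvPolynomial.rename c f}, ?_⟩, ?_, ?_⟩
  · ext v
    simp only [Set.mem_ofPred_eq, Set.mem_singleton_iff, exists_eq_left, MvPolynomial.eval_rename]
    rfl
  · have : ∃ y : n ⊕ n → ℂ, MvPolynomial.eval y f ≠ 0 := by
      by_contra! h
      exact hf0 (MvPolynomial.funext fun y => (h y).trans (map_zero _).symm)
    obtain ⟨y, hy⟩ := this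
    refine ⟨(bs.constr ℂ (y ∘ Sum.inl), bs.constr ℂ (y ∘ Sum.inr)), ?_⟩
    have : (fun i => c i (bs.constr ℂ (y ∘ Sum.inl), bs.constr ℂ (y ∘ Sum.inr))) = y := by
      ext (i | i)
      · exact bs.constr_basis ℂ _ i
      · exact bs.constr_basis ℂ _ i
    rw [Set.mem_ofPred_eq, this]
    exact hy
  · rintro ⟨x, a⟩ hv
    let p : R →ₐ[ℂ] ℂ := MvPolynomial.aeval fun i => c i (x, a)
    obtain ⟨A, φ, hA, hφ⟩ := hf p (by
      change MvPolynomial.aeval _ f ≠ 0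
      rwa [MvPolynomial.aeval_eq_eval])
    -- The forms have polynomial entries, which lie in the subring and specialize to their values at
    -- (x, a).
    have hN : ∀ M : Matrix n n R, ∃ N : Matrix n n A, N.map A.subtype = M.map (algebraMap R Ω) ∧
        N.map φ = M.map p := fun M =>
      ⟨Matrix.of fun i j => ⟨_, (hφ (M i j)).1⟩, rfl, by ext i j; exact (hφ (M i j)).2⟩
    obtain ⟨NA, hNA, hNA'⟩ := hN (genericLieMatrix bs Sum.inl)
    obtain ⟨NB, hNB, hNB'⟩ := hN (genericLieMatrix bs Sum.inr)
    refine hS A φ hA NA NB hNA hNB _ _ ?_ ?_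
    · rw [hNA']
      exact aeval_genericLieMatrix bs Sum.inl _ _ fun k => rfl
    · rw [hNB']
      exact aeval_genericLieMatrix bs Sum.inr _ _ fun k => rfl

variable {L : Type*} [LieRing L] [LieAlgebra ℂ L] [FiniteDimensional ℂ L]

theorem isGenericJKType_jkInvariants : IsGenericJKType L (jkInvariants L) := by
  have h := exists_isGenericJKType L
  rw [jkInvariants, dif_pos h]
  exact h.choose_spec

theorem HasAlgebraicType.unique {K V : Type*} [Field K] [AddCommGroup V] [Module K V]
    [FiniteDimensional K V] {A B : LinearMap.BilinForm K V} {T T' : Multiset JKInvariant}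
    (h : HasAlgebraicType A B T) (h' : HasAlgebraicType A B T') : T = T' := by
  obtain ⟨s, hs, rfl⟩ := h
  obtain ⟨s', hs', rfl⟩ := h'
  exact hs.algebraicType_eq hs'

/-- The generic algebraic type is unique. -/
theorem isGenericJKType_iff {T : Multiset JKInvariant} :
    IsGenericJKType L T ↔ T = jkInvariants L := by
  refine ⟨fun ⟨U, hU, hU', h⟩ => ?_, fun h => h ▸ isGenericJKType_jkInvariants⟩
  obtain ⟨W, hW, hW', h'⟩ := isGenericJKType_jkInvariants (L := L)
  obtain ⟨p, hp, hp'⟩ := hU.inter_nonempty hW hU' hW'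
  exact (h p hp).unique (h' p hp')

end Generic

/-! ### Additivity of types and disjointness of eigenvalues -/

section Sums

variable {K : Type*} {s s₁ s₂ : Multiset (JKBlock K)}

theorem jordanRows_add (s₁ s₂ : Multiset (JKBlock K)) (μ : OnePoint K) :
    jordanRows (s₁ + s₂) μ = jordanRows s₁ μ + jordanRows s₂ μ := by
  simp only [jordanRows, Multiset.filter_add, Multiset.map_add]

theorem kroneckerRows_add (s₁ s₂ : Multiset (JKBlock K)) :
    kroneckerRows (s₁ + s₂) = kroneckerRows s₁ + kroneckerRows s₂ := by
  simp only [kroneckerRows, Multiset.filter_add, Multiset.map_add]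

open Classical in
theorem jkEigenvalues_add (s₁ s₂ : Multiset (JKBlock K)) :
    jkEigenvalues (s₁ + s₂) = jkEigenvalues s₁ ∪ jkEigenvalues s₂ := by
  ext μ
  simp only [mem_jkEigenvalues, Finset.mem_union, Multiset.mem_add, or_and_right, exists_or]

theorem jordanRows_eq_zero {μ : OnePoint K} (h : μ ∉ jkEigenvalues s) : jordanRows s μ = 0 :=
  not_not.1 fun h' => h (mem_jkEigenvalues_iff_jordanRows.2 h')

/-- Algebraic types add up if there are no common eigenvalues. -/
theorem algebraicType_add (h : Disjoint (jkEigenvalues s₁) (jkEigenvalues s₂)) :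
    algebraicType (s₁ + s₂) = algebraicType s₁ + algebraicType s₂ := by
  classical
  simp only [algebraicType, kroneckerSizes_eq, kroneckerRows_add, jkEigenvalues_add,
    jordanSizes_eq, jordanRows_add, Multiset.map_add]
  rw [← Finset.disjUnion_eq_union _ _ h, Finset.disjUnion_val, Multiset.map_add,
    Multiset.map_congr (rfl : (jkEigenvalues s₁).val = _) fun μ (hμ : μ ∈ jkEigenvalues s₁) => by
      rw [jordanRows_eq_zero (Finset.disjoint_left.1 h hμ), Multiset.map_zero, add_zero],
    Multiset.map_congr (rfl : (jkEigenvalues s₂).val = _) fun μ (hμ : μ ∈ jkEigenvalues s₂) => by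
      rw [jordanRows_eq_zero (Finset.disjoint_right.1 h hμ), Multiset.map_zero, zero_add]]
  exact add_add_add_comm _ _ _ _

/-- Whether an element of an algebraic type is a Jordan tuple. -/
def JKInvariant.isJordan : JKInvariant → Bool
  | jordanTuple _ => true
  | kroneckerSize _ => false

theorem countP_algebraicType (s : Multiset (JKBlock K)) :
    (algebraicType s).countP (fun j => j.isJordan = true) = (jkEigenvalues s).card := by
  rw [algebraicType, Multiset.countP_add, Multiset.countP_map, Multiset.countP_map]
  simp [JKInvariant.isJordan]

theorem countP_algebraicType' (s : Multiset (JKBlock K)) :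
    (algebraicType s).countP (fun j => ¬ j.isJordan = true) = (kroneckerRows s).card := by
  rw [algebraicType, Multiset.countP_add, Multiset.countP_map, Multiset.countP_map]
  simp [JKInvariant.isJordan, kroneckerSizes_eq]

/-- Used to cancel the Kronecker contribution when kernel dimensions of two pencils of equal type
are compared. -/
theorem card_kroneckerRows_eq (h : algebraicType s₁ = algebraicType s₂) :
    (kroneckerRows s₁).card = (kroneckerRows s₂).card := by
  rw [← countP_algebraicType', h, countP_algebraicType']

/-- There is one Jordan tuple per distinct eigenvalue, so additivity of types makes the union of the
two eigenvalue sets as large as the sum of their sizes. -/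
theorem disjoint_jkEigenvalues (h : algebraicType (s₁ + s₂) = algebraicType s₁ + algebraicType s₂) :
    Disjoint (jkEigenvalues s₁) (jkEigenvalues s₂) := by
  classical
  rw [← Finset.card_union_eq_card_add_card, ← jkEigenvalues_add, ← countP_algebraicType, h,
    Multiset.countP_add, countP_algebraicType, countP_algebraicType]

end Sums

/-! ### Moving the eigenvalues of a pencil -/

section Shift

variable {K V : Type*} [Field K] [AddCommGroup V] [Module K V] [FiniteDimensional K V]
  {A B : LinearMap.BilinForm K V} {s s' : Multiset (JKBlock K)}

theorem HasJKBlocks.finrank_ker_coe (h : HasJKBlocks A B s) (μ : K) :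
    Module.finrank K (LinearMap.ker (A + (-μ) • B)) =
      2 * (jordanRows s (μ : OnePoint K)).card + (kroneckerRows s).card := by
  rw [← h.finrank_ker]
  change _ = Module.finrank K (LinearMap.ker ((1 : K) • A + (-μ) • B))
  rw [one_smul]

theorem HasJKBlocks.finrank_ker_infty (h : HasJKBlocks A B s) :
    Module.finrank K (LinearMap.ker B) =
      2 * (jordanRows s OnePoint.infty).card + (kroneckerRows s).card := by
  rw [← h.finrank_ker]
  change _ = Module.finrank K (LinearMap.ker ((0 : K) • A + (1 : K) • B))
  rw [zero_smul, zero_add, one_smul]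

/-- A generic change of the second form of a pencil gets rid of the eigenvalue `∞`. -/
theorem HasJKBlocks.infty_notMem (h : HasJKBlocks A B s) {t : K} (ht : t ≠ 0)
    (hs : ((-t⁻¹ : K) : OnePoint K) ∉ jkEigenvalues s) (h' : HasJKBlocks A (B + t • A) s')
    (hk : (kroneckerRows s).card = (kroneckerRows s').card) :
    OnePoint.infty ∉ jkEigenvalues s' := by
  have h1 := h.finrank_ker_coe (-t⁻¹)
  -- Up to a scalar, the new second form is the form of the old pencil that tests the eigenvalue
  -- -t⁻¹.
  have h2 : A + (-(-t⁻¹)) • B = t⁻¹ • (B + t • A) := by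
    rw [smul_add, smul_smul, inv_mul_cancel₀ ht, one_smul, neg_neg, add_comm]
  rw [h2, LinearMap.ker_smul _ _ (inv_ne_zero ht), h'.finrank_ker_infty, jordanRows_eq_zero hs,
    Multiset.card_zero] at h1
  rw [mem_jkEigenvalues_iff_jordanRows, not_not, ← Multiset.card_eq_zero]
  omega

/-- Adding a multiple of the second form to the first one shifts the eigenvalues. -/
theorem HasJKBlocks.mem_jkEigenvalues_add (h : HasJKBlocks A B s) {t : K}
    (h' : HasJKBlocks (A + t • B) B s')
    (hk : (kroneckerRows s).card = (kroneckerRows s').card) {μ : K}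
    (hμ : (μ : OnePoint K) ∈ jkEigenvalues s') : ((μ - t : K) : OnePoint K) ∈ jkEigenvalues s := by
  have h1 := h.finrank_ker_coe (μ - t)
  have h2 : A + (-(μ - t)) • B = A + t • B + (-μ) • B := by
    rw [add_assoc, ← add_smul, neg_sub, sub_eq_add_neg]
  rw [h2, h'.finrank_ker_coe] at h1
  rw [mem_jkEigenvalues_iff_jordanRows, Ne, ← Multiset.card_eq_zero] at hμ ⊢
  omega

/-- The eigenvalue ∞ is detected by the dimension of ker B, and B does not change. -/
theorem HasJKBlocks.infty_notMem_add (h : HasJKBlocks A B s) {t : K}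
    (h' : HasJKBlocks (A + t • B) B s')
    (hk : (kroneckerRows s).card = (kroneckerRows s').card)
    (hs : OnePoint.infty ∉ jkEigenvalues s) : OnePoint.infty ∉ jkEigenvalues s' := by
  have h1 := h.finrank_ker_infty
  rw [h'.finrank_ker_infty] at h1
  rw [mem_jkEigenvalues_iff_jordanRows, not_not, ← Multiset.card_eq_zero] at hs ⊢
  omega

end Shift

/-! ### Separating the eigenvalues of the summands -/

section Product

variable {L₁ L₂ : Type*} [LieRing L₁] [LieAlgebra ℂ L₁] [LieRing L₂] [LieAlgebra ℂ L₂]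

/-- The blocks of two pencils together are the blocks of their direct sum. -/
theorem hasJKBlocks_prod {x₁ a₁ : Module.Dual ℂ L₁} {x₂ a₂ : Module.Dual ℂ L₂}
    {s₁ s₂ : Multiset (JKBlock ℂ)} (h₁ : HasJKBlocks (lieForm x₁) (lieForm a₁) s₁)
    (h₂ : HasJKBlocks (lieForm x₂) (lieForm a₂) s₂) :
    HasJKBlocks (lieForm (LinearMap.coprod x₁ x₂)) (lieForm (LinearMap.coprod a₁ a₂))
      (s₁ + s₂) :=
  HasJKBlocks.add (LinearEquiv.refl ℂ (L₁ × L₂)) (fun _ _ => rfl) (fun _ _ => rfl) h₁ h₂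

/-- In every non-empty Zariski open set on which the two pencils have constant algebraic types there
are points where the two pencils have no common eigenvalues. -/
theorem exists_disjoint_jkEigenvalues [FiniteDimensional ℂ L₁]
    {U : Set (Module.Dual ℂ (L₁ × L₂) × Module.Dual ℂ (L₁ × L₂))} {T₁ T₂ : Multiset JKInvariant}
    (hU : IsZariskiOpen ℂ U) (hne : U.Nonempty)
    (h : ∀ (x₁ a₁ : Module.Dual ℂ L₁) (x₂ a₂ : Module.Dual ℂ L₂),
      (LinearMap.coprod x₁ x₂, LinearMap.coprod a₁ a₂) ∈ U →
        HasAlgebraicType (lieForm x₁) (lieForm a₁) T₁ ∧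
        HasAlgebraicType (lieForm x₂) (lieForm a₂) T₂) :
    ∃ (x₁ a₁ : Module.Dual ℂ L₁) (x₂ a₂ : Module.Dual ℂ L₂) (s₁ s₂ : Multiset (JKBlock ℂ)),
      (LinearMap.coprod x₁ x₂, LinearMap.coprod a₁ a₂) ∈ U ∧
      HasJKBlocks (lieForm x₁) (lieForm a₁) s₁ ∧ HasJKBlocks (lieForm x₂) (lieForm a₂) s₂ ∧
      algebraicType s₁ = T₁ ∧ algebraicType s₂ = T₂ ∧
      Disjoint (jkEigenvalues s₁) (jkEigenvalues s₂) := by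
  have hfin : ∀ s : Multiset (JKBlock ℂ), {μ : ℂ | (μ : OnePoint ℂ) ∈ jkEigenvalues s}.Finite :=
    fun s => (jkEigenvalues s).finite_toSet.preimage OnePoint.coe_injective.injOn
  obtain ⟨⟨x, a⟩, hxa⟩ := hne
  obtain ⟨x₁, x₂, rfl⟩ : ∃ x₁ x₂, x = LinearMap.coprod x₁ x₂ :=
    ⟨_, _, (LinearMap.coprod_comp_inl_inr x).symm⟩
  obtain ⟨a₁, a₂, rfl⟩ : ∃ a₁ a₂, a = LinearMap.coprod a₁ a₂ :=
    ⟨_, _, (LinearMap.coprod_comp_inl_inr a).symm⟩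
  obtain ⟨⟨s₁, hs₁, hT₁⟩, s₂, hs₂, hT₂⟩ := h _ _ _ _ hxa
  -- First move: a₁ becomes a₁ + t x₁. Finitely many t leave U, and finitely many make -t⁻¹ an
  -- eigenvalue; any other non-zero t removes ∞.
  have hbad := hU.finite_line (v := (LinearMap.coprod x₁ x₂, LinearMap.coprod a₁ a₂))
    (w := (0, LinearMap.coprod x₁ 0)) (t₀ := 0) (by rwa [zero_smul, add_zero])
  have hinv : Function.Injective fun t : ℂ => -t⁻¹ := neg_injective.comp inv_injective
  obtain ⟨t, ht⟩ := ((hbad.union (Set.finite_singleton 0)).union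
    ((hfin s₁).preimage hinv.injOn)).infinite_compl.nonempty
  simp only [Set.mem_compl_iff, Set.mem_union, Set.mem_ofPred_eq, not_or, not_not,
    Set.mem_singleton_iff, Set.mem_preimage] at ht
  obtain ⟨⟨htU, ht0⟩, hts⟩ := ht
  have e1 : ((LinearMap.coprod x₁ x₂, LinearMap.coprod a₁ a₂) + t • (0, LinearMap.coprod x₁ 0) :
      Module.Dual ℂ (L₁ × L₂) × Module.Dual ℂ (L₁ × L₂)) =
      (LinearMap.coprod x₁ x₂, LinearMap.coprod (a₁ + t • x₁) a₂) := by
    ext <;> simp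
  rw [e1] at htU
  obtain ⟨⟨r₁, hr₁, hR₁⟩, -⟩ := h _ _ _ _ htU
  have hinf := hs₁.infty_notMem ht0 hts hr₁ (card_kroneckerRows_eq (hT₁.trans hR₁.symm))
  set b₁ := a₁ + t • x₁
  -- Second move: x₁ becomes x₁ + u b₁, which translates the eigenvalues by u. A collision with the
  -- second pencil would make u a difference of an eigenvalue of `s₂` and one of `r₁`.
  have hbad' := hU.finite_line (v := (LinearMap.coprod x₁ x₂, LinearMap.coprod b₁ a₂))
    (w := (LinearMap.coprod b₁ 0, 0)) (t₀ := 0) (by rwa [zero_smul, add_zero])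
  obtain ⟨u, hu⟩ := (hbad'.union ((hfin s₂).image2 (· - ·) (hfin r₁))).infinite_compl.nonempty
  simp only [Set.mem_compl_iff, Set.mem_union, Set.mem_ofPred_eq, not_or, not_not] at hu
  obtain ⟨huU, hus⟩ := hu
  have e2 : ((LinearMap.coprod x₁ x₂, LinearMap.coprod b₁ a₂) + u • (LinearMap.coprod b₁ 0, 0) :
      Module.Dual ℂ (L₁ × L₂) × Module.Dual ℂ (L₁ × L₂)) =
      (LinearMap.coprod (x₁ + u • b₁) x₂, LinearMap.coprod b₁ a₂) := by
    ext <;> simp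
  rw [e2] at huU
  obtain ⟨⟨q₁, hq₁, hQ₁⟩, -⟩ := h _ _ _ _ huU
  have hk := card_kroneckerRows_eq (hR₁.trans hQ₁.symm)
  refine ⟨_, _, _, _, q₁, s₂, huU, hq₁, hs₂, hQ₁, hT₂, Finset.disjoint_left.2 fun μ hμ hμ' => ?_⟩
  induction μ using OnePoint.rec with
  | infty => exact hr₁.infty_notMem_add hq₁ hk hinf hμ
  | coe μ => exact hus ⟨μ, hμ', μ - u, hr₁.mem_jkEigenvalues_add hq₁ hk hμ, sub_sub_cancel μ u⟩

end Product

/-! ### The theorem for direct sums -/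

/-- Every product of Lie algebras has a non-empty Zariski open set of pairs at which the pencil and
its restrictions to both factors are generic. -/
theorem exists_isZariskiOpen_generic (L₁ L₂ : Type*) [LieRing L₁] [LieAlgebra ℂ L₁]
    [FiniteDimensional ℂ L₁] [LieRing L₂] [LieAlgebra ℂ L₂] [FiniteDimensional ℂ L₂] :
    ∃ U : Set (Module.Dual ℂ (L₁ × L₂) × Module.Dual ℂ (L₁ × L₂)), IsZariskiOpen ℂ U ∧
      U.Nonempty ∧ ∀ (x₁ a₁ : Module.Dual ℂ L₁) (x₂ a₂ : Module.Dual ℂ L₂),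
      (LinearMap.coprod x₁ x₂, LinearMap.coprod a₁ a₂) ∈ U →
        HasAlgebraicType (lieForm x₁) (lieForm a₁) (jkInvariants L₁) ∧
        HasAlgebraicType (lieForm x₂) (lieForm a₂) (jkInvariants L₂) ∧
        HasAlgebraicType (lieForm (LinearMap.coprod x₁ x₂)) (lieForm (LinearMap.coprod a₁ a₂))
          (jkInvariants (L₁ × L₂)) := by
  obtain ⟨U₁, hU₁, hne₁, h₁⟩ := isGenericJKType_jkInvariants (L := L₁)
  obtain ⟨U₂, hU₂, hne₂, h₂⟩ := isGenericJKType_jkInvariants (L := L₂)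
  obtain ⟨U₃, hU₃, hne₃, h₃⟩ := isGenericJKType_jkInvariants (L := L₁ × L₂)
  obtain ⟨f₁, hf₁⟩ : ∃ f : Module.Dual ℂ (L₁ × L₂) × Module.Dual ℂ (L₁ × L₂) →ₗ[ℂ]
      Module.Dual ℂ L₁ × Module.Dual ℂ L₁, ∀ x₁ a₁ x₂ a₂,
      f (LinearMap.coprod x₁ x₂, LinearMap.coprod a₁ a₂) = (x₁, a₁) :=
    ⟨(LinearMap.inl ℂ L₁ L₂).dualMap.prodMap (LinearMap.inl ℂ L₁ L₂).dualMap,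
      fun x₁ a₁ x₂ a₂ => Prod.ext (LinearMap.coprod_inl x₁ x₂) (LinearMap.coprod_inl a₁ a₂)⟩
  obtain ⟨f₂, hf₂⟩ : ∃ f : Module.Dual ℂ (L₁ × L₂) × Module.Dual ℂ (L₁ × L₂) →ₗ[ℂ]
      Module.Dual ℂ L₂ × Module.Dual ℂ L₂, ∀ x₁ a₁ x₂ a₂,
      f (LinearMap.coprod x₁ x₂, LinearMap.coprod a₁ a₂) = (x₂, a₂) :=
    ⟨(LinearMap.inr ℂ L₁ L₂).dualMap.prodMap (LinearMap.inr ℂ L₁ L₂).dualMap,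
      fun x₁ a₁ x₂ a₂ => Prod.ext (LinearMap.coprod_inr x₁ x₂) (LinearMap.coprod_inr a₁ a₂)⟩
  have hV₁ := hU₁.preimage f₁
  have hV₂ := hU₂.preimage f₂
  have hne₁' : (f₁ ⁻¹' U₁).Nonempty := by
    obtain ⟨⟨x, a⟩, h⟩ := hne₁
    exact ⟨(LinearMap.coprod x 0, LinearMap.coprod a 0), by rwa [Set.mem_preimage, hf₁]⟩
  have hne₂' : (f₂ ⁻¹' U₂).Nonempty := by
    obtain ⟨⟨x, a⟩, h⟩ := hne₂
    exact ⟨(LinearMap.coprod 0 x, LinearMap.coprod 0 a), by rwa [Set.mem_preimage, hf₂]⟩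
  have hV := hV₁.inter hV₂
  refine ⟨_, hU₃.inter hV, hU₃.inter_nonempty hV hne₃ (hV₁.inter_nonempty hV₂ hne₁' hne₂'), ?_⟩
  rintro x₁ a₁ x₂ a₂ ⟨h, h', h''⟩
  have k₁ : (x₁, a₁) ∈ U₁ := by rw [← hf₁ x₁ a₁ x₂ a₂]; exact h'
  have k₂ : (x₂, a₂) ∈ U₂ := by rw [← hf₂ x₁ a₁ x₂ a₂]; exact h''
  exact ⟨h₁ (x₁, a₁) k₁, h₂ (x₂, a₂) k₂, h₃ (_, _) h⟩

theorem mainTheorem9 (𝔤₁ 𝔤₂ : Type*)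
    [LieRing 𝔤₁] [LieAlgebra ℂ 𝔤₁] [FiniteDimensional ℂ 𝔤₁]
    [LieRing 𝔤₂] [LieAlgebra ℂ 𝔤₂] [FiniteDimensional ℂ 𝔤₂] :
    (∀ T, IsGenericJKType 𝔤₁ T ↔ T = jkInvariants 𝔤₁) ∧
    (∀ T, IsGenericJKType 𝔤₂ T ↔ T = jkInvariants 𝔤₂) ∧
    (∀ T, IsGenericJKType (𝔤₁ × 𝔤₂) T ↔ T = jkInvariants (𝔤₁ × 𝔤₂)) ∧
    jkInvariants (𝔤₁ × 𝔤₂) = jkInvariants 𝔤₁ + jkInvariants 𝔤₂ ∧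
    ∃ U : Set (Module.Dual ℂ (𝔤₁ × 𝔤₂) × Module.Dual ℂ (𝔤₁ × 𝔤₂)),
      IsZariskiOpen ℂ U ∧ U.Nonempty ∧
      ∀ (x₁ a₁ : Module.Dual ℂ 𝔤₁) (x₂ a₂ : Module.Dual ℂ 𝔤₂),
        (LinearMap.coprod x₁ x₂, LinearMap.coprod a₁ a₂) ∈ U →
          HasAlgebraicType (lieForm x₁) (lieForm a₁) (jkInvariants 𝔤₁) ∧
          HasAlgebraicType (lieForm x₂) (lieForm a₂) (jkInvariants 𝔤₂) ∧
          ∀ s₁ s₂ : Multiset (JKBlock ℂ),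
            HasJKBlocks (lieForm x₁) (lieForm a₁) s₁ →
            HasJKBlocks (lieForm x₂) (lieForm a₂) s₂ →
              HasJKBlocks (lieForm (LinearMap.coprod x₁ x₂)) (lieForm (LinearMap.coprod a₁ a₂))
                (s₁ + s₂) ∧
              algebraicType (s₁ + s₂) = jkInvariants (𝔤₁ × 𝔤₂) ∧
              Disjoint (jkEigenvalues s₁) (jkEigenvalues s₂) := by

  obtain ⟨U, hU, hne, htypes⟩ := exists_isZariskiOpen_generic 𝔤₁ 𝔤₂
  -- All types involved are constant on U, so a single point with disjoint eigenvalues suffices.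
  have hadd : jkInvariants (𝔤₁ × 𝔤₂) = jkInvariants 𝔤₁ + jkInvariants 𝔤₂ := by
    obtain ⟨x₁, a₁, x₂, a₂, s₁, s₂, hmem, hs₁, hs₂, hT₁, hT₂, hdisj⟩ :=
      exists_disjoint_jkEigenvalues hU hne fun x₁ a₁ x₂ a₂ h =>
        ⟨(htypes x₁ a₁ x₂ a₂ h).1, (htypes x₁ a₁ x₂ a₂ h).2.1⟩
    rw [← hT₁, ← hT₂, ← algebraicType_add hdisj]
    exact (htypes _ _ _ _ hmem).2.2.unique ⟨_, hasJKBlocks_prod hs₁ hs₂, rfl⟩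
  refine ⟨fun _ => isGenericJKType_iff, fun _ => isGenericJKType_iff, fun _ => isGenericJKType_iff,
    hadd, U, hU, hne, fun x₁ a₁ x₂ a₂ hmem => ?_⟩
  obtain ⟨ht₁, ht₂, ht⟩ := htypes x₁ a₁ x₂ a₂ hmem
  refine ⟨ht₁, ht₂, fun s₁ s₂ hs₁ hs₂ => ?_⟩
  have hs := hasJKBlocks_prod hs₁ hs₂
  have hT : algebraicType (s₁ + s₂) = jkInvariants (𝔤₁ × 𝔤₂) :=
    HasAlgebraicType.unique ⟨_, hs, rfl⟩ ht
  -- Conversely the formula, now known, yields disjointness at every point of U by counting, so U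
  -- need not be shrunk.
  refine ⟨hs, hT, disjoint_jkEigenvalues ?_⟩
  rw [hT, hadd, ht₁.unique ⟨_, hs₁, rfl⟩, ht₂.unique ⟨_, hs₂, rfl⟩]
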